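/- Let $E_n, A_n, D_n$ denote the positive definite root lattices (roots of square norm $2$), $U$ the hyperbolic plane, and $I$ the rank one lattice with a generator of square norm $1$. Let $\Lambda = 2E_8\perp 2U\perp 3I$ (the odd unimodular lattice of signature $(21,2)$), let $\eta\in\Lambda$ be the sum of the three standard generators of $3I$, let $\Lambda_o=\eta^\perp$ (isometric to $2E_8\perp 2U\perp A_2$), and let $\Gamma$ be the stabilizer of $\eta$ in $\mathrm{O}(\Lambda)$. Let $\Lambda_1 = 2E_8\perp A_2\perp U$. For an integral lattice $M$ with dual lattice $M^*\subset M\otimes\mathbb{Q}$, a long root is a vector of $M$ of square norm $2$ and a short root is a vector of $M^*$ of square norm $2/3$. We write $A_1^s$ for $\{\pm r\}$ with $r$ a short root, and $G_2$ for the root system of that type with long roots of square norm $2$ and short roots of square norm $2/3$; in types $A_n,D_n,E_n$ all roots have square norm $2$. For a finite root system $R_0$ perpendicular to a nonzero isotropic vector $\delta$, the affine root system $\hat R_0$ with nil vector $\delta$ is $\{\alpha+n\delta : \alpha\in R_0,\ n\in\mathbb{Z}\}$; hats are distributed over orthogonal sums, all summands having the same nil vector. (1) For a primitive isotropic vector $v\in\Lambda_1$,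 let $R_v$ be the set of (long and short) roots of $\Lambda_1$ perpendicular to $v$, i.e. the roots whose reflections fix $v$. Then $R_v$ is an affine root system with nil vector $v$, of exactly one of the six types $$2\hat E_8\perp\hat G_2,\quad \hat D_{16}\perp\hat G_2,\quad \hat A_{17}\perp\hat A_1^s,\quad \hat E_7\perp\hat D_{10}\perp\hat A_1^s,\quad 3\hat E_6,\quad \hat D_7\perp\hat A_{11};$$ each of these types occurs, and two primitive isotropic vectors $v,w\in\Lambda_1$ lie in the same $\mathrm{O}(\Lambda_1)$-orbit if and only if $R_v$ and $R_w$ have the same type. (2) Let $K\subset\Lambda_o$ be a primitive isotropic sublattice of rank $2$. Then $K^\perp/K$ is a positive definite even lattice. Let $R(K)$ be the union of those irreducible components of the system of all (long and short) roots of $K^\perp/K$ that contain no short root. Then $R(K)$ is a root system of exactly one of the six types $$2E_8,\quad D_{16},\quad A_{17},\quad E_7\perp D_{10},\quad 3E_6,\quad D_7\perp A_{11},$$ and each of these types occurs. For two such sublattices $K,K'$ the following are equivalent: $K$ and $K'$ lie in the same $\Gamma$-orbit; the lattices $K^\perp/K$ and $K'^\perp/K'$ are isometric; $R(K)$ and $R(K')$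 have the same type. -/

import Mathlib

open scoped TensorProduct

namespace CubicFourfold

section Lattices

variable {M : Type*} [AddCommGroup M] (B : LinearMap.BilinForm ℤ M)

/-- A vector of a lattice is primitive if it is not a proper integral multiple of another vector
(so that in particular it is nonzero). -/
def IsPrimitiveVector (v : M) : Prop := ∀ (n : ℤ) (w : M), v = n • w → IsUnit n

/-- A sublattice `K ⊆ M` is primitive if `M / K` is torsion free. -/
def IsPrimitiveSublattice (K : Submodule ℤ M) : Prop :=
  ∀ (n : ℤ) (x : M), n ≠ 0 → n • x ∈ K → x ∈ K

/-- The primitive isotropic sublattices of rank two. -/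
structure IsPrimitiveIsotropicPlane (K : Submodule ℤ M) : Prop where
  primitive : IsPrimitiveSublattice K
  isotropic : ∀ x ∈ K, ∀ y ∈ K, B x y = 0
  rank_two : Module.finrank ℤ K = 2

/-- The lattice `K^⊥ / (K ∩ K^⊥)`; it is `K^⊥ / K` if `K` is isotropic. -/
abbrev PerpQuot (K : Submodule ℤ M) : Type _ :=
  ↥(B.orthogonal K) ⧸ K.submoduleOf (B.orthogonal K)

/-- The bilinear form induced by `B` on `K^⊥ / (K ∩ K^⊥)`. -/
def perpQuotForm (hB : ∀ x y, B x y = B y x) (K : Submodule ℤ M) :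
    LinearMap.BilinForm ℤ (PerpQuot B K) :=
  (Submodule.liftQ (K.submoduleOf (B.orthogonal K))
    (Submodule.liftQ (K.submoduleOf (B.orthogonal K)) (B.restrict (B.orthogonal K))
      (fun x hx => LinearMap.ext fun y => y.2 x.1 hx)).flip
    (fun x hx => LinearMap.ext fun y => by
      obtain ⟨y, rfl⟩ := Submodule.Quotient.mk_surjective _ y
      exact (hB y.1 x.1).trans (y.2 x.1 hx))).flip

theorem perpQuotForm_mk (hB : ∀ x y, B x y = B y x) (K : Submodule ℤ M)
    (x y : B.orthogonal K) :
    perpQuotForm B hB K (Submodule.Quotient.mk x) (Submodule.Quotient.mk y) = B x.1 y.1 := rfl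

/-- The form on `ℚ ⊗ M` that extends `B`. -/
noncomputable abbrev rationalForm : LinearMap.BilinForm ℚ (ℚ ⊗[ℤ] M) :=
  LinearMap.BilinForm.baseChange ℚ B

/-- The vector of `M`, as an element of `ℚ ⊗ M`. -/
noncomputable abbrev toRational (m : M) : ℚ ⊗[ℤ] M := (1 : ℚ) ⊗ₜ[ℤ] m

/-- The dual lattice `M^* = {x ∈ ℚ ⊗ M | x · m ∈ ℤ for all m ∈ M}`. -/
def dualLattice : Set (ℚ ⊗[ℤ] M) :=
  {x | ∀ m : M, ∃ n : ℤ, rationalForm B x (toRational m) = n}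

/-- The long roots: the vectors of `M` of square norm `2`. -/
def longRoots : Set (ℚ ⊗[ℤ] M) :=
  {x | ∃ m : M, x = toRational m ∧ B m m = 2}

/-- The short roots: the vectors of `M^*` of square norm `2/3`. -/
def shortRoots : Set (ℚ ⊗[ℤ] M) :=
  {x | x ∈ dualLattice B ∧ rationalForm B x x = 2 / 3}

/-- All roots, long and short. -/
def roots : Set (ℚ ⊗[ℤ] M) := longRoots B ∪ shortRoots B

/-- The root system in the stabilizer of `v`: the roots perpendicular to `v`, in other words the
roots whose reflection fixes `v`. -/
def rootsPerp (v : M) : Set (ℚ ⊗[ℤ] M) :=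
  {r | r ∈ roots B ∧ rationalForm B r (toRational v) = 0}

end Lattices

section RootSystems

variable {V : Type*} [AddCommGroup V] [Module ℚ V] (Q : LinearMap.BilinForm ℚ V)

/-- The orbit of the family `b` under the group generated by the orthogonal reflections in its
members. -/
inductive WeylOrbit {ι : Type} (b : ι → V) : V → Prop
  | simple (i : ι) : WeylOrbit b (b i)
  | reflect (i : ι) (x : V) : WeylOrbit b x →
      WeylOrbit b (x - (2 * Q x (b i) / Q (b i) (b i)) • b i)

/-- `R` is a finite root system with a root basis `b` whose Gram matrix is the given (positive
definite) matrix `G`, so that `R` is the union of the Weyl group orbits of the members of `b`. -/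
def IsOfFiniteType {ι : Type} (R : Set V) (G : Matrix ι ι ℚ) : Prop :=
  ∃ b : ι → V, (∀ i j, Q (b i) (b j) = G i j) ∧ R = {x | WeylOrbit Q b x}

/-- `R` is the affine root system with primitive nil vector `δ` (that is, the affine completion
`{α + n δ | α ∈ R₀, n ∈ ℤ}`) of a finite root system `R₀` which has a root basis with Gram
matrix `G`. -/
def IsOfAffineType {ι : Type} (R : Set V) (δ : V) (G : Matrix ι ι ℚ) : Prop :=
  δ ≠ 0 ∧ Q δ δ = 0 ∧ ∃ b : ι → V, (∀ i j, Q (b i) (b j) = G i j) ∧ (∀ i, Q δ (b i) = 0) ∧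
    R = {x | ∃ (α : V) (n : ℤ), WeylOrbit Q b α ∧ x = α + n • δ}

/-- The union of the irreducible components of `R` that contain no short root. The irreducible
components are the classes of the equivalence relation generated by non-orthogonality. -/
def componentsWithoutShort (R : Set V) : Set V :=
  {x | x ∈ R ∧ ∀ y, Relation.ReflTransGen (fun a b => a ∈ R ∧ b ∈ R ∧ Q a b ≠ 0) x y →
    Q y y ≠ 2 / 3}

end RootSystems

section Types

/-- The Gram matrix of the orthogonal direct sum. -/
def orthSum {R : Type*} [Zero R] {ι κ : Type} (G : Matrix ι ι R) (H : Matrix κ κ R) :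
    Matrix (ι ⊕ κ) (ι ⊕ κ) R :=
  Matrix.fromBlocks G 0 0 H

/-- The orthogonal direct sum of Gram matrices. -/
infixr:65 " ⊥ₗ " => orthSum

/-- Type `E6`, all roots of square norm `2`: the Gram matrix of a root basis is the Cartan
matrix. -/
def gramE6 : Matrix (Fin 6) (Fin 6) ℚ := CartanMatrix.E₆.map (Int.cast : ℤ → ℚ)
/-- Type `E7`, all roots of square norm `2`. -/
def gramE7 : Matrix (Fin 7) (Fin 7) ℚ := CartanMatrix.E₇.map (Int.cast : ℤ → ℚ)
/-- Type `E8`, all roots of square norm `2`. -/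
def gramE8 : Matrix (Fin 8) (Fin 8) ℚ := CartanMatrix.E₈.map (Int.cast : ℤ → ℚ)
/-- Type `Aₙ` (of rank `n`), all roots of square norm `2`. -/
def gramA (n : ℕ) : Matrix (Fin n) (Fin n) ℚ := (CartanMatrix.A n).map (Int.cast : ℤ → ℚ)
/-- Type `Dₙ` (of rank `n`), all roots of square norm `2`. -/
def gramD (n : ℕ) : Matrix (Fin n) (Fin n) ℚ := (CartanMatrix.D n).map (Int.cast : ℤ → ℚ)

/-- `A₁` spanned by a short root. -/
def gramA1s : Matrix (Fin 1) (Fin 1) ℚ := !![2 / 3]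

/-- `G₂` with long roots of square norm `2` and short roots of square norm `2/3`. -/
def gramG2 : Matrix (Fin 2) (Fin 2) ℚ := !![2, -1; -1, 2 / 3]

/-- Labels for the six cases. -/
inductive BoundaryType
  | twoE8 | D16 | A17 | E7D10 | threeE6 | D7A11

variable {V : Type*} [AddCommGroup V] [Module ℚ V] (Q : LinearMap.BilinForm ℚ V)

/-- The affine types `2Ê₈ ⊥ Ĝ₂`, `D̂₁₆ ⊥ Ĝ₂`, `Â₁₇ ⊥ Â₁ˢ`, `Ê₇ ⊥ D̂₁₀ ⊥ Â₁ˢ`, `3Ê₆` and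
`D̂₇ ⊥ Â₁₁`. -/
def HasAffineType (R : Set V) (δ : V) : BoundaryType → Prop
  | .twoE8 => IsOfAffineType Q R δ (gramE8 ⊥ₗ gramE8 ⊥ₗ gramG2)
  | .D16 => IsOfAffineType Q R δ (gramD 16 ⊥ₗ gramG2)
  | .A17 => IsOfAffineType Q R δ (gramA 17 ⊥ₗ gramA1s)
  | .E7D10 => IsOfAffineType Q R δ (gramE7 ⊥ₗ gramD 10 ⊥ₗ gramA1s)
  | .threeE6 => IsOfAffineType Q R δ (gramE6 ⊥ₗ gramE6 ⊥ₗ gramE6)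
  | .D7A11 => IsOfAffineType Q R δ (gramD 7 ⊥ₗ gramA 11)

/-- The finite types `2E₈`, `D₁₆`, `A₁₇`, `E₇ ⊥ D₁₀`, `3E₆` and `D₇ ⊥ A₁₁`. -/
def HasFiniteType (R : Set V) : BoundaryType → Prop
  | .twoE8 => IsOfFiniteType Q R (gramE8 ⊥ₗ gramE8)
  | .D16 => IsOfFiniteType Q R (gramD 16)
  | .A17 => IsOfFiniteType Q R (gramA 17)
  | .E7D10 => IsOfFiniteType Q R (gramE7 ⊥ₗ gramD 10)
  | .threeE6 => IsOfFiniteType Q R (gramE6 ⊥ₗ gramE6 ⊥ₗ gramE6)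
  | .D7A11 => IsOfFiniteType Q R (gramD 7 ⊥ₗ gramA 11)

end Types

section TheLattices

/-- The Gram matrix of the hyperbolic plane. -/
def gramU : Matrix (Fin 2) (Fin 2) ℤ := !![0, 1; 1, 0]

/-- The index set of the standard basis of `2E₈ ⊥ A₂ ⊥ U`. -/
abbrev Index1 : Type := Fin 8 ⊕ Fin 8 ⊕ Fin 2 ⊕ Fin 2

/-- The lattice `Λ₁ = 2E₈ ⊥ A₂ ⊥ U`. -/
abbrev Lambda1 : Type := Index1 → ℤ

/-- The form of `Λ₁ = 2E₈ ⊥ A₂ ⊥ U`. -/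
noncomputable def form1 : LinearMap.BilinForm ℤ Lambda1 :=
  Matrix.toBilin' (CartanMatrix.E₈ ⊥ₗ CartanMatrix.E₈ ⊥ₗ CartanMatrix.A 2 ⊥ₗ gramU)

/-- The index set of the standard basis of `2E₈ ⊥ 2U ⊥ 3I`. -/
abbrev Index : Type := Fin 8 ⊕ Fin 8 ⊕ Fin 2 ⊕ Fin 2 ⊕ Fin 3

/-- The odd unimodular lattice `Λ = 2E₈ ⊥ 2U ⊥ 3I` of signature `(21, 2)`. -/
abbrev Lambda : Type := Index → ℤ

/-- The Gram matrix of `Λ = 2E₈ ⊥ 2U ⊥ 3I`. -/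
def gramLambda : Matrix Index Index ℤ :=
  CartanMatrix.E₈ ⊥ₗ CartanMatrix.E₈ ⊥ₗ gramU ⊥ₗ gramU ⊥ₗ (1 : Matrix (Fin 3) (Fin 3) ℤ)

/-- The form of `Λ = 2E₈ ⊥ 2U ⊥ 3I`. -/
noncomputable def form : LinearMap.BilinForm ℤ Lambda := Matrix.toBilin' gramLambda

/-- The vector `η = ε₁ + ε₂ + ε₃`, the sum of the basis vectors of `3I`. -/
def eta : Lambda :=
  Sum.elim 0 (Sum.elim 0 (Sum.elim 0 (Sum.elim 0 1)))

/-- `Λ_o`, the orthogonal complement of `η` in `Λ`. -/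
noncomputable def LambdaO : Submodule ℤ Lambda := form.orthogonal (Submodule.span ℤ {eta})

/-- The form of `Λ_o`. -/
noncomputable def formO : LinearMap.BilinForm ℤ LambdaO := form.restrict LambdaO

theorem gramLambda_transpose : gramLambda.transpose = gramLambda := by
  have hU : gramU.transpose = gramU := by decide
  simp [gramLambda, orthSum, Matrix.fromBlocks_transpose, hU]

theorem form_comm (x y : Lambda) : form x y = form y x := by
  rw [form, Matrix.toBilin'_apply', Matrix.toBilin'_apply', Matrix.dotProduct_mulVec,
    ← Matrix.mulVec_transpose, gramLambda_transpose, dotProduct_comm]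

theorem formO_comm (x y : LambdaO) : formO x y = formO y x := form_comm x.1 y.1

/-- `K` and `K'` lie in the same orbit under `Γ`, the stabilizer of `η` in the orthogonal group
of `Λ`. -/
def GammaEquivalent (K K' : Submodule ℤ LambdaO) : Prop :=
  ∃ g : form.IsometryEquiv form, g eta = eta ∧
    (K.map LambdaO.subtype).map (g.toLinearEquiv : Lambda →ₗ[ℤ] Lambda) =
      K'.map LambdaO.subtype

/-- The form of the lattice `K^⊥ / K`, for `K ⊆ Λ_o` isotropic. -/
noncomputable def quotForm (K : Submodule ℤ LambdaO) :
    LinearMap.BilinForm ℤ (PerpQuot formO K) :=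
  perpQuotForm formO formO_comm K

/-- The root system formed by the irreducible components, without short roots, of the system of
all roots (long and short) of `K^⊥ / K`. -/
noncomputable def longRootSystem (K : Submodule ℤ LambdaO) :
    Set (ℚ ⊗[ℤ] PerpQuot formO K) :=
  componentsWithoutShort (rationalForm (quotForm K)) (roots (quotForm K))

end TheLattices

end CubicFourfold

open CubicFourfold

/-! For `Λ₁`, of signature `(19, 1)`, the proof uses explicit data: 36 simple roots (24 long, 12
short), six cusps, three involutive isometries, and a vector `weylVector` of negative norm that they
fix. In the sign convention in use, the negatives of the cusps and of `weylVector` have nonnegative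
products with all simple roots, so they lie in the chamber.

The heart is `exists_isometry_cusp`. In the orbit of a primitive isotropic vector, and over all six
cusps, a pair `(y, t)` is chosen with `cuspWeight t * form1 y (cusp t)` minimal, and then `y` with
minimal product with `weylVector`. If `y` had a negative product with a simple root, the reflection
would contradict minimality; hence `y` lies in the chamber. Minimality also compares `cusp t` with
finitely many images of cusps. These linear inequalities force `form1 y (cusp t) = 0`, hence `y = ±
cusp t`. The reason is a certificate: a positive multiple of `form1`, plus the square of the product
with `cusp t`, plus a sum of products of linear functions that are nonnegative at `y`, is
nonpositive on a simplicial cone containing `y`. At an isotropic `y` the first summand vanishes and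
the others are nonnegative, so the square is zero. The six certificates are finite integer
computations (`pairsL_certL`).

At each cusp, 18 of the simple roots are orthogonal to it. Every root orthogonal to the cusp can be
reflected to a dominant one, whose norm is a quadratic form with nonnegative coefficients in its
weights; a finite search then shows that all dominant weights come from the Weyl orbits of the 18
roots (`rootsPerp_eq`). Two root bases of one system span the same lattice modulo the nil vector, so
the determinant of the Gram matrix is an invariant; it separates the six types
(`HasAffineType.unique`, `HasFiniteType.unique`).

For the planes, `Λ_o` is written as `U ⊥ Λ₁` with `U` spanned by isotropic `e`, `f`. Eichler
transvections fixing `η`, with the exchange of `e` and `f`, move every primitive isotropic vector of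
`Λ_o` to `± e` (`orbitRel_of_isPrimitiveVector`), so every plane becomes the span of `e` and a
primitive isotropic `w` in `Λ₁`. An isometry of `Λ₁` acts by `± 1` on the discriminant group of
order 3 (`exists_glue`); up to sign it therefore extends to an isometry of `Λ` that fixes `η`
(`extend`). As `w` and `-w` span the same plane with `e`, the first part leaves six standard planes.
Their quotients `K^⊥ / K` are `w^⊥ / w`, in which the same 18 roots form a root basis with nil
vector `0`. Equivalent planes have isometric quotients, isometric quotients have the same type, and
the type determines the standard plane, which closes the circle of equivalences. -/

namespace CubicFourfold

/-! ### Orthogonal sums and a criterion for positive definiteness -/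

section OrthogonalSums

theorem toBilin'_orthSum {R ι κ : Type} [CommRing R] [Fintype ι] [DecidableEq ι] [Fintype κ]
    [DecidableEq κ] (G : Matrix ι ι R) (H : Matrix κ κ R) (x y : ι ⊕ κ → R) :
    Matrix.toBilin' (G ⊥ₗ H) x y =
      Matrix.toBilin' G (fun i => x (Sum.inl i)) (fun i => y (Sum.inl i)) +
        Matrix.toBilin' H (fun i => x (Sum.inr i)) (fun i => y (Sum.inr i)) := by
  simp [Matrix.toBilin'_apply, orthSum, Fintype.sum_sum_type]

/-- A symmetric matrix with nonpositive off-diagonal entries that maps some positive vector to a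
positive vector is positive definite. -/
theorem sum_mul_mul_pos {ι : Type} [Fintype ι] {G : ι → ι → ℚ} (hs : ∀ i j, G i j = G j i)
    (ho : ∀ i j, i ≠ j → G i j ≤ 0) (m : ι → ℚ) (hm : ∀ i, 0 < m i)
    (hG : ∀ i, 0 < ∑ j, G i j * m j) {x : ι → ℚ} (hx : x ≠ 0) :
    0 < ∑ i, ∑ j, x i * G i j * x j := by
  -- The arithmetic-geometric mean inequality after rescaling `x` by `m`. Summed over all pairs, the
  -- lower bounds combine to `∑ (G m)_i x_i² / m_i`, which is positive.
  have key : ∀ i j, G i j * m j * (x i ^ 2 / m i) / 2 + G j i * m i * (x j ^ 2 / m j) / 2 ≤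
      x i * G i j * x j := by
    intro i j
    have hi := (hm i).ne'
    have hj := (hm j).ne'
    rcases eq_or_ne i j with rfl | hij
    · apply le_of_eq
      field_simp
      ring
    · rw [hs j i]
      have h : x i * G i j * x j -
          (G i j * m j * (x i ^ 2 / m i) / 2 + G i j * m i * (x j ^ 2 / m j) / 2) =
          -G i j * (m i * m j / 2) * (x i / m i - x j / m j) ^ 2 := by
        field_simp
        ring
      have h2 : 0 ≤ -G i j * (m i * m j / 2) * (x i / m i - x j / m j) ^ 2 := by
        have := ho i j hij
        have := hm i
        have := hm j
        apply mul_nonneg (mul_nonneg (by linarith) (by positivity)) (sq_nonneg _)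
      linarith
  have h1 : ∑ i, (∑ j, G i j * m j) * (x i ^ 2 / m i) ≤ ∑ i, ∑ j, x i * G i j * x j := by
    have e1 : ∑ i, (∑ j, G i j * m j) * (x i ^ 2 / m i) =
        ∑ i, ∑ j, (G i j * m j * (x i ^ 2 / m i) / 2 + G j i * m i * (x j ^ 2 / m j) / 2) := by
      simp only [Finset.sum_add_distrib]
      rw [Finset.sum_comm (f := fun i j => G j i * m i * (x j ^ 2 / m j) / 2)]
      simp only [Finset.sum_mul, ← Finset.sum_add_distrib]
      exact Finset.sum_congr rfl fun i _ => Finset.sum_congr rfl fun j _ => by ring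
    rw [e1]
    exact Finset.sum_le_sum fun i _ => Finset.sum_le_sum fun j _ => key i j
  refine lt_of_lt_of_le ?_ h1
  obtain ⟨i, hi⟩ := Function.ne_iff.1 hx
  refine Finset.sum_pos' (fun i _ => ?_) ⟨i, Finset.mem_univ i, ?_⟩
  · exact mul_nonneg (hG i).le (div_nonneg (sq_nonneg _) (hm i).le)
  · exact mul_pos (hG i) (div_pos (by have : x i ≠ 0 := hi
                                      positivity) (hm i))

end OrthogonalSums

/-! ### The forms of `E₈`, `A₂` and `U` -/

section SmallLattices

theorem formE8_apply (x y : Fin 8 → ℤ) :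
    Matrix.toBilin' CartanMatrix.E₈ x y =
      x 0 * (2 * y 0 - y 2) + x 1 * (2 * y 1 - y 3) + x 2 * (2 * y 2 - y 0 - y 3) +
      x 3 * (2 * y 3 - y 1 - y 2 - y 4) + x 4 * (2 * y 4 - y 3 - y 5) +
      x 5 * (2 * y 5 - y 4 - y 6) + x 6 * (2 * y 6 - y 5 - y 7) + x 7 * (2 * y 7 - y 6) := by
  simp [Matrix.toBilin'_apply, Fin.sum_univ_eight, CartanMatrix.E₈]
  ring

theorem formA2_apply (x y : Fin 2 → ℤ) :
    Matrix.toBilin' (CartanMatrix.A 2) x y =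
      x 0 * (2 * y 0 - y 1) + x 1 * (2 * y 1 - y 0) := by
  simp [Matrix.toBilin'_apply, Fin.sum_univ_two, CartanMatrix.A_two]
  ring

theorem formU_apply (x y : Fin 2 → ℤ) :
    Matrix.toBilin' gramU x y = x 0 * y 1 + x 1 * y 0 := by
  simp [Matrix.toBilin'_apply, Fin.sum_univ_two, gramU]

theorem formE8_even (x : Fin 8 → ℤ) : Even (Matrix.toBilin' CartanMatrix.E₈ x x) := by
  rw [formE8_apply]
  refine ⟨x 0 * (x 0 - x 2) + x 1 * (x 1 - x 3) + x 2 * (x 2 - x 3) + x 3 * (x 3 - x 4) +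
    x 4 * (x 4 - x 5) + x 5 * (x 5 - x 6) + x 6 * (x 6 - x 7) + x 7 * x 7, by ring⟩

theorem formE8_pos {x : Fin 8 → ℤ} (hx : x ≠ 0) : 0 < Matrix.toBilin' CartanMatrix.E₈ x x := by
  have h := sum_mul_mul_pos (G := fun i j => ((CartanMatrix.E₈ i j : ℤ) : ℚ))
    (fun i j => by
      have := congrFun (congrFun CartanMatrix.E₈_transpose j) i
      rw [Matrix.transpose_apply] at this
      exact_mod_cast this)
    (fun i j hij => by exact_mod_cast CartanMatrix.E₈_off_diag_nonpos i j hij)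
    -- Half the sum of the positive roots of `E₈`; the Cartan matrix maps it to the vector with all
    -- entries `1`.
    ![46, 68, 91, 135, 110, 84, 57, 29]
    (fun i => by fin_cases i <;> norm_num)
    (fun i => by fin_cases i <;> simp [Fin.sum_univ_eight, CartanMatrix.E₈] <;> norm_num)
    (x := fun i => (x i : ℚ))
    (fun h => hx (funext fun i => by have h1 := congrFun h i; simpa using h1))
  rw [Matrix.toBilin'_apply]
  exact_mod_cast h

theorem formE8_nonneg (x : Fin 8 → ℤ) : 0 ≤ Matrix.toBilin' CartanMatrix.E₈ x x := by
  rcases eq_or_ne x 0 with rfl | h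
  · simp
  · exact (formE8_pos h).le

theorem formA2_nonneg (x : Fin 2 → ℤ) : 0 ≤ Matrix.toBilin' (CartanMatrix.A 2) x x := by
  rw [formA2_apply]
  nlinarith [sq_nonneg (x 0 - x 1), sq_nonneg (x 0), sq_nonneg (x 1)]

theorem formA2_pos {x : Fin 2 → ℤ} (hx : x ≠ 0) : 0 < Matrix.toBilin' (CartanMatrix.A 2) x x := by
  refine lt_of_le_of_ne (formA2_nonneg x) fun h => hx ?_
  rw [formA2_apply] at h
  have h0 : x 0 ^ 2 = 0 := by nlinarith [sq_nonneg (x 0 - x 1), sq_nonneg (x 0), sq_nonneg (x 1)]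
  have h1 : x 1 ^ 2 = 0 := by nlinarith [sq_nonneg (x 0 - x 1), sq_nonneg (x 0), sq_nonneg (x 1)]
  funext i
  fin_cases i
  · simpa using h0
  · simpa using h1

end SmallLattices

/-! ### The hyperbolic lattice `Λ₁` and its forward cone -/

section LambdaOne

/-- The coefficient at the first basis vector of the hyperbolic plane in `Λ₁`. -/
abbrev uZero (x : Lambda1) : ℤ := x (Sum.inr (Sum.inr (Sum.inr 0)))
/-- The coefficient at the second basis vector of the hyperbolic plane in `Λ₁`. -/
abbrev uOne (x : Lambda1) : ℤ := x (Sum.inr (Sum.inr (Sum.inr 1)))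

/-- The form of `2E₈ ⊥ A₂`, on `Λ₁`. -/
noncomputable def formN : LinearMap.BilinForm ℤ Lambda1 :=
  Matrix.toBilin' (CartanMatrix.E₈ ⊥ₗ CartanMatrix.E₈ ⊥ₗ CartanMatrix.A 2 ⊥ₗ
    (0 : Matrix (Fin 2) (Fin 2) ℤ))

theorem formN_apply (x y : Lambda1) :
    formN x y =
      Matrix.toBilin' CartanMatrix.E₈ (fun i => x (Sum.inl i)) (fun i => y (Sum.inl i)) +
      (Matrix.toBilin' CartanMatrix.E₈ (fun i => x (Sum.inr (Sum.inl i)))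
        (fun i => y (Sum.inr (Sum.inl i))) +
      Matrix.toBilin' (CartanMatrix.A 2) (fun i => x (Sum.inr (Sum.inr (Sum.inl i))))
        (fun i => y (Sum.inr (Sum.inr (Sum.inl i))))) := by
  rw [formN, toBilin'_orthSum, toBilin'_orthSum, toBilin'_orthSum]
  simp

theorem form1_eq (x y : Lambda1) :
    form1 x y = formN x y + (uZero x * uOne y + uOne x * uZero y) := by
  rw [form1, formN_apply, toBilin'_orthSum, toBilin'_orthSum, toBilin'_orthSum, formU_apply]
  ring

theorem form1_comm (x y : Lambda1) : form1 x y = form1 y x := by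
  rw [form1_eq, form1_eq, formN_apply, formN_apply]
  simp only [formE8_apply, formA2_apply]
  ring

theorem formN_comm (x y : Lambda1) : formN x y = formN y x := by
  have h := form1_comm x y
  rw [form1_eq, form1_eq] at h
  linarith

theorem formN_nonneg (x : Lambda1) : 0 ≤ formN x x := by
  rw [formN_apply]
  have h1 := formE8_nonneg (fun i => x (Sum.inl i))
  have h2 := formE8_nonneg (fun i => x (Sum.inr (Sum.inl i)))
  have h3 := formA2_nonneg (fun i => x (Sum.inr (Sum.inr (Sum.inl i))))
  linarith

theorem form1_even (x : Lambda1) : Even (form1 x x) := by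
  rw [form1_eq, formN_apply]
  refine Even.add (Even.add (formE8_even _) (Even.add (formE8_even _) ?_)) ?_
  · rw [formA2_apply]
    exact ⟨x (Sum.inr (Sum.inr (Sum.inl 0))) ^ 2 + x (Sum.inr (Sum.inr (Sum.inl 1))) ^ 2 -
      x (Sum.inr (Sum.inr (Sum.inl 0))) * x (Sum.inr (Sum.inr (Sum.inl 1))), by ring⟩
  · exact ⟨uZero x * uOne x, by ring⟩

theorem eq_zero_of_formN {x : Lambda1} (h : formN x x = 0) (h0 : uZero x = 0)
    (h1 : uOne x = 0) : x = 0 := by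
  rw [formN_apply] at h
  have n1 := formE8_nonneg (fun i => x (Sum.inl i))
  have n2 := formE8_nonneg (fun i => x (Sum.inr (Sum.inl i)))
  have n3 := formA2_nonneg (fun i => x (Sum.inr (Sum.inr (Sum.inl i))))
  have e1 : (fun i => x (Sum.inl i)) = 0 := by
    by_contra hne
    have := formE8_pos hne
    linarith
  have e2 : (fun i => x (Sum.inr (Sum.inl i))) = 0 := by
    by_contra hne
    have := formE8_pos hne
    linarith
  have e3 : (fun i => x (Sum.inr (Sum.inr (Sum.inl i)))) = 0 := by
    by_contra hne
    have := formA2_pos hne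
    linarith
  funext i
  rcases i with i | i | i | i
  · exact congrFun e1 i
  · exact congrFun e2 i
  · exact congrFun e3 i
  · fin_cases i
    · exact h0
    · exact h1

/-- The vectors in the closed forward cone, among the vectors of nonpositive square norm. -/
def IsForward (x : Lambda1) : Prop := uZero x ≤ 0 ∧ 0 ≤ uOne x

/-- The reversed Cauchy–Schwarz inequality: the definite part `formN x y` is dominated by the
hyperbolic part, whose sign is known on the forward cone. -/
theorem form1_nonpos_of_isForward {x y : Lambda1} (hx : form1 x x ≤ 0) (hy : form1 y y ≤ 0)
    (fx : IsForward x) (fy : IsForward y) : form1 x y ≤ 0 := by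
  have hc := LinearMap.BilinForm.apply_sq_le_of_symm formN formN_nonneg
    (⟨fun x y => formN_comm x y⟩) x y
  rw [form1_eq] at hx hy ⊢
  obtain ⟨x0, x1⟩ := fx
  obtain ⟨y0, y1⟩ := fy
  have nx := formN_nonneg x
  have ny := formN_nonneg y
  set a := uZero x
  set b := uOne x
  set c := uZero y
  set d := uOne y
  have hab : a * b ≤ 0 := mul_nonpos_of_nonpos_of_nonneg x0 x1
  have h1 : formN x x * formN y y ≤ (-(2 * (a * b))) * (-(2 * (c * d))) :=
    mul_le_mul (by linarith) (by linarith) ny (by linarith)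
  have h3 : 0 ≤ -(a * d + b * c) := by nlinarith
  -- Cauchy–Schwarz for `formN` bounds the left side by `4abcd`, which differs from `(ad + bc)²` by
  -- `(ad - bc)²`.
  have h2 : formN x y ^ 2 ≤ (-(a * d + b * c)) ^ 2 := by nlinarith [sq_nonneg (a * d - b * c)]
  have := abs_le_of_sq_le_sq' h2 h3
  linarith [this.2]

theorem isForward_or_neg {x : Lambda1} (hx : form1 x x = 0) : IsForward x ∨ IsForward (-x) := by
  rw [form1_eq] at hx
  have nx := formN_nonneg x
  have h : uZero x * uOne x ≤ 0 := by linarith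
  rcases mul_nonpos_iff.1 h with ⟨h0, h1⟩ | ⟨h0, h1⟩
  · right
    exact ⟨by simpa using h0, by simpa using h1⟩
  · exact Or.inl ⟨h0, h1⟩

end LambdaOne

/-! ### Computation in `Λ₁` with lists of coordinates -/

section ListVectors

/-- The position of a basis vector of `Λ₁` in lists of coordinates. -/
def coordPos : Index1 → ℕ
  | .inl i => i
  | .inr (.inl i) => 8 + i
  | .inr (.inr (.inl i)) => 16 + i
  | .inr (.inr (.inr i)) => 18 + i

/-- The vector of `Λ₁` with the given list of coordinates. -/
def ofList (l : List ℤ) : Lambda1 := fun i => l.getD (coordPos i) 0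

/-- The dot product of two lists. -/
def dotL : List ℤ → List ℤ → ℤ
  | a :: l, b :: m => a * b + dotL l m
  | _, _ => 0

/-- The sum of two lists. -/
def addL : List ℤ → List ℤ → List ℤ
  | [], m => m
  | a :: l, [] => a :: l
  | a :: l, b :: m => (a + b) :: addL l m

/-- The multiples of a list. -/
def smulL (c : ℤ) : List ℤ → List ℤ
  | [] => []
  | a :: l => c * a :: smulL c l

/-- Linear combinations of lists. -/
def combL : List ℤ → List (List ℤ) → List ℤ
  | c :: cs, v :: vs => if c = 0 then combL cs vs else addL (smulL c v) (combL cs vs)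
  | _, _ => []

/-- The product of the Gram matrix of `Λ₁` with a vector. -/
def gramMulL : List ℤ → List ℤ
  | [a0, a1, a2, a3, a4, a5, a6, a7, a8, a9, a10, a11, a12, a13, a14, a15, a16, a17, a18, a19] =>
      [2 * a0 - a2, 2 * a1 - a3, 2 * a2 - a0 - a3, 2 * a3 - a1 - a2 - a4, 2 * a4 - a3 - a5, 2 *
      a5 - a4 - a6, 2 * a6 - a5 - a7, 2 * a7 - a6, 2 * a8 - a10, 2 * a9 - a11, 2 * a10 - a8 -
      a11, 2 * a11 - a9 - a10 - a12, 2 * a12 - a11 - a13, 2 * a13 - a12 - a14, 2 * a14 - a13 -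
      a15, 2 * a15 - a14, 2 * a16 - a17, 2 * a17 - a16, a19, a18]
  | _ => []

/-- The form of `Λ₁`, on lists of coordinates. -/
def bilL (l m : List ℤ) : ℤ := dotL l (gramMulL m)

/-- The lists of coordinates of the basis vectors. -/
def unitL (i : ℕ) : List ℤ := (List.range 20).map fun j => if j = i then 1 else 0

theorem ofList_addL (l m : List ℤ) : ofList (addL l m) = ofList l + ofList m := by
  have h : ∀ (l m : List ℤ) (n : ℕ), (addL l m).getD n 0 = l.getD n 0 + m.getD n 0 := by
    intro l
    induction l with
    | nil => simp [addL]
    | cons a l ih =>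
      intro m n
      cases m with
      | nil => simp [addL]
      | cons b m =>
        cases n with
        | zero => simp [addL]
        | succ n => simpa [addL] using ih m n
  funext i
  exact h l m _

theorem ofList_smulL (c : ℤ) (l : List ℤ) : ofList (smulL c l) = c • ofList l := by
  have h : ∀ (l : List ℤ) (n : ℕ), (smulL c l).getD n 0 = c * l.getD n 0 := by
    intro l
    induction l with
    | nil => simp [smulL]
    | cons a l ih =>
      intro n
      cases n with
      | zero => simp [smulL]
      | succ n => simpa [smulL] using ih n
  funext i
  exact h l _

theorem ofList_nil : ofList [] = 0 := by
  funext i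
  simp [ofList]

theorem ofList_eq_single : ∀ i j : Index1,
    (Pi.single i 1 : Lambda1) j = ofList (unitL (coordPos i)) j := by
  decide +kernel

theorem coordPos_lt (i : Index1) : coordPos i < 20 := by
  revert i
  decide +kernel

/-- This reduces identities of linear maps on `Λ₁` to twenty identities between integer lists, which
the kernel can evaluate. -/
theorem ext_unitL {N : Type*} [AddCommGroup N] {f g : Lambda1 →ₗ[ℤ] N}
    (h : ∀ i < 20, f (ofList (unitL i)) = g (ofList (unitL i))) : f = g := by
  refine (Pi.basisFun ℤ Index1).ext fun i => ?_
  have e : (Pi.basisFun ℤ Index1) i = ofList (unitL (coordPos i)) := by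
    rw [Pi.basisFun_apply]
    exact funext (ofList_eq_single i)
  rw [e]
  exact h _ (coordPos_lt i)

/-- The linear map `x ↦ ∑ fᵢ x • vᵢ`. -/
def lincomb {M N : Type*} [AddCommGroup M] [AddCommGroup N] :
    List (M →ₗ[ℤ] ℤ) → List N → M →ₗ[ℤ] N
  | f :: fs, v :: vs => f.smulRight v + lincomb fs vs
  | _, _ => 0

/-- The coordinate functions of `Λ₁`. -/
def coordFns : List (Lambda1 →ₗ[ℤ] ℤ) :=
  ([.inl 0, .inl 1, .inl 2, .inl 3, .inl 4, .inl 5, .inl 6, .inl 7, .inr (.inl 0), .inr (.inl 1),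
    .inr (.inl 2), .inr (.inl 3), .inr (.inl 4), .inr (.inl 5), .inr (.inl 6), .inr (.inl 7),
    .inr (.inr (.inl 0)), .inr (.inr (.inl 1)), .inr (.inr (.inr 0)), .inr (.inr (.inr 1))] :
    List Index1).map (LinearMap.proj (R := ℤ) (φ := fun _ => ℤ))

theorem exists_list {l : List ℤ} (h : l.length = 20) :
    ∃ a0 a1 a2 a3 a4 a5 a6 a7 a8 a9 a10 a11 a12 a13 a14 a15 a16 a17 a18 a19 : ℤ,
      l = [a0, a1, a2, a3, a4, a5, a6, a7, a8, a9, a10, a11, a12, a13, a14, a15, a16, a17, a18,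
        a19] := by
  match l, h with
  | [a0, a1, a2, a3, a4, a5, a6, a7, a8, a9, a10, a11, a12, a13, a14, a15, a16, a17, a18, a19], _ =>
    exact ⟨_, _, _, _, _, _, _, _, _, _, _, _, _, _, _, _, _, _, _, _, rfl⟩

theorem coordFns_ofList {l : List ℤ} (h : l.length = 20) :
    coordFns.map (fun f => f (ofList l)) = l := by
  obtain ⟨a0, a1, a2, a3, a4, a5, a6, a7, a8, a9, a10, a11, a12, a13, a14, a15, a16, a17,
    a18, a19, rfl⟩ := exists_list h
  rfl

theorem lincomb_apply (fs : List (Lambda1 →ₗ[ℤ] ℤ)) (vs : List (List ℤ)) (x : Lambda1) :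
    lincomb fs (vs.map ofList) x = ofList (combL (fs.map fun f => f x) vs) := by
  induction fs generalizing vs with
  | nil => simp [lincomb, combL, ofList_nil]
  | cons f fs ih =>
    cases vs with
    | nil => simp [lincomb, combL, ofList_nil]
    | cons v vs =>
      simp only [List.map_cons, lincomb, combL, LinearMap.add_apply, ih,
        LinearMap.smulRight_apply]
      split_ifs with h0
      · rw [h0, zero_smul, zero_add]
      · rw [ofList_addL, ofList_smulL]

/-- The linear map given by the images of the basis vectors. -/
def matMap (m : List (List ℤ)) : Lambda1 →ₗ[ℤ] Lambda1 := lincomb coordFns (m.map ofList)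

theorem matMap_ofList {l : List ℤ} (h : l.length = 20) (m : List (List ℤ)) :
    matMap m (ofList l) = ofList (combL l m) := by
  rw [matMap, lincomb_apply, coordFns_ofList h]

/-- The dot product with a list of coefficients. -/
def dotWith (p : List ℤ) : Lambda1 →ₗ[ℤ] ℤ := lincomb coordFns p

theorem dotWith_ofList (p : List ℤ) {l : List ℤ} (h : l.length = 20) :
    dotWith p (ofList l) = dotL p l := by
  have key : ∀ (fs : List (Lambda1 →ₗ[ℤ] ℤ)) (p : List ℤ) (x : Lambda1),
      lincomb fs p x = dotL p (fs.map fun f => f x) := by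
    intro fs
    induction fs with
    | nil =>
      intro p x
      cases p <;> simp [lincomb, dotL]
    | cons f fs ih =>
      intro p x
      cases p with
      | nil => simp [lincomb, dotL]
      | cons a p => simp [lincomb, dotL, ih, mul_comm]
  rw [dotWith, key, coordFns_ofList h]

theorem length_unitL (i : ℕ) : (unitL i).length = 20 := by simp [unitL]

theorem form1_ofList {l m : List ℤ} (hl : l.length = 20) (hm : m.length = 20) :
    form1 (ofList l) (ofList m) = bilL l m := by
  obtain ⟨a0, a1, a2, a3, a4, a5, a6, a7, a8, a9, a10, a11, a12, a13, a14, a15, a16, a17,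
    a18, a19, rfl⟩ := exists_list hl
  obtain ⟨b0, b1, b2, b3, b4, b5, b6, b7, b8, b9, b10, b11, b12, b13, b14, b15, b16, b17,
    b18, b19, rfl⟩ := exists_list hm
  rw [form1_eq, formN_apply, formE8_apply, formE8_apply, formA2_apply]
  simp only [ofList, coordPos, bilL, gramMulL, dotL]
  simp
  ring

/-- Replaces the noncomputable form by an explicit functional, so that certificates and coroots can
be handled as lists of coefficients. -/
theorem form1_eq_dotWith {m : List ℤ} (hm : m.length = 20) (x : Lambda1) :
    form1 x (ofList m) = dotWith (gramMulL m) x := by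
  have h : LinearMap.flip form1 (ofList m) = dotWith (gramMulL m) := by
    refine ext_unitL fun i _ => ?_
    rw [LinearMap.flip_apply, form1_ofList (length_unitL i) hm,
      dotWith_ofList _ (length_unitL i), bilL]
    have hc : ∀ l m : List ℤ, dotL l m = dotL m l := by
      intro l
      induction l with
      | nil => intro m; cases m <;> rfl
      | cons a l ih =>
        intro m
        cases m with
        | nil => rfl
        | cons b m => simp [dotL, ih, mul_comm]
    exact hc _ _
  exact congrArg (fun f => f x) h

end ListVectors

/-! ### Simple roots, symmetries, cusps and certificates -/

section ChamberData

set_option maxHeartbeats 4000000 in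
/-- The simple roots of a fundamental chamber of the reflection group of `Λ₁`: first the `24` long
ones, then the triples of the `12` short ones. -/
def simpleL : List (List ℤ) :=
    [[0, 0, 0, 1, 0, 0, 0, 0, 0, 0, 0, 0, 0, 0, 0, 0, 0, 0, 0, 0], [0, 0, 0, 0, 0, 0, 0, 0, 0, 0,
    0, 1, 0, 0, 0, 0, 0, 0, 0, 0], [0, 0, 0, 0, 0, 0, 0, 0, 0, 0, 0, 0, 0, 0, 0, 0, 0, 0, -1, -1],
    [0, 0, 0, 0, 0, 0, 0, 0, 0, 0, 0, 0, 0, 0, 1, 0, 0, 0, 0, 0], [-4, -5, -7, -10, -8, -6, -4,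
    -2, -4, -5, -7, -10, -8, -6, -4, -2, -1, -1, 2, -2], [0, 0, 0, 0, 0, 0, 1, 0, 0, 0, 0, 0, 0,
    0, 0, 0, 0, 0, 0, 0], [0, 1, 0, 0, 0, 0, 0, 0, 0, 0, 0, 0, 0, 0, 0, 0, 0, 0, 0, 0], [0, 0, 1,
    0, 0, 0, 0, 0, 0, 0, 0, 0, 0, 0, 0, 0, 0, 0, 0, 0], [0, 0, 0, 0, 1, 0, 0, 0, 0, 0, 0, 0, 0, 0,
    0, 0, 0, 0, 0, 0], [0, 0, 0, 0, 0, 0, 0, 0, 0, 0, 0, 0, 1, 0, 0, 0, 0, 0, 0, 0], [0, 0, 0, 0,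
    0, 0, 0, 0, 0, 0, 1, 0, 0, 0, 0, 0, 0, 0, 0, 0], [0, 0, 0, 0, 0, 0, 0, 0, 0, 1, 0, 0, 0, 0, 0,
    0, 0, 0, 0, 0], [0, 0, 0, 0, 0, 0, 0, 0, -2, -3, -4, -6, -5, -4, -3, -2, 0, 0, 1, 0], [0, 0,
    0, 0, 0, 0, 0, 0, 0, 0, 0, 0, 0, 0, 0, 0, -1, -1, 1, 0], [-2, -3, -4, -6, -5, -4, -3, -2, 0,
    0, 0, 0, 0, 0, 0, 0, 0, 0, 1, 0], [-5, -8, -10, -15, -12, -9, -6, -3, -4, -6, -8, -12, -10,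
    -8, -6, -3, -1, -2, 3, -3], [1, 0, 0, 0, 0, 0, 0, 0, 0, 0, 0, 0, 0, 0, 0, 0, 0, 0, 0, 0], [0,
    0, 0, 0, 0, 1, 0, 0, 0, 0, 0, 0, 0, 0, 0, 0, 0, 0, 0, 0], [0, 0, 0, 0, 0, 0, 0, 0, 0, 0, 0, 0,
    0, 1, 0, 0, 0, 0, 0, 0], [0, 0, 0, 0, 0, 0, 0, 0, 1, 0, 0, 0, 0, 0, 0, 0, 0, 0, 0, 0], [-4,
    -6, -8, -12, -10, -8, -6, -3, -5, -8, -10, -15, -12, -9, -6, -3, -1, -2, 3, -3], [0, 0, 0, 0,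
    0, 0, 0, 0, 0, 0, 0, 0, 0, 0, 0, 1, 0, 0, 0, 0], [0, 0, 0, 0, 0, 0, 0, 0, 0, 0, 0, 0, 0, 0, 0,
    0, 1, 0, 0, 0], [0, 0, 0, 0, 0, 0, 0, 1, 0, 0, 0, 0, 0, 0, 0, 0, 0, 0, 0, 0], [-15, -24, -30,
    -45, -36, -27, -18, -9, -21, -30, -42, -60, -48, -36, -24, -12, -4, -8, 12, -12], [-15, -24,
    -30, -45, -36, -27, -18, -9, -15, -24, -30, -45, -36, -27, -18, -9, -2, -4, 9, -9], [-21, -30,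
    -42, -60, -48, -36, -24, -12, -24, -36, -48, -72, -60, -45, -30, -15, -5, -10, 15, -15], [-21,
    -30, -42, -60, -48, -36, -24, -12, -15, -24, -30, -45, -36, -27, -18, -9, -4, -8, 12, -12],
    [-24, -36, -48, -72, -60, -45, -30, -15, -24, -36, -48, -72, -60, -45, -30, -15, -4, -8, 15,
    -15], [-24, -36, -48, -72, -60, -45, -30, -15, -21, -30, -42, -60, -48, -36, -24, -12, -5,
    -10, 15, -15], [-6, -9, -12, -18, -15, -12, -9, -6, -12, -15, -21, -30, -24, -18, -12, -6, -2,
    -4, 6, -6], [0, 0, 0, 0, 0, 0, 0, 0, 0, 0, 0, 0, 0, 0, 0, 0, -1, 1, 0, 0], [-18, -24, -33,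
    -48, -39, -30, -21, -12, -18, -27, -36, -54, -45, -36, -24, -12, -4, -8, 12, -12], [-12, -15,
    -21, -30, -24, -18, -12, -6, -6, -9, -12, -18, -15, -12, -9, -6, -2, -4, 6, -6], [-18, -27,
    -36, -54, -45, -36, -24, -12, -18, -27, -36, -54, -45, -36, -24, -12, -5, -7, 12, -12], [-18,
    -27, -36, -54, -45, -36, -24, -12, -18, -24, -33, -48, -39, -30, -21, -12, -4, -8, 12, -12]]

set_option maxHeartbeats 4000000 in
/-- Generators of the automorphism group of the chamber. -/
def diagramMat : Fin 3 → List (List ℤ)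
  | 0 =>
    [[0, 0, 0, 0, 0, 0, 0, 0, 1, 0, 0, 0, 0, 0, 0, 0, 0, 0, 0, 0], [0, 0, 0, 0, 0, 0, 0, 0, 0, 0,
    0, 0, 1, 0, 0, 0, 0, 0, 0, 0], [0, 0, 0, 0, 0, 0, 0, 0, 0, 0, 1, 0, 0, 0, 0, 0, 0, 0, 0, 0],
    [0, 0, 0, 0, 0, 0, 0, 0, 0, 0, 0, 1, 0, 0, 0, 0, 0, 0, 0, 0], [0, 0, 0, 0, 0, 0, 0, 0, 0, 1,
    0, 0, 0, 0, 0, 0, 0, 0, 0, 0], [-4, -6, -8, -12, -10, -8, -6, -3, -5, -8, -10, -15, -12, -9,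
    -6, -3, -1, -2, 3, -3], [0, 0, 0, 0, 0, 0, 1, 0, 0, 0, 0, 0, 0, 0, 0, 0, 0, 0, 0, 0], [0, 0,
    0, 0, 0, 0, 0, 1, 0, 0, 0, 0, 0, 0, 0, 0, 0, 0, 0, 0], [1, 0, 0, 0, 0, 0, 0, 0, 0, 0, 0, 0, 0,
    0, 0, 0, 0, 0, 0, 0], [0, 0, 0, 0, 1, 0, 0, 0, 0, 0, 0, 0, 0, 0, 0, 0, 0, 0, 0, 0], [0, 0, 1,
    0, 0, 0, 0, 0, 0, 0, 0, 0, 0, 0, 0, 0, 0, 0, 0, 0], [0, 0, 0, 1, 0, 0, 0, 0, 0, 0, 0, 0, 0, 0,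
    0, 0, 0, 0, 0, 0], [0, 1, 0, 0, 0, 0, 0, 0, 0, 0, 0, 0, 0, 0, 0, 0, 0, 0, 0, 0], [-5, -8, -10,
    -15, -12, -9, -6, -3, -4, -6, -8, -12, -10, -8, -6, -3, -1, -2, 3, -3], [0, 0, 0, 0, 0, 0, 0,
    0, 0, 0, 0, 0, 0, 0, 1, 0, 0, 0, 0, 0], [0, 0, 0, 0, 0, 0, 0, 0, 0, 0, 0, 0, 0, 0, 0, 1, 0, 0,
    0, 0], [0, 0, 0, 0, 0, 0, 0, 0, 0, 0, 0, 0, 0, 0, 0, 0, 1, 0, 0, 0], [-18, -27, -36, -54, -45,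
    -36, -24, -12, -18, -27, -36, -54, -45, -36, -24, -12, -4, -7, 12, -12], [-18, -27, -36, -54,
    -45, -36, -24, -12, -18, -27, -36, -54, -45, -36, -24, -12, -4, -8, 13, -12], [18, 27, 36, 54,
    45, 36, 24, 12, 18, 27, 36, 54, 45, 36, 24, 12, 4, 8, -12, 13]]
  | 1 =>
    [[1, 0, 0, 0, 0, 0, 0, 0, 0, 0, 0, 0, 0, 0, 0, 0, 0, 0, 0, 0], [0, 1, 0, 0, 0, 0, 0, 0, 0, 0,
    0, 0, 0, 0, 0, 0, 0, 0, 0, 0], [0, 0, 1, 0, 0, 0, 0, 0, 0, 0, 0, 0, 0, 0, 0, 0, 0, 0, 0, 0],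
    [0, 0, 0, 1, 0, 0, 0, 0, 0, 0, 0, 0, 0, 0, 0, 0, 0, 0, 0, 0], [0, 0, 0, 0, 1, 0, 0, 0, 0, 0,
    0, 0, 0, 0, 0, 0, 0, 0, 0, 0], [0, 0, 0, 0, 0, 1, 0, 0, 0, 0, 0, 0, 0, 0, 0, 0, 0, 0, 0, 0],
    [0, 0, 0, 0, 0, 0, 1, 0, 0, 0, 0, 0, 0, 0, 0, 0, 0, 0, 0, 0], [-4, -6, -8, -12, -10, -8, -6,
    -3, -5, -8, -10, -15, -12, -9, -6, -3, -1, -2, 3, -3], [0, 0, 0, 0, 0, 0, 0, 0, 0, 0, 0, 0, 0,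
    0, 0, 0, 1, 0, 0, 0], [-2, -3, -4, -6, -5, -4, -3, -2, 0, 0, 0, 0, 0, 0, 0, 0, 0, 0, 1, 0],
    [0, 0, 0, 0, 0, 0, 0, 0, 0, 0, 0, 0, 0, 0, 0, 0, -1, -1, 1, 0], [0, 0, 0, 0, 0, 0, 0, 0, 0, 0,
    0, 0, 0, 0, 0, 0, 0, 0, -1, -1], [0, 0, 0, 0, 0, 0, 0, 0, -2, -3, -4, -6, -5, -4, -3, -2, 0,
    0, 1, 0], [0, 0, 0, 0, 0, 0, 0, 0, 0, 0, 0, 0, 0, 0, 0, 1, 0, 0, 0, 0], [0, 0, 0, 0, 0, 0, 0,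
    0, 0, 0, 0, 0, 0, 0, 1, 0, 0, 0, 0, 0], [0, 0, 0, 0, 0, 0, 0, 0, 0, 0, 0, 0, 0, 1, 0, 0, 0, 0,
    0, 0], [0, 0, 0, 0, 0, 0, 0, 0, 1, 0, 0, 0, 0, 0, 0, 0, 0, 0, 0, 0], [-6, -9, -12, -18, -15,
    -12, -9, -6, -11, -15, -21, -30, -24, -18, -12, -6, -2, -4, 6, -6], [-6, -9, -12, -18, -15,
    -12, -9, -6, -10, -15, -20, -30, -24, -18, -12, -6, -2, -4, 6, -6], [6, 9, 12, 18, 15, 12, 9,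
    6, 10, 15, 20, 29, 24, 18, 12, 6, 2, 4, -6, 6]]
  | 2 =>
    [[0, 0, 0, 0, 0, 0, 0, 0, 0, 0, 0, 0, 1, 0, 0, 0, 0, 0, 0, 0], [-5, -8, -10, -15, -12, -9, -6,
    -3, -4, -6, -8, -12, -10, -8, -6, -3, -1, -2, 3, -3], [0, 0, 0, 0, 0, 0, 0, 0, 0, 0, 0, 0, 0,
    1, 0, 0, 0, 0, 0, 0], [0, 0, 0, 0, 0, 0, 0, 0, 0, 0, 0, 0, 0, 0, 1, 0, 0, 0, 0, 0], [0, 0, 0,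
    0, 0, 0, 0, 0, 0, 0, 0, 0, 0, 0, 0, 1, 0, 0, 0, 0], [0, 0, 0, 0, 0, 0, 0, 0, -2, -3, -4, -6,
    -5, -4, -3, -2, 0, 0, 1, 0], [0, 0, 0, 0, 0, 0, 0, 0, 0, 0, 0, 0, 0, 0, 0, 0, 0, 0, -1, -1],
    [-2, -3, -4, -6, -5, -4, -3, -2, 0, 0, 0, 0, 0, 0, 0, 0, 0, 0, 1, 0], [0, 0, 0, 0, 0, 0, 0, 0,
    0, 0, 1, 0, 0, 0, 0, 0, 0, 0, 0, 0], [0, 0, 0, 0, 0, 0, 0, 0, 0, 0, 0, 0, 0, 0, 0, 0, 1, 0, 0,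
    0], [0, 0, 0, 0, 0, 0, 0, 0, 1, 0, 0, 0, 0, 0, 0, 0, 0, 0, 0, 0], [-4, -5, -7, -10, -8, -6,
    -4, -2, -4, -5, -7, -10, -8, -6, -4, -2, -1, -1, 2, -2], [1, 0, 0, 0, 0, 0, 0, 0, 0, 0, 0, 0,
    0, 0, 0, 0, 0, 0, 0, 0], [0, 0, 1, 0, 0, 0, 0, 0, 0, 0, 0, 0, 0, 0, 0, 0, 0, 0, 0, 0], [0, 0,
    0, 1, 0, 0, 0, 0, 0, 0, 0, 0, 0, 0, 0, 0, 0, 0, 0, 0], [0, 0, 0, 0, 1, 0, 0, 0, 0, 0, 0, 0, 0,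
    0, 0, 0, 0, 0, 0, 0], [0, 0, 0, 0, 0, 0, 0, 0, 0, 1, 0, 0, 0, 0, 0, 0, 0, 0, 0, 0], [-15, -24,
    -30, -45, -36, -27, -18, -9, -15, -23, -30, -45, -36, -27, -18, -9, -2, -4, 9, -9], [-19, -30,
    -38, -57, -46, -35, -24, -12, -20, -30, -40, -60, -48, -36, -24, -12, -3, -6, 12, -12], [19,
    30, 38, 57, 46, 35, 23, 12, 20, 30, 40, 60, 48, 36, 24, 12, 3, 6, -12, 12]]

/-- Representatives of the cusps, as lists of coordinates. -/
def cuspL : BoundaryType → List ℤ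
  | .twoE8 =>
    [0, 0, 0, 0, 0, 0, 0, 0, 0, 0, 0, 0, 0, 0, 0, 0, 0, 0, 1, 0]
  | .D16 =>
    [-6, -9, -12, -18, -15, -12, -8, -4, -12, -15, -21, -30, -24, -18, -12, -6, -2, -4, 6, -6]
  | .A17 =>
    [-14, -21, -28, -42, -35, -27, -18, -9, -14, -21, -28, -42, -35, -27, -18, -9, -3, -5, 9, -9]
  | .E7D10 =>
    [-2, -3, -4, -6, -5, -4, -3, -2, -4, -5, -7, -10, -8, -6, -4, -2, -1, -1, 2, -2]
  | .threeE6 =>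
    [-4, -6, -8, -12, -10, -8, -6, -3, -4, -6, -8, -12, -10, -8, -6, -3, -1, -2, 3, -3]
  | .D7A11 =>
    [-6, -9, -12, -18, -15, -12, -8, -4, -7, -10, -14, -20, -16, -12, -8, -4, -1, -2, 4, -4]

/-- Vectors with product `1` with the representatives of the cusps. -/
def cuspPartnerL : BoundaryType → List ℤ
  | .twoE8 =>
    [0, 0, 0, 0, 0, 0, 0, 0, 0, 0, 0, 0, 0, 0, 0, 0, 0, 0, 0, 1]
  | .D16 =>
    [0, 0, 0, 0, 0, -1, 0, 0, 0, 0, 0, 0, 0, 0, 0, 0, 0, 0, 0, 0]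
  | .A17 =>
    [0, 0, 0, 0, -1, 0, 0, 0, 0, 0, 0, 0, 0, 0, 0, 0, 0, 0, 0, 0]
  | .E7D10 =>
    [0, 0, 0, 0, 0, 0, 0, -1, 0, 0, 0, 0, 0, 0, 0, 0, 0, 0, 0, 0]
  | .threeE6 =>
    [0, 0, 0, 0, 0, 0, -1, 0, 0, 0, 0, 0, 0, 0, 0, 0, 0, 0, 0, 0]
  | .D7A11 =>
    [0, 0, 0, 0, 0, -1, 0, 0, 0, 0, 0, 0, 0, 0, 0, 0, 0, 0, 0, 0]

/-- The weights with which distances from the cusps are compared. -/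
def cuspWeight : BoundaryType → ℤ
  | .twoE8 => 2
  | .D16 => 2
  | .A17 => 3
  | .E7D10 => 3
  | .threeE6 => 4
  | .D7A11 => 4

/-- A vector in the chamber, invariant under the automorphisms of the chamber. -/
def weylL : List ℤ :=
  [-46, -68, -91, -135, -110, -84, -57, -29, -46, -68, -91, -135, -110, -84, -57, -29, -10, -19,
  31, -30]

/-- A certificate for the statement that the isotropic vectors that are closest to a given cusp
represent that cusp. -/
structure Certificate where
  /-- The simple roots that are used as coordinates. -/
  basis : List ℕ
  /-- The common denominator of the dual basis. -/
  den : ℤ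
  /-- The dual basis, multiplied by `den`. -/
  duals : List (List ℤ)
  /-- Competing cusps: the images of representatives under products of chamber automorphisms. -/
  rivals : List (BoundaryType × List (Fin 3))
  /-- A simple root whose product is at least that with `cutLow`. -/
  cutHigh : ℕ
  /-- A simple root. -/
  cutLow : ℕ
  /-- A chamber automorphism that fixes the cusp and exchanges `cutHigh` and `cutLow`. -/
  swap : List (Fin 3)
  /-- Coefficients of products of nonnegative linear functions. -/
  terms : List (ℕ × List (ℕ × ℤ))
  /-- The coefficient of the form. -/
  coeff : ℤ

set_option maxHeartbeats 4000000 in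
/-- The certificates for the six cusps. -/
def certificate : BoundaryType → Certificate
  | .twoE8 => {
      basis := [16, 6, 7, 0, 8, 17, 5, 23, 14, 19, 11, 10, 1, 9, 18, 3, 21, 22, 13, 2]
      den := 3
      duals :=
        [[12, 15, 21, 30, 24, 18, 12, 6, 0, 0, 0, 0, 0, 0, 0, 0, 2, 4, -6, 6], [15, 24, 30, 45,
        36, 27, 18, 9, 0, 0, 0, 0, 0, 0, 0, 0, 3, 6, -9, 9], [21, 30, 42, 60, 48, 36, 24, 12, 0,
        0, 0, 0, 0, 0, 0, 0, 4, 8, -12, 12], [30, 45, 60, 90, 72, 54, 36, 18, 0, 0, 0, 0, 0, 0, 0,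
        0, 6, 12, -18, 18], [24, 36, 48, 72, 60, 45, 30, 15, 0, 0, 0, 0, 0, 0, 0, 0, 5, 10, -15,
        15], [18, 27, 36, 54, 45, 36, 24, 12, 0, 0, 0, 0, 0, 0, 0, 0, 4, 8, -12, 12], [12, 18, 24,
        36, 30, 24, 18, 9, 0, 0, 0, 0, 0, 0, 0, 0, 3, 6, -9, 9], [6, 9, 12, 18, 15, 12, 9, 6, 0,
        0, 0, 0, 0, 0, 0, 0, 2, 4, -6, 6], [0, 0, 0, 0, 0, 0, 0, 0, 0, 0, 0, 0, 0, 0, 0, 0, 1, 2,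
        -3, 3], [0, 0, 0, 0, 0, 0, 0, 0, 12, 15, 21, 30, 24, 18, 12, 6, 0, 0, 0, 0], [0, 0, 0, 0,
        0, 0, 0, 0, 15, 24, 30, 45, 36, 27, 18, 9, 0, 0, 0, 0], [0, 0, 0, 0, 0, 0, 0, 0, 21, 30,
        42, 60, 48, 36, 24, 12, 0, 0, 0, 0], [0, 0, 0, 0, 0, 0, 0, 0, 30, 45, 60, 90, 72, 54, 36,
        18, 0, 0, 0, 0], [0, 0, 0, 0, 0, 0, 0, 0, 24, 36, 48, 72, 60, 45, 30, 15, 0, 0, 0, 0], [0,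
        0, 0, 0, 0, 0, 0, 0, 18, 27, 36, 54, 45, 36, 24, 12, 0, 0, 0, 0], [0, 0, 0, 0, 0, 0, 0, 0,
        12, 18, 24, 36, 30, 24, 18, 9, 0, 0, 0, 0], [0, 0, 0, 0, 0, 0, 0, 0, 6, 9, 12, 18, 15, 12,
        9, 6, 0, 0, 0, 0], [0, 0, 0, 0, 0, 0, 0, 0, 0, 0, 0, 0, 0, 0, 0, 0, 1, -1, 0, 0], [0, 0,
        0, 0, 0, 0, 0, 0, 0, 0, 0, 0, 0, 0, 0, 0, -1, -2, 0, 0], [0, 0, 0, 0, 0, 0, 0, 0, 0, 0, 0,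
        0, 0, 0, 0, 0, 0, 0, -3, 0]]
      rivals := [(.E7D10, []), (.E7D10, [2, 1, 0, 2, 0]), (.D16, [2, 1, 2]), (.A17, [0]),
      (.threeE6, []), (.D7A11, [2]), (.D7A11, [2, 1, 2])]
      cutHigh := 0
      cutLow := 0
      swap := []
      terms := [(12, [(9, 8300), (18, 9613), (10, 7425), (5, 6740), (1, 10496), (19, 3454), (11,
      8653), (14, 10515), (13, 2631), (23, 7058), (21, 6035), (3, 12187), (2, 8311), (22, 4045)]),
      (38, [(9, 1302), (16, 948), (1, 2606), (18, 1894), (0, 3878), (13, 579), (10, 1586), (19,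
      798), (7, 2480)]), (39, [(11, 1433), (6, 1638), (18, 790), (17, 2233), (9, 1393), (8,
      2582)]), (37, [(16, 2468), (7, 4555), (0, 6192), (21, 1330), (8, 2273)]), (36, [(1, 6165),
      (23, 1603), (10, 4197), (9, 3650), (19, 2230)]), (31, [(40, 117), (41, 80), (22, 2570), (13,
      5140)]), (41, [(8, 310), (0, 269), (6, 658)]), (40, [(17, 819), (18, 1173)]), (3, [(15,
      3915)]), (5, [(20, 4833)]), (11, [(42, 615)])]
      coeff := 10000 }
  | .D16 => {
      basis := [16, 6, 7, 0, 8, 5, 23, 11, 10, 1, 9, 18, 3, 21, 12, 22, 13, 2, 4, 17]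
      den := 6
      duals :=
        [[24, 30, 42, 60, 48, 36, 24, 12, 48, 60, 84, 120, 96, 72, 48, 24, 8, 16, -24, 24], [30,
        48, 60, 90, 72, 54, 36, 18, 60, 75, 105, 150, 120, 90, 60, 30, 10, 20, -30, 30], [42, 60,
        84, 120, 96, 72, 48, 24, 84, 105, 147, 210, 168, 126, 84, 42, 14, 28, -42, 42], [60, 90,
        120, 180, 144, 108, 72, 36, 120, 150, 210, 300, 240, 180, 120, 60, 20, 40, -60, 60], [48,
        72, 96, 144, 120, 90, 60, 30, 96, 120, 168, 240, 192, 144, 96, 48, 16, 32, -48, 48], [24,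
        36, 48, 72, 60, 48, 36, 18, 48, 60, 84, 120, 96, 72, 48, 24, 8, 16, -24, 24], [12, 18, 24,
        36, 30, 24, 18, 12, 24, 30, 42, 60, 48, 36, 24, 12, 4, 8, -12, 12], [0, 0, 0, 0, 0, 0, 0,
        0, -18, -12, -24, -30, -24, -18, -12, -6, -2, -4, 6, -6], [0, 0, 0, 0, 0, 0, 0, 0, -18,
        -15, -21, -30, -24, -18, -12, -6, -2, -4, 6, -6], [0, 0, 0, 0, 0, 0, 0, 0, -36, -30, -48,
        -60, -48, -36, -24, -12, -4, -8, 12, -12], [0, 0, 0, 0, 0, 0, 0, 0, -36, -33, -51, -66,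
        -48, -36, -24, -12, -4, -8, 12, -12], [0, 0, 0, 0, 0, 0, 0, 0, -36, -36, -54, -72, -54,
        -36, -24, -12, -4, -8, 12, -12], [0, 0, 0, 0, 0, 0, 0, 0, -36, -39, -57, -78, -60, -42,
        -24, -12, -4, -8, 12, -12], [0, 0, 0, 0, 0, 0, 0, 0, -36, -42, -60, -84, -66, -48, -30,
        -12, -4, -8, 12, -12], [0, 0, 0, 0, 0, 0, 0, 0, -36, -45, -63, -90, -72, -54, -36, -18,
        -4, -8, 12, -12], [0, 0, 0, 0, 0, 0, 0, 0, 0, 0, 0, 0, 0, 0, 0, 0, 2, -2, 0, 0], [0, 0, 0,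
        0, 0, 0, 0, 0, -12, -15, -21, -30, -24, -18, -12, -6, -4, -8, 6, -6], [0, 0, 0, 0, 0, 0,
        0, 0, -24, -30, -42, -60, -48, -36, -24, -12, -4, -8, 6, -12], [0, 0, 0, 0, 0, 0, 0, 0,
        12, 15, 21, 30, 24, 18, 12, 6, 2, 4, -6, 6], [36, 54, 72, 108, 90, 72, 48, 24, 72, 90,
        126, 180, 144, 108, 72, 36, 12, 24, -36, 36]]
      rivals := [(.twoE8, [2, 1, 2]), (.E7D10, []), (.E7D10, [2, 0, 2, 0]), (.A17, [1, 0]),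
      (.D7A11, []), (.D7A11, [2, 1, 0]), (.D7A11, [2]), (.D7A11, [2, 1, 2])]
      cutHigh := 0
      cutLow := 0
      swap := []
      terms := [(20, [(2, 476), (23, 528), (11, 1890), (10, 2130), (8, 284), (4, 356), (9, 3720),
      (1, 3802), (3, 676), (18, 1966), (21, 508), (0, 518), (22, 298)]), (14, [(13, 1224), (0,
      538), (12, 1150), (8, 236), (2, 1628), (1, 472), (21, 786), (22, 914), (11, 240)]), (37,
      [(16, 202), (2, 174), (4, 718), (13, 242), (22, 446), (7, 118), (9, 88)]), (38, [(21, 460),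
      (12, 340), (3, 698), (18, 220)]), (36, [(12, 92), (5, 140), (13, 124)]), (30, [(39, 100),
      (5, 778), (23, 538)]), (42, [(12, 28), (9, 78)]), (6, [(15, 42), (39, 68)]), (43, [(7, 168),
      (16, 178)]), (18, [(41, 158)]), (2, [(15, 134)]), (13, [(40, 58)]), (10, [(39, 68)])]
      coeff := 1600 }
  | .A17 => {
      basis := [16, 6, 7, 0, 5, 23, 14, 19, 11, 10, 1, 3, 21, 12, 2, 4, 20, 15, 28, 8]
      den := 6
      duals :=
        [[42, 57, 78, 114, 93, 72, 48, 24, 38, 57, 76, 114, 95, 72, 48, 24, 3, 13, -24, 24], [66,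
        102, 132, 198, 162, 126, 84, 42, 68, 102, 136, 204, 170, 126, 84, 42, 12, 22, -42, 42],
        [78, 114, 156, 228, 186, 144, 96, 48, 76, 114, 152, 228, 190, 144, 96, 48, 12, 26, -48,
        48], [114, 171, 228, 342, 279, 216, 144, 72, 114, 171, 228, 342, 285, 216, 144, 72, 21,
        39, -72, 72], [-84, -126, -168, -252, -210, -168, -108, -54, -84, -126, -168, -252, -210,
        -162, -108, -54, -18, -30, 54, -54], [-78, -117, -156, -234, -195, -156, -102, -48, -74,
        -111, -148, -222, -185, -144, -96, -48, -15, -25, 48, -48], [-72, -108, -144, -216, -180,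
        -144, -96, -48, -64, -96, -128, -192, -160, -126, -84, -42, -12, -20, 42, -42], [-18, -27,
        -36, -54, -45, -36, -24, -12, -14, -27, -34, -54, -47, -36, -24, -12, -9, -7, 12, -12],
        [-72, -108, -144, -216, -180, -144, -96, -48, -74, -108, -148, -222, -188, -144, -96, -48,
        -18, -28, 48, -48], [-36, -54, -72, -108, -90, -72, -48, -24, -34, -54, -68, -108, -94,
        -72, -48, -24, -12, -14, 24, -24], [-54, -81, -108, -162, -135, -108, -72, -36, -54, -81,
        -108, -162, -141, -108, -72, -36, -15, -21, 36, -36], [0, 0, 0, 0, 0, 0, 0, 0, 0, 0, 0, 0,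
        0, -6, 0, 0, 0, 0, 0, 0], [-18, -27, -36, -54, -45, -36, -24, -12, -22, -33, -44, -66,
        -55, -48, -30, -12, -3, -5, 12, -12], [-36, -54, -72, -108, -90, -72, -48, -24, -44, -66,
        -88, -132, -110, -90, -60, -30, -6, -10, 24, -24], [-54, -81, -108, -162, -135, -108, -72,
        -36, -54, -81, -108, -162, -135, -108, -72, -36, -9, -15, 30, -36], [0, 0, 0, 0, 0, 0, 0,
        0, 0, 0, 0, 0, 0, 0, 0, 0, -6, 0, 0, 0], [-90, -135, -180, -270, -225, -180, -120, -60,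
        -94, -141, -188, -282, -235, -180, -120, -60, -21, -35, 60, -60], [18, 27, 36, 54, 45, 36,
        24, 12, 22, 33, 44, 66, 55, 36, 24, 12, 3, 5, -12, 12], [18, 27, 36, 54, 45, 36, 24, 12,
        18, 27, 36, 54, 45, 36, 24, 12, 5, 7, -12, 12], [84, 126, 168, 252, 210, 162, 108, 54, 84,
        126, 168, 252, 210, 162, 108, 54, 18, 30, -54, 54]]
      rivals := [(.D16, [1, 2, 0, 1, 0]), (.D16, [2, 1, 0]), (.D16, [0, 1, 2]), (.D7A11, []),
      (.D7A11, [1, 2, 1, 0]), (.D7A11, [2, 1, 0]), (.D7A11, [0]), (.D7A11, [1, 2]), (.D7A11, [0,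
      2])]
      cutHigh := 34
      cutLow := 28
      swap := [0, 2, 0]
      terms := [(17, [(4, 213), (14, 64), (0, 183), (23, 876), (5, 654), (20, 981), (45, 67), (11,
      362), (3, 222), (1, 200)]), (45, [(28, 46), (20, 59), (19, 16), (5, 23), (23, 91), (22, 13),
      (18, 14)]), (13, [(14, 404), (5, 341), (21, 119), (23, 150), (12, 204), (2, 446)]), (9,
      [(19, 116), (10, 181), (11, 357), (20, 227), (1, 328), (5, 284)]), (22, [(16, 822), (7, 52),
      (19, 857), (4, 764), (10, 99), (2, 196)]), (18, [(1, 59), (12, 97), (21, 828), (3, 765),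
      (15, 837), (6, 77)]), (28, [(39, 2), (42, 8), (44, 3), (40, 10)]), (36, [(1, 160), (11,
      115), (10, 164)]), (37, [(2, 159), (14, 133), (12, 165)]), (38, [(0, 227), (7, 217), (6,
      198)]), (44, [(16, 57), (12, 43)]), (43, [(6, 49), (23, 36)]), (41, [(14, 37), (19, 42)]),
      (40, [(11, 10), (21, 41)]), (39, [(10, 46), (15, 49)]), (7, [(42, 47)])]
      coeff := 800 }
  | .E7D10 => {
      basis := [16, 6, 7, 0, 8, 17, 5, 14, 11, 10, 1, 9, 18, 3, 21, 12, 13, 2, 31, 23]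
      den := 6
      duals :=
        [[24, 30, 42, 60, 48, 36, 24, 12, 24, 30, 42, 60, 48, 36, 24, 12, 6, 6, -12, 12], [30, 48,
        60, 90, 72, 54, 36, 18, 36, 45, 63, 90, 72, 54, 36, 18, 9, 9, -18, 18], [42, 60, 84, 120,
        96, 72, 48, 24, 48, 60, 84, 120, 96, 72, 48, 24, 12, 12, -24, 24], [60, 90, 120, 180, 144,
        108, 72, 36, 72, 90, 126, 180, 144, 108, 72, 36, 18, 18, -36, 36], [48, 72, 96, 144, 120,
        90, 60, 30, 60, 75, 105, 150, 120, 90, 60, 30, 15, 15, -30, 30], [36, 54, 72, 108, 90, 72,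
        48, 24, 48, 60, 84, 120, 96, 72, 48, 24, 12, 12, -24, 24], [24, 36, 48, 72, 60, 48, 36,
        18, 36, 45, 63, 90, 72, 54, 36, 18, 9, 9, -18, 18], [0, 0, 0, 0, 0, 0, 0, 0, 12, 15, 21,
        30, 24, 18, 12, 6, 3, 3, -6, 6], [0, 0, 0, 0, 0, 0, 0, 0, -6, 3, -3, 0, 0, 0, 0, 0, 0, 0,
        0, 0], [0, 0, 0, 0, 0, 0, 0, 0, -6, 0, 0, 0, 0, 0, 0, 0, 0, 0, 0, 0], [0, 0, 0, 0, 0, 0,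
        0, 0, -12, 0, -6, 0, 0, 0, 0, 0, 0, 0, 0, 0], [0, 0, 0, 0, 0, 0, 0, 0, -12, -3, -9, -6, 0,
        0, 0, 0, 0, 0, 0, 0], [0, 0, 0, 0, 0, 0, 0, 0, -12, -6, -12, -12, -6, 0, 0, 0, 0, 0, 0,
        0], [0, 0, 0, 0, 0, 0, 0, 0, -12, -9, -15, -18, -12, -6, 0, 0, 0, 0, 0, 0], [0, 0, 0, 0,
        0, 0, 0, 0, -12, -12, -18, -24, -18, -12, -6, 0, 0, 0, 0, 0], [0, 0, 0, 0, 0, 0, 0, 0,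
        -12, -15, -21, -30, -24, -18, -12, -6, 0, 0, 0, 0], [0, 0, 0, 0, 0, 0, 0, 0, 0, 0, 0, 0,
        0, 0, 0, 0, -3, -3, 0, 0], [0, 0, 0, 0, 0, 0, 0, 0, 0, 0, 0, 0, 0, 0, 0, 0, 0, 0, -6, 0],
        [0, 0, 0, 0, 0, 0, 0, 0, 0, 0, 0, 0, 0, 0, 0, 0, -1, 1, 0, 0], [12, 18, 24, 36, 30, 24,
        18, 12, 24, 30, 42, 60, 48, 36, 24, 12, 6, 6, -12, 12]]
      rivals := [(.twoE8, []), (.twoE8, [2, 1, 2, 1]), (.E7D10, [2, 1, 0, 2, 0]), (.D16, [1]),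
      (.A17, [0]), (.threeE6, []), (.D7A11, []), (.D7A11, [2]), (.D7A11, [1, 2]), (.D7A11, [2, 1,
      2])]
      cutHigh := 30
      cutLow := 31
      swap := [1]
      terms := [(4, [(6, 1247), (1, 788), (0, 2111), (7, 1762), (36, 75), (8, 2190), (17, 1410),
      (16, 790), (5, 1064), (22, 26), (19, 972), (10, 1390)]), (19, [(9, 691), (3, 572), (16,
      165), (11, 12), (12, 357), (1, 1239), (2, 196), (18, 76), (10, 1594)]), (38, [(12, 88), (7,
      354), (16, 380), (8, 89), (21, 476)]), (20, [(11, 519), (10, 239), (1, 1129), (9, 244), (5,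
      46)]), (45, [(1, 225), (16, 18), (11, 126), (14, 26)]), (44, [(18, 145), (9, 446), (8, 24),
      (7, 24)]), (40, [(8, 473), (0, 721), (6, 393), (7, 261)]), (15, [(0, 122), (6, 71), (2, 12),
      (3, 1132)]), (46, [(23, 5), (10, 91), (21, 308), (31, 172)]), (22, [(14, 920), (12, 1441),
      (13, 1024), (2, 2017)]), (41, [(18, 362), (21, 199), (3, 224)]), (39, [(1, 299), (18, 308),
      (11, 284)]), (37, [(5, 204), (17, 236), (8, 80)]), (36, [(13, 87), (14, 26)]), (42, [(17,
      18), (10, 106)]), (12, [(43, 147)])]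
      coeff := 2000 }
  | .threeE6 => {
      basis := [16, 6, 7, 0, 8, 17, 23, 14, 19, 11, 10, 1, 9, 18, 21, 12, 22, 13, 2, 5]
      den := 3
      duals :=
        [[12, 15, 21, 30, 24, 18, 12, 6, 8, 12, 16, 24, 20, 16, 12, 6, 2, 4, -6, 6], [15, 24, 30,
        45, 36, 27, 18, 9, 12, 18, 24, 36, 30, 24, 18, 9, 3, 6, -9, 9], [21, 30, 42, 60, 48, 36,
        24, 12, 16, 24, 32, 48, 40, 32, 24, 12, 4, 8, -12, 12], [30, 45, 60, 90, 72, 54, 36, 18,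
        24, 36, 48, 72, 60, 48, 36, 18, 6, 12, -18, 18], [24, 36, 48, 72, 60, 45, 30, 15, 20, 30,
        40, 60, 50, 40, 30, 15, 5, 10, -15, 15], [18, 27, 36, 54, 45, 36, 24, 12, 16, 24, 32, 48,
        40, 32, 24, 12, 4, 8, -12, 12], [6, 9, 12, 18, 15, 12, 9, 6, 8, 12, 16, 24, 20, 16, 12, 6,
        2, 4, -6, 6], [0, 0, 0, 0, 0, 0, 0, 0, 4, 6, 8, 12, 10, 8, 6, 3, 1, 2, -3, 3], [0, 0, 0,
        0, 0, 0, 0, 0, 4, 3, 5, 6, 4, 2, 0, 0, 0, 0, 0, 0], [0, 0, 0, 0, 0, 0, 0, 0, 3, 6, 6, 9,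
        6, 3, 0, 0, 0, 0, 0, 0], [0, 0, 0, 0, 0, 0, 0, 0, 5, 6, 10, 12, 8, 4, 0, 0, 0, 0, 0, 0],
        [0, 0, 0, 0, 0, 0, 0, 0, 6, 9, 12, 18, 12, 6, 0, 0, 0, 0, 0, 0], [0, 0, 0, 0, 0, 0, 0, 0,
        4, 6, 8, 12, 10, 5, 0, 0, 0, 0, 0, 0], [0, 0, 0, 0, 0, 0, 0, 0, 2, 3, 4, 6, 5, 4, 0, 0, 0,
        0, 0, 0], [0, 0, 0, 0, 0, 0, 0, 0, -2, -3, -4, -6, -5, -4, -3, 0, 0, 0, 0, 0], [0, 0, 0,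
        0, 0, 0, 0, 0, -4, -6, -8, -12, -10, -8, -6, -3, 0, 0, 0, 0], [0, 0, 0, 0, 0, 0, 0, 0, 0,
        0, 0, 0, 0, 0, 0, 0, 1, -1, 0, 0], [0, 0, 0, 0, 0, 0, 0, 0, 0, 0, 0, 0, 0, 0, 0, 0, -1,
        -2, 0, 0], [0, 0, 0, 0, 0, 0, 0, 0, 0, 0, 0, 0, 0, 0, 0, 0, 0, 0, -3, 0], [12, 18, 24, 36,
        30, 24, 18, 9, 12, 18, 24, 36, 30, 24, 18, 9, 3, 6, -9, 9]]
      rivals := [(.E7D10, []), (.E7D10, [2, 0, 2, 1, 0]), (.E7D10, [2, 0, 2, 0]), (.E7D10, [2, 1,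
      0, 2]), (.E7D10, [2, 1, 0, 2, 0]), (.E7D10, [2, 1, 0, 2, 1, 0]), (.E7D10, [1, 0]), (.E7D10,
      [0]), (.E7D10, [2, 0, 2]), (.D7A11, [1, 2, 1, 0])]
      cutHigh := 0
      cutLow := 0
      swap := []
      terms := [(20, [(5, 153), (31, 16), (8, 20), (0, 28), (6, 18), (18, 221), (17, 60), (10,
      260), (1, 521), (11, 505), (40, 25), (7, 12), (9, 260), (19, 221)]), (15, [(16, 288), (18,
      67), (6, 526), (37, 8), (0, 668), (9, 18), (17, 298), (21, 37), (3, 169), (7, 358), (36,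
      15), (8, 366)]), (4, [(1, 309), (0, 282), (7, 226), (2, 351), (12, 31), (10, 223), (19, 82),
      (16, 100), (13, 252), (22, 151)]), (3, [(21, 85), (12, 179), (0, 349), (9, 197), (6, 255),
      (1, 318), (18, 106), (2, 315)]), (41, [(14, 79), (23, 46)]), (38, [(10, 78), (19, 43)]),
      (39, [(8, 73), (17, 31)]), (42, [(21, 41), (12, 76)]), (44, [(7, 64), (16, 33)]), (43, [(9,
      83), (18, 39)]), (37, [(13, 67), (22, 29)]), (11, [(40, 75)]), (6, [(36, 59)]), (1, [(45,
      16)])]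
      coeff := 500 }
  | .D7A11 => {
      basis := [16, 6, 7, 0, 8, 5, 23, 14, 19, 11, 1, 9, 18, 3, 21, 12, 22, 2, 4, 17]
      den := 12
      duals :=
        [[48, 60, 84, 120, 96, 72, 48, 24, 42, 60, 84, 120, 96, 72, 48, 24, 2, 4, -24, 24], [60,
        96, 120, 180, 144, 108, 72, 36, 63, 90, 126, 180, 144, 108, 72, 36, 7, 14, -36, 36], [84,
        120, 168, 240, 192, 144, 96, 48, 84, 120, 168, 240, 192, 144, 96, 48, 8, 16, -48, 48],
        [120, 180, 240, 360, 288, 216, 144, 72, 126, 180, 252, 360, 288, 216, 144, 72, 14, 28,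
        -72, 72], [96, 144, 192, 288, 240, 180, 120, 60, 105, 150, 210, 300, 240, 180, 120, 60,
        13, 26, -60, 60], [48, 72, 96, 144, 120, 96, 72, 36, 63, 90, 126, 180, 144, 108, 72, 36,
        11, 22, -36, 36], [24, 36, 48, 72, 60, 48, 36, 24, 42, 60, 84, 120, 96, 72, 48, 24, 10,
        20, -24, 24], [0, 0, 0, 0, 0, 0, 0, 0, 21, 30, 42, 60, 48, 36, 24, 12, 9, 18, -12, 12],
        [0, 0, 0, 0, 0, 0, 0, 0, 6, 0, 0, 0, 0, 0, 0, 0, -2, -4, 0, 0], [0, 0, 0, 0, 0, 0, 0, 0,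
        -3, 6, -6, 0, 0, 0, 0, 0, 1, 2, 0, 0], [0, 0, 0, 0, 0, 0, 0, 0, -6, 0, -12, 0, 0, 0, 0, 0,
        2, 4, 0, 0], [0, 0, 0, 0, 0, 0, 0, 0, -9, -6, -18, -12, 0, 0, 0, 0, 3, 6, 0, 0], [0, 0, 0,
        0, 0, 0, 0, 0, -12, -12, -24, -24, -12, 0, 0, 0, 4, 8, 0, 0], [0, 0, 0, 0, 0, 0, 0, 0,
        -15, -18, -30, -36, -24, -12, 0, 0, 5, 10, 0, 0], [0, 0, 0, 0, 0, 0, 0, 0, -18, -24, -36,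
        -48, -36, -24, -12, 0, 6, 12, 0, 0], [0, 0, 0, 0, 0, 0, 0, 0, -21, -30, -42, -60, -48,
        -36, -24, -12, 7, 14, 0, 0], [0, 0, 0, 0, 0, 0, 0, 0, 0, 0, 0, 0, 0, 0, 0, 0, 4, -4, 0,
        0], [0, 0, 0, 0, 0, 0, 0, 0, 0, 0, 0, 0, 0, 0, 0, 0, 8, 16, -12, 0], [0, 0, 0, 0, 0, 0, 0,
        0, 0, 0, 0, 0, 0, 0, 0, 0, -4, -8, 0, 0], [72, 108, 144, 216, 180, 144, 96, 48, 84, 120,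
        168, 240, 192, 144, 96, 48, 12, 24, -48, 48]]
      rivals := [(.E7D10, []), (.E7D10, [2, 0, 2, 1, 0]), (.E7D10, [2, 0, 2, 0]), (.E7D10, [2, 1,
      0]), (.E7D10, [2]), (.D16, [0, 1, 2, 0, 1, 0]), (.D16, [0, 1, 2, 0, 1]), (.D16, [0, 1, 2]),
      (.D16, [0, 1, 2, 0]), (.D16, [1, 2]), (.D16, [2, 1, 2, 1, 0]), (.D16, [2, 1, 2, 0]), (.A17,
      [1, 0])]
      cutHigh := 0
      cutLow := 0
      swap := []
      terms := [(20, [(5, 353), (12, 208), (22, 109), (14, 337), (2, 221), (3, 60), (11, 35), (17,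
      191), (21, 132), (23, 446), (45, 7), (1, 24), (9, 127), (36, 62), (18, 42)]), (15, [(7,
      237), (0, 288), (1, 35), (9, 45), (12, 23), (3, 544), (2, 30), (21, 220), (18, 220), (5,
      37)]), (10, [(16, 173), (19, 93), (9, 148), (11, 290), (0, 16), (1, 494), (4, 474)]), (13,
      [(12, 138), (2, 493), (14, 294), (4, 276), (3, 6), (22, 78), (16, 237)]), (37, [(22, 51),
      (16, 28), (9, 4), (3, 3)]), (39, [(2, 7), (1, 10), (8, 40), (7, 3)]), (12, [(38, 3), (46,
      6), (44, 63)]), (36, [(5, 27), (16, 33), (23, 17)]), (38, [(19, 49), (3, 5)]), (44, [(2, 5),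
      (7, 2)]), (41, [(7, 8), (11, 45)]), (6, [(45, 4), (40, 60)]), (18, [(47, 62)]), (23, [(48,
      82)]), (21, [(46, 62)]), (0, [(40, 14)]), (14, [(42, 46)]), (9, [(43, 63)])]
      coeff := 500 }

end ChamberData

/-! ### From a certificate to orthogonality with a cusp -/

section CertificateCheck

/-- The action of a product of generators of the automorphism group of the chamber. -/
def wordL (w : List (Fin 3)) (l : List ℤ) : List ℤ :=
  w.foldr (fun i x => combL x (diagramMat i)) l

/-- The vector that compares the distances from two cusps. -/
def rivalL (t : BoundaryType) (r : BoundaryType × List (Fin 3)) : List ℤ :=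
  addL (smulL (cuspWeight r.1) (wordL r.2 (cuspL r.1))) (smulL (-cuspWeight t) (cuspL t))

/-- The simple root with a given number. -/
def rootL (i : ℕ) : List ℤ := simpleL.getD i []

/-- The vectors whose products with closest isotropic vectors are nonnegative. -/
def wallsL (t : BoundaryType) : List (List ℤ) :=
  simpleL ++ ((certificate t).rivals.map (rivalL t) ++
    [addL (rootL (certificate t).cutHigh) (smulL (-1) (rootL (certificate t).cutLow))])

/-- The first factors of the products in a certificate. -/
def leftL (vals : List ℤ) (terms : List (ℕ × List (ℕ × ℤ))) : List ℤ :=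
  terms.map fun t => vals.getD t.1 0

/-- A linear combination of the members of a list with given numbers. -/
def sparseL (vals : List ℤ) : List (ℕ × ℤ) → ℤ
  | [] => 0
  | p :: l => p.2 * vals.getD p.1 0 + sparseL vals l

/-- The second factors of the products in a certificate. -/
def rightL (vals : List ℤ) (terms : List (ℕ × List (ℕ × ℤ))) : List ℤ :=
  terms.map fun t => sparseL vals t.2

/-- The products of a vector with the vectors in a list. -/
def valuesL (ps : List (List ℤ)) (x : List ℤ) : List ℤ := ps.map fun p => dotL p (gramMulL x)

/-- The value of the bilinear form of a certificate. -/
def certL (t : BoundaryType) (x y : List ℤ) : ℤ :=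
  (certificate t).coeff * bilL x y + bilL x (cuspL t) * bilL y (cuspL t) +
    dotL (leftL (valuesL (wallsL t) x) (certificate t).terms)
      (rightL (valuesL (wallsL t) y) (certificate t).terms)

/-- The verification of a property of the pairs of members of a list. -/
def pairsL {α : Type*} (p : α → α → Bool) : List α → Bool
  | [] => true
  | x :: l => (x :: l).all (p x) && pairsL p l

/-- By symmetry of `p` only unordered pairs have to be evaluated, which halves the computation. -/
theorem pairsL_spec {α : Type*} {p : α → α → Bool} (hp : ∀ x y, p x y = p y x) {l : List α}
    (h : pairsL p l = true) : ∀ x ∈ l, ∀ y ∈ l, p x y = true := by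
  induction l with
  | nil => simp
  | cons a l ih =>
    simp only [pairsL, Bool.and_eq_true, List.all_eq_true] at h
    intro x hx y hy
    rcases List.mem_cons.1 hx with rfl | hx'
    · exact h.1 y hy
    · rcases List.mem_cons.1 hy with rfl | hy'
      · rw [hp]
        exact h.1 x hx
      · exact ih h.2 x hx' y hy'

/-- The computational core of the classification: the symmetrized coefficients of the certificate
form, in the basis of the rays of a simplicial cone, are all nonpositive. Hence the form is
nonpositive on that cone. -/
theorem pairsL_certL (t : BoundaryType) :
    pairsL (fun x y => decide (certL t x y + certL t y x ≤ 0)) (certificate t).duals = true := by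
  cases t <;> decide +kernel

theorem certL_add_le (t : BoundaryType) {x y : List ℤ} (hx : x ∈ (certificate t).duals)
    (hy : y ∈ (certificate t).duals) : certL t x y + certL t y x ≤ 0 := by
  have := pairsL_spec (fun x y => by simp only [add_comm]) (pairsL_certL t) x hx y hy
  simpa using this

theorem length_duals (t : BoundaryType) : ∀ x ∈ (certificate t).duals, x.length = 20 := by
  cases t <;> decide +kernel

theorem length_wallsL (t : BoundaryType) : ∀ x ∈ wallsL t, x.length = 20 := by
  cases t <;> decide +kernel

theorem length_cuspL (t : BoundaryType) : (cuspL t).length = 20 := by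
  cases t <;> decide +kernel

theorem basis_lt (t : BoundaryType) : ∀ i ∈ (certificate t).basis, i < 36 := by
  cases t <;> decide +kernel

theorem den_pos (t : BoundaryType) : 0 < (certificate t).den := by
  cases t <;> decide +kernel

theorem combL_duals (t : BoundaryType) : ∀ i < 20,
    combL ((certificate t).basis.map fun j => dotL (gramMulL (rootL j)) (unitL i))
      (certificate t).duals = smulL (certificate t).den (unitL i) := by
  cases t <;> decide +kernel

/-- The index bounds ensure that no default value of `getD` enters the certificate; nonnegativity of
the coefficients makes the products nonnegative at points satisfying the wall inequalities. -/
theorem terms_lt (t : BoundaryType) : ∀ p ∈ (certificate t).terms,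
    p.1 < (wallsL t).length ∧ ∀ q ∈ p.2, q.1 < (wallsL t).length ∧ 0 ≤ q.2 := by
  cases t <;> decide +kernel

theorem length_rootL : ∀ i < 36, (rootL i).length = 20 := by decide +kernel

/-- The coordinates of `den • x` in the dual basis are the products of `x` with twenty of the simple
roots. They are nonnegative in the chamber, so the chamber lies in the cone spanned by the dual
basis. -/
theorem den_smul_eq (t : BoundaryType) (x : Lambda1) :
    (certificate t).den • x = lincomb ((certificate t).basis.map fun j =>
      dotWith (gramMulL (rootL j))) ((certificate t).duals.map ofList) x := by
  have h : (certificate t).den • LinearMap.id = lincomb ((certificate t).basis.map fun j =>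
      dotWith (gramMulL (rootL j))) ((certificate t).duals.map ofList) := by
    refine ext_unitL fun i hi => ?_
    rw [lincomb_apply, List.map_map]
    have e : (fun f : Lambda1 →ₗ[ℤ] ℤ => f (ofList (unitL i))) ∘
        (fun j => dotWith (gramMulL (rootL j))) =
        fun j => dotL (gramMulL (rootL j)) (unitL i) := by
      funext j
      exact dotWith_ofList _ (length_unitL i)
    rw [e, combL_duals t i hi, ofList_smulL]
    rfl
  exact congrArg (fun f => f x) h

/-- The bilinear form of a certificate. -/
noncomputable def termsForm (ws : List (List ℤ)) :
    List (ℕ × List (ℕ × ℤ)) → LinearMap.BilinForm ℤ Lambda1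
  | [] => 0
  | p :: l => LinearMap.BilinForm.linMulLin (dotWith (gramMulL (ws.getD p.1 [])))
      ((p.2.map fun q => q.2 • dotWith (gramMulL (ws.getD q.1 []))).sum) + termsForm ws l

theorem dotL_comm (l m : List ℤ) : dotL l m = dotL m l := by
  induction l generalizing m with
  | nil => cases m <;> rfl
  | cons a l ih =>
    cases m with
    | nil => rfl
    | cons b m => simp [dotL, ih, mul_comm]

theorem bilL_comm {l m : List ℤ} (hl : l.length = 20) (hm : m.length = 20) :
    bilL l m = bilL m l := by
  rw [← form1_ofList hl hm, ← form1_ofList hm hl, form1_comm]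

theorem getD_valuesL {ws : List (List ℤ)} {x : List ℤ} (hx : x.length = 20)
    (hw : ∀ w ∈ ws, w.length = 20) {i : ℕ} (hi : i < ws.length) :
    (valuesL ws x).getD i 0 = dotWith (gramMulL (ws.getD i [])) (ofList x) := by
  rw [dotWith_ofList _ hx, valuesL, List.getD_eq_getElem _ _ (by simpa using hi),
    List.getElem_map, List.getD_eq_getElem _ _ hi]
  change bilL _ _ = _
  rw [bilL_comm (hw _ (List.getElem_mem hi)) hx, bilL, dotL_comm]

theorem termsForm_ofList {ws : List (List ℤ)} (hw : ∀ w ∈ ws, w.length = 20)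
    {ts : List (ℕ × List (ℕ × ℤ))}
    (ht : ∀ p ∈ ts, p.1 < ws.length ∧ ∀ q ∈ p.2, q.1 < ws.length ∧ 0 ≤ q.2)
    {x y : List ℤ} (hx : x.length = 20) (hy : y.length = 20) :
    termsForm ws ts (ofList x) (ofList y) =
      dotL (leftL (valuesL ws x) ts) (rightL (valuesL ws y) ts) := by
  induction ts with
  | nil => rfl
  | cons p ts ih =>
    have h1 := ih fun q hq => ht q (List.mem_cons_of_mem _ hq)
    obtain ⟨hp, hq⟩ := ht p List.mem_cons_self
    simp only [termsForm, leftL, rightL, List.map_cons, dotL, LinearMap.add_apply,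
      LinearMap.BilinForm.linMulLin_apply, getD_valuesL hx hw hp] at h1 ⊢
    rw [h1]
    congr 2
    generalize p.2 = l at hq ⊢
    induction l with
    | nil => rfl
    | cons a l il =>
      simp only [List.map_cons, List.sum_cons, sparseL, LinearMap.add_apply,
        LinearMap.smul_apply, smul_eq_mul, getD_valuesL hy hw (hq a List.mem_cons_self).1]
      rw [il fun q hq' => hq q (List.mem_cons_of_mem _ hq')]

theorem termsForm_nonneg {ws : List (List ℤ)} {ts : List (ℕ × List (ℕ × ℤ))}
    (ht : ∀ p ∈ ts, p.1 < ws.length ∧ ∀ q ∈ p.2, q.1 < ws.length ∧ 0 ≤ q.2)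
    {x : Lambda1} (hx : ∀ w ∈ ws, 0 ≤ dotWith (gramMulL w) x) : 0 ≤ termsForm ws ts x x := by
  have hx' : ∀ i < ws.length, 0 ≤ dotWith (gramMulL (ws.getD i [])) x := by
    intro i hi
    rw [List.getD_eq_getElem _ _ hi]
    exact hx _ (List.getElem_mem hi)
  induction ts with
  | nil => simp [termsForm]
  | cons p ts ih =>
    obtain ⟨hp, hq⟩ := ht p List.mem_cons_self
    rw [termsForm, LinearMap.add_apply, LinearMap.add_apply,
      LinearMap.BilinForm.linMulLin_apply]
    refine add_nonneg (mul_nonneg (hx' _ hp) ?_) (ih fun q hq => ht q (List.mem_cons_of_mem _ hq))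
    generalize p.2 = l at hq ⊢
    induction l with
    | nil => simp
    | cons a l il =>
      rw [List.map_cons, List.sum_cons, LinearMap.add_apply]
      exact add_nonneg (mul_nonneg (hq a List.mem_cons_self).2 (hx' _ (hq a List.mem_cons_self).1))
        (il fun q hq' => hq q (List.mem_cons_of_mem _ hq'))

/-- The value at a combination with coefficients `f x ≥ 0` is a nonnegative combination of the
numbers `F v w + F w v`. Only these are controlled, because `F` need not be symmetric. -/
theorem apply_lincomb_nonpos {M : Type*} [AddCommGroup M] (F : LinearMap.BilinForm ℤ M)
    {fs : List (M →ₗ[ℤ] ℤ)} {vs : List M} {x : M} (hf : ∀ f ∈ fs, 0 ≤ f x)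
    (hv : ∀ v ∈ vs, ∀ w ∈ vs, F v w + F w v ≤ 0) :
    F (lincomb fs vs x) (lincomb fs vs x) ≤ 0 := by
  have h1 : ∀ (fs : List (M →ₗ[ℤ] ℤ)) (vs : List M) (w : M), (∀ f ∈ fs, 0 ≤ f x) →
      (∀ v ∈ vs, F v w + F w v ≤ 0) →
      F (lincomb fs vs x) w + F w (lincomb fs vs x) ≤ 0 := by
    intro fs
    induction fs with
    | nil => intro vs w _ _; simp [lincomb]
    | cons f fs ih =>
      intro vs w hf hv
      cases vs with
      | nil => simp [lincomb]
      | cons v vs =>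
        have h2 := ih vs w (fun g hg => hf g (List.mem_cons_of_mem _ hg))
          (fun u hu => hv u (List.mem_cons_of_mem _ hu))
        have h3 := mul_nonneg (hf f List.mem_cons_self)
          (neg_nonneg.2 (hv v List.mem_cons_self))
        simp only [lincomb, LinearMap.add_apply, LinearMap.smulRight_apply, map_add, map_smul,
          LinearMap.smul_apply, smul_eq_mul]
        linarith
  -- `h1` is applied twice: here to expand one argument against each generator, and at the end to
  -- expand the other.
  have h4 : ∀ v ∈ vs, F v (lincomb fs vs x) + F (lincomb fs vs x) v ≤ 0 := by
    intro v hvv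
    have := h1 fs vs v hf (fun w hw => hv w hw v hvv)
    linarith
  have := h1 fs vs _ hf h4
  linarith

theorem wallsL_root (t : BoundaryType) {i : ℕ} (hi : i < 36) : rootL i ∈ wallsL t := by
  have h : i < simpleL.length := hi
  rw [rootL, List.getD_eq_getElem _ _ h]
  exact List.mem_append_left _ (List.getElem_mem h)

/-- An isotropic vector that is in the closed polyhedral cone given by the walls is orthogonal to
the cusp. -/
theorem form1_cuspL_eq_zero (t : BoundaryType) {x : Lambda1} (hx : form1 x x = 0)
    (hw : ∀ w ∈ wallsL t, 0 ≤ form1 x (ofList w)) : form1 x (ofList (cuspL t)) = 0 := by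
  have hw' : ∀ w ∈ wallsL t, 0 ≤ dotWith (gramMulL w) x := fun w h => by
    rw [← form1_eq_dotWith (length_wallsL t w h)]
    exact hw w h
  -- The form of the certificate. On the generators it is the integer `certL`, so its sign on the
  -- cone is known.
  set F : LinearMap.BilinForm ℤ Lambda1 := (certificate t).coeff • form1 +
    LinearMap.BilinForm.linMulLin (dotWith (gramMulL (cuspL t))) (dotWith (gramMulL (cuspL t))) +
    termsForm (wallsL t) (certificate t).terms with hF
  have hFl : ∀ y ∈ (certificate t).duals, ∀ z ∈ (certificate t).duals,
      F (ofList y) (ofList z) = certL t y z := by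
    intro y hy z hz
    have ly := length_duals t y hy
    have lz := length_duals t z hz
    simp only [hF, LinearMap.add_apply, LinearMap.smul_apply,
      LinearMap.BilinForm.linMulLin_apply, form1_ofList ly lz,
      termsForm_ofList (length_wallsL t) (terms_lt t) ly lz, ← form1_eq_dotWith (length_cuspL t),
      form1_ofList ly (length_cuspL t), form1_ofList lz (length_cuspL t), certL, smul_eq_mul]
  have h1 : F ((certificate t).den • x) ((certificate t).den • x) ≤ 0 := by
    rw [den_smul_eq]
    apply apply_lincomb_nonpos
    · intro f hf
      obtain ⟨j, hj, rfl⟩ := List.mem_map.1 hf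
      exact hw' _ (wallsL_root t (basis_lt t j hj))
    · intro v hv w hw
      obtain ⟨y, hy, rfl⟩ := List.mem_map.1 hv
      obtain ⟨z, hz, rfl⟩ := List.mem_map.1 hw
      rw [hFl y hy z hz, hFl z hz y hy]
      exact certL_add_le t hy hz
  have h2 : F x x ≤ 0 := by
    rw [map_smul, map_smul, LinearMap.smul_apply, smul_eq_mul, smul_eq_mul] at h1
    have hd := den_pos t
    by_contra hne
    push Not at hne
    have := mul_pos hd (mul_pos hd hne)
    linarith
  -- Isotropy of `x` removes the `form1` term; a square and a nonnegative sum remain, while `F x x ≤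
  -- 0`.
  have h3 : F x x = form1 x (ofList (cuspL t)) * form1 x (ofList (cuspL t)) +
      termsForm (wallsL t) (certificate t).terms x x := by
    simp only [hF, LinearMap.add_apply, LinearMap.smul_apply, hx,
      LinearMap.BilinForm.linMulLin_apply, ← form1_eq_dotWith (length_cuspL t), smul_zero,
      zero_add]
  have h4 := termsForm_nonneg (terms_lt t) hw'
  have h5 : form1 x (ofList (cuspL t)) * form1 x (ofList (cuspL t)) ≤ 0 := by linarith
  nlinarith [mul_self_nonneg (form1 x (ofList (cuspL t)))]

end CertificateCheck

/-! ### Reflections, the isometry `-1`, and primitive vectors -/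

section Isometries

theorem exists_min_of_nonneg {α : Type*} {s : Set α} (hs : s.Nonempty) (f : α → ℤ)
    (hf : ∀ a ∈ s, 0 ≤ f a) : ∃ a ∈ s, ∀ b ∈ s, f a ≤ f b := by
  obtain ⟨a, ha, h⟩ := (measure fun a => (f a).toNat).wf.has_min s hs
  refine ⟨a, ha, fun b hb => ?_⟩
  have h1 : ¬ (f b).toNat < (f a).toNat := h b hb
  have := hf a ha
  have := hf b hb
  omega

/-- The isometry `x ↦ x - φ(x) R`, if `φ` is a multiple of the product with `R` and `φ(R) = 2`. -/
noncomputable def reflectionEquiv {M : Type*} [AddCommGroup M] (B : LinearMap.BilinForm ℤ M)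
    (hB : ∀ x y, B x y = B y x) (R : M) (φ : M →ₗ[ℤ] ℤ) (k : ℤ) (hk : k ≠ 0)
    (hφ : ∀ x, k * φ x = B x R) (hR : B R R = 2 * k) : B.IsometryEquiv B where
  toLinearEquiv := LinearEquiv.ofInvolutive (LinearMap.id - φ.smulRight R) (by
    have h2 : φ R = 2 := by
      have := hφ R
      rw [hR] at this
      exact mul_left_cancel₀ hk (by linarith)
    intro x
    simp only [LinearMap.sub_apply, LinearMap.id_apply, LinearMap.smulRight_apply, map_sub,
      map_smul, h2]
    module)
  map_app' x y := by
    change B (x - φ x • R) (y - φ y • R) = B x y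
    simp only [map_sub, LinearMap.sub_apply, map_smul, LinearMap.smul_apply, smul_eq_mul, hR,
      hB R y, ← hφ]
    ring

theorem reflectionEquiv_apply {M : Type*} [AddCommGroup M] (B : LinearMap.BilinForm ℤ M)
    (hB : ∀ x y, B x y = B y x) (R : M) (φ : M →ₗ[ℤ] ℤ) (k : ℤ) (hk : k ≠ 0)
    (hφ : ∀ x, k * φ x = B x R) (hR : B R R = 2 * k) (x : M) :
    reflectionEquiv B hB R φ k hk hφ hR x = x - φ x • R := rfl

/-- The isometry `-1`. -/
noncomputable def negEquiv {M : Type*} [AddCommGroup M] (B : LinearMap.BilinForm ℤ M) :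
    B.IsometryEquiv B where
  toLinearEquiv := LinearEquiv.neg ℤ
  map_app' x y := by simp

theorem negEquiv_apply {M : Type*} [AddCommGroup M] (B : LinearMap.BilinForm ℤ M) (x : M) :
    negEquiv B x = -x := rfl

theorem IsPrimitiveVector.map {M N : Type*} [AddCommGroup M] [AddCommGroup N] {v : M}
    (hv : IsPrimitiveVector v) (g : M ≃ₗ[ℤ] N) : IsPrimitiveVector (g v) := by
  intro n w h
  refine hv n (g.symm w) ?_
  rw [← map_smul, ← h, LinearEquiv.symm_apply_apply]

theorem IsPrimitiveVector.ne_zero {M : Type*} [AddCommGroup M] {v : M}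
    (hv : IsPrimitiveVector v) : v ≠ 0 := by
  rintro rfl
  have := hv 0 0 (by simp)
  simp at this

theorem isPrimitiveVector_of_apply_eq_one {M : Type*} [AddCommGroup M] (f : M →ₗ[ℤ] ℤ) {v : M}
    (h : f v = 1) : IsPrimitiveVector v := by
  intro n w hw
  rw [hw, map_smul, smul_eq_mul] at h
  exact IsUnit.of_mul_eq_one _ h

theorem exists_smul_of_dvd {ι : Type*} {x : ι → ℤ} {n : ℤ} (h : ∀ i, n ∣ x i) :
    ∃ w, x = n • w := by
  choose w hw using h
  exact ⟨w, funext hw⟩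

/-- Proportional primitive vectors agree up to sign. -/
theorem eq_or_eq_neg_of_smul_eq {ι : Type*} {x y : ι → ℤ} (hx : IsPrimitiveVector x)
    (hy : IsPrimitiveVector y) {m n : ℤ} (hn : n ≠ 0) (h : n • x = m • y) : x = y ∨ x = -y := by
  obtain ⟨g, n', m', hg, hc, rfl, rfl⟩ := Int.exists_gcd_one' (m := n) (n := m)
    (Int.gcd_pos_of_ne_zero_left m hn)
  have hg0 : (g : ℤ) ≠ 0 := by positivity
  have h' : n' • x = m' • y := by
    have : (g : ℤ) • (n' • x - m' • y) = 0 := by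
      rw [smul_sub, smul_smul, smul_smul, mul_comm _ n', mul_comm _ m', h, sub_self]
    rcases smul_eq_zero.1 this with h0 | h0
    · exact absurd h0 hg0
    · exact sub_eq_zero.1 h0
  have hco : IsCoprime n' m' := Int.isCoprime_iff_gcd_eq_one.2 hc
  have hn' : IsUnit n' := by
    obtain ⟨w, hw⟩ := exists_smul_of_dvd (x := y) (n := n') fun i =>
      hco.dvd_of_dvd_mul_left ⟨x i, (congrFun h' i).symm⟩
    exact hy _ _ hw
  have hm' : IsUnit m' := by
    obtain ⟨w, hw⟩ := exists_smul_of_dvd (x := x) (n := m') fun i =>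
      hco.symm.dvd_of_dvd_mul_left ⟨y i, congrFun h' i⟩
    exact hx _ _ hw
  rcases Int.isUnit_iff.1 hn' with rfl | rfl <;> rcases Int.isUnit_iff.1 hm' with rfl | rfl
  · left; simpa using h'
  · right; simpa using h'
  · right; simpa using congrArg Neg.neg h'
  · left; simpa using h'

end Isometries

/-! ### Isotropic vectors in a hyperbolic lattice -/

section ForwardCone

/-- The strict case of the reversed Cauchy–Schwarz inequality: an isotropic vector orthogonal to a
vector of negative norm vanishes. It makes the product with `weylVector` strictly positive on orbit
representatives. -/
theorem form1_neg_of_isForward {x y : Lambda1} (hx : form1 x x = 0) (x0 : x ≠ 0)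
    (hy : form1 y y < 0) (fx : IsForward x) (fy : IsForward y) : form1 x y < 0 := by
  refine lt_of_le_of_ne (form1_nonpos_of_isForward hx.le hy.le fx fy) fun h0 => x0 ?_
  have hc := LinearMap.BilinForm.apply_sq_le_of_symm formN formN_nonneg
    (⟨fun x y => formN_comm x y⟩) x y
  rw [form1_eq] at hx hy h0
  obtain ⟨x0, x1⟩ := fx
  obtain ⟨y0, y1⟩ := fy
  have nx := formN_nonneg x
  have ny := formN_nonneg y
  have hN : formN x x = 0 ∧ uZero x = 0 ∧ uOne x = 0 := by
    set a := uZero x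
    set b := uOne x
    set c := uZero y
    set d := uOne y
    have hc' : c < 0 := lt_of_le_of_ne y0 fun h => by
      rw [h] at hy
      simp at hy
      linarith
    have hd' : 0 < d := lt_of_le_of_ne y1 fun h => by
      rw [← h] at hy
      simp at hy
      linarith
    have h1 : formN x y = -(a * d + b * c) := by linarith
    have h2 : formN x x = -(2 * (a * b)) := by linarith
    rw [h1, h2] at hc
    have hab : a * b ≤ 0 := mul_nonpos_of_nonpos_of_nonneg x0 x1
    have h3 : -(2 * (a * b)) * formN y y ≤ -(2 * (a * b)) * (-(2 * (c * d))) :=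
      mul_le_mul_of_nonneg_left (by linarith) (by linarith)
    have h4 : a * b = 0 := by
      by_contra hne
      have h5 : 0 < -(2 * (a * b)) := by
        have := lt_of_le_of_ne hab hne
        linarith
      have h6 : -(2 * (a * b)) * formN y y < -(2 * (a * b)) * (-(2 * (c * d))) :=
        mul_lt_mul_of_pos_left (by linarith) h5
      nlinarith [sq_nonneg (a * d - b * c)]
    have h7 : (a * d + b * c) ^ 2 ≤ 0 := by
      rw [h4] at hc
      linarith
    have h8 : a * d + b * c = 0 := by nlinarith [sq_nonneg (a * d + b * c)]
    have h9 : a * d ≤ 0 := mul_nonpos_of_nonpos_of_nonneg x0 hd'.le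
    have h10 : b * c ≤ 0 := mul_nonpos_of_nonneg_of_nonpos x1 hc'.le
    have ha : a = 0 := by
      rcases mul_eq_zero.1 (show a * d = 0 by linarith) with h | h
      · exact h
      · exact absurd h hd'.ne'
    have hb : b = 0 := by
      rcases mul_eq_zero.1 (show b * c = 0 by linarith) with h | h
      · exact h
      · exact absurd h hc'.ne
    exact ⟨by rw [h2, h4]; ring, ha, hb⟩
  exact eq_zero_of_formN hN.1 hN.2.1 hN.2.2

/-- The sign of the product with one forward vector decides between the two halves of the light
cone; this keeps reflected vectors in the forward half. -/
theorem isForward_of_form1_neg {x y : Lambda1} (hx : form1 x x ≤ 0) (hy : form1 y y = 0)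
    (fx : IsForward x) (h : form1 x y < 0) : IsForward y := by
  rcases isForward_or_neg hy with fy | fy
  · exact fy
  · have := form1_nonpos_of_isForward hx (y := -y) (by simp [hy]) fx fy
    rw [map_neg] at this
    linarith

/-- Signature `(19, 1)` leaves no room for an isotropic plane: the combination of `x` and `y` that
cancels one hyperbolic coordinate is isotropic and must vanish. Primitivity turns proportionality
into equality up to sign. -/
theorem eq_or_eq_neg_of_form1_eq_zero {x y : Lambda1} (hx : IsPrimitiveVector x)
    (hy : IsPrimitiveVector y) (hxx : form1 x x = 0) (hyy : form1 y y = 0)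
    (hxy : form1 x y = 0) : x = y ∨ x = -y := by
  have hyx : form1 y x = 0 := by rw [form1_comm, hxy]
  have aux : ∀ (a b : ℤ), form1 (a • x - b • y) (a • x - b • y) = 0 := by
    intro a b
    simp only [map_sub, LinearMap.sub_apply, map_smul, LinearMap.smul_apply, hxx, hyy, hxy, hyx]
    simp
  have key : ∀ z : Lambda1, form1 z z = 0 → uOne z = 0 → uZero z = 0 → z = 0 := by
    intro z hz h1 h0
    rw [form1_eq, h1, h0] at hz
    exact eq_zero_of_formN (by linarith) h0 h1
  by_cases h1 : uOne x = 0
  · have h0 : uZero x ≠ 0 := fun h0 => hx.ne_zero (key x hxx h1 h0)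
    have hNx : formN x x = 0 := by
      rw [form1_eq, h1] at hxx
      linarith
    have hNxy : formN x y = 0 := by
      have hc := LinearMap.BilinForm.apply_sq_le_of_symm formN formN_nonneg
        (⟨fun x y => formN_comm x y⟩) x y
      rw [hNx, zero_mul] at hc
      nlinarith [sq_nonneg (formN x y)]
    have hy1 : uOne y = 0 := by
      rw [form1_eq, hNxy, h1] at hxy
      have : uZero x * uOne y = 0 := by linarith
      exact (mul_eq_zero.1 this).resolve_left h0
    by_cases hy0 : uZero y = 0
    · exact absurd (key y hyy hy1 hy0) hy.ne_zero
    · refine eq_or_eq_neg_of_smul_eq hx hy hy0 (m := uZero x) (sub_eq_zero.1 ?_)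
      refine key _ (aux _ _) ?_ ?_
      · simp [h1, hy1]
      · simp [mul_comm]
  · by_cases hy1 : uOne y = 0
    · have hNy : formN y y = 0 := by
        rw [form1_eq, hy1] at hyy
        linarith
      have hNxy : formN x y = 0 := by
        have hc := LinearMap.BilinForm.apply_sq_le_of_symm formN formN_nonneg
          (⟨fun x y => formN_comm x y⟩) x y
        rw [hNy, mul_zero] at hc
        nlinarith [sq_nonneg (formN x y)]
      have hy0 : uZero y = 0 := by
        rw [form1_eq, hNxy, hy1] at hxy
        have : uOne x * uZero y = 0 := by linarith
        exact (mul_eq_zero.1 this).resolve_left h1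
      exact absurd (key y hyy hy1 hy0) hy.ne_zero
    · refine eq_or_eq_neg_of_smul_eq hx hy hy1 (m := uOne x) (sub_eq_zero.1 ?_)
      -- Since `uOne z = 0`, isotropy says `formN z z = 0`; then `formN z x = 0` by Cauchy–Schwarz,
      -- and `form1 z x = 0` makes `uZero z` vanish as well.
      set z := uOne y • x - uOne x • y with hz
      have hz1 : uOne z = 0 := by simp [hz, mul_comm]
      have hzx : form1 z x = 0 := by
        rw [hz, map_sub, LinearMap.sub_apply, map_smul, map_smul, LinearMap.smul_apply,
          LinearMap.smul_apply, hxx, hyx, smul_zero, smul_zero, sub_zero]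
      have hNz : formN z z = 0 := by
        have := aux (uOne y) (uOne x)
        rw [← hz, form1_eq, hz1] at this
        linarith
      have hNzx : formN z x = 0 := by
        have hc := LinearMap.BilinForm.apply_sq_le_of_symm formN formN_nonneg
          (⟨fun x y => formN_comm x y⟩) z x
        rw [hNz, zero_mul] at hc
        nlinarith [sq_nonneg (formN z x)]
      have hz0 : uZero z = 0 := by
        rw [form1_eq, hNzx, hz1] at hzx
        have : uZero z * uOne x = 0 := by linarith
        exact (mul_eq_zero.1 this).resolve_right h1
      exact eq_zero_of_formN hNz hz0 hz1

end ForwardCone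

/-! ### Reflections and diagram automorphisms of the chamber -/

section ChamberIsometries

/-- The type of a simple root of the chamber: `1` for long roots, `3` for short roots. -/
def rootDiv (i : ℕ) : ℤ := if i < 24 then 1 else 3

theorem rootDiv_ne_zero (i : ℕ) : rootDiv i ≠ 0 := by
  unfold rootDiv
  split_ifs <;> norm_num

/-- The simple roots of the chamber, those of the short roots multiplied by `3`. -/
def simpleRoot (i : ℕ) : Lambda1 := ofList (rootL i)

/-- The coefficients of the function that defines the reflection in a simple root. -/
def corootL (i : ℕ) : List ℤ := (gramMulL (rootL i)).map fun a => a / rootDiv i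

/-- The integer division in `corootL` is exact: three times a short root has all its products with
`Λ₁` divisible by `3`. Thus the reflections in short roots preserve the lattice. -/
theorem smulL_corootL : ∀ i < 36, smulL (rootDiv i) (corootL i) = gramMulL (rootL i) := by
  decide +kernel

theorem bilL_rootL : ∀ i < 36, bilL (rootL i) (rootL i) = 2 * rootDiv i := by decide +kernel

/-- The linear function that defines the reflection in a simple root. -/
def coroot (i : ℕ) : Lambda1 →ₗ[ℤ] ℤ := dotWith (corootL i)

theorem dotL_smulL (c : ℤ) (p l : List ℤ) : dotL (smulL c p) l = c * dotL p l := by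
  induction p generalizing l with
  | nil => cases l <;> simp [smulL, dotL]
  | cons a p ih =>
    cases l with
    | nil => simp [smulL, dotL]
    | cons b l =>
      simp only [smulL, dotL, ih]
      ring

theorem exists_ofList (x : Lambda1) : ∃ l : List ℤ, l.length = 20 ∧ x = ofList l := by
  refine ⟨coordFns.map fun f => f x, by simp [coordFns], ?_⟩
  funext i
  rcases i with i | i | i | i <;> fin_cases i <;> rfl

theorem rootDiv_mul_coroot {i : ℕ} (hi : i < 36) (x : Lambda1) :
    rootDiv i * coroot i x = form1 x (simpleRoot i) := by
  obtain ⟨l, hl, rfl⟩ := exists_ofList x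
  rw [simpleRoot, form1_eq_dotWith (length_rootL i hi), coroot, dotWith_ofList _ hl,
    dotWith_ofList _ hl, ← smulL_corootL i hi, dotL_smulL]

theorem form1_simpleRoot {i : ℕ} (hi : i < 36) :
    form1 (simpleRoot i) (simpleRoot i) = 2 * rootDiv i := by
  rw [simpleRoot, form1_ofList (length_rootL i hi) (length_rootL i hi), bilL_rootL i hi]

/-- Each generator is an involution, which gives invertibility without a separate inverse matrix,
and it preserves the form on basis vectors. -/
theorem diagramMat_spec (a : Fin 3) : (diagramMat a).length = 20 ∧
    (∀ i < 20, (combL (unitL i) (diagramMat a)).length = 20 ∧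
      combL (combL (unitL i) (diagramMat a)) (diagramMat a) = unitL i) ∧
    ∀ i < 20, ∀ j < 20, bilL (combL (unitL i) (diagramMat a)) (combL (unitL j) (diagramMat a)) =
      bilL (unitL i) (unitL j) := by
  fin_cases a <;> decide +kernel

/-- The generators of the automorphism group of the chamber. -/
noncomputable def diagramEquiv (a : Fin 3) : form1.IsometryEquiv form1 where
  toLinearEquiv := LinearEquiv.ofInvolutive (matMap (diagramMat a)) (by
    intro x
    have h : matMap (diagramMat a) ∘ₗ matMap (diagramMat a) = LinearMap.id := by
      refine ext_unitL fun i hi => ?_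
      obtain ⟨h1, h2⟩ := (diagramMat_spec a).2.1 i hi
      rw [LinearMap.comp_apply, matMap_ofList (length_unitL i), matMap_ofList h1, h2]
      rfl
    exact congrArg (fun f => f x) h)
  map_app' x y := by
    change form1 (matMap (diagramMat a) x) (matMap (diagramMat a) y) = form1 x y
    have h : form1.compl₁₂ (matMap (diagramMat a)) (matMap (diagramMat a)) = form1 := by
      refine ext_unitL fun i hi => ext_unitL fun j hj => ?_
      rw [LinearMap.compl₁₂_apply, matMap_ofList (length_unitL i), matMap_ofList (length_unitL j),
        form1_ofList ((diagramMat_spec a).2.1 i hi).1 ((diagramMat_spec a).2.1 j hj).1,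
        form1_ofList (length_unitL i) (length_unitL j), (diagramMat_spec a).2.2 i hi j hj]
    exact congrArg (fun f => f x y) h

theorem diagramEquiv_apply (a : Fin 3) (x : Lambda1) :
    diagramEquiv a x = matMap (diagramMat a) x := rfl

/-- Products of generators of the automorphism group of the chamber. -/
noncomputable def wordEquiv : List (Fin 3) → form1.IsometryEquiv form1
  | [] => LinearMap.BilinForm.IsometryEquiv.refl form1
  | a :: w => (wordEquiv w).trans (diagramEquiv a)

theorem wordEquiv_cons (a : Fin 3) (w : List (Fin 3)) (x : Lambda1) :
    wordEquiv (a :: w) x = diagramEquiv a (wordEquiv w x) := rfl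

/-- All intermediate steps of the application of a word to a list have length `20`. -/
def wordLengths (w : List (Fin 3)) (l : List ℤ) : Bool :=
  w.tails.all fun v => (wordL v l).length == 20

theorem wordEquiv_ofList {w : List (Fin 3)} {l : List ℤ} (h : wordLengths w l = true) :
    (wordL w l).length = 20 ∧ wordEquiv w (ofList l) = ofList (wordL w l) := by
  induction w with
  | nil => exact ⟨by simpa [wordLengths] using h, rfl⟩
  | cons a w ih =>
    simp only [wordLengths, List.tails, List.all_cons, Bool.and_eq_true, beq_iff_eq] at h
    obtain ⟨h1, h2⟩ := ih (by simpa [wordLengths] using h.2)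
    refine ⟨h.1, ?_⟩
    rw [wordEquiv_cons, h2, diagramEquiv_apply, matMap_ofList h1]
    rfl

/-- The cusps. -/
def cusp (t : BoundaryType) : Lambda1 := ofList (cuspL t)

/-- The invariant vector in the chamber. -/
def weylVector : Lambda1 := ofList weylL

theorem weylL_spec : weylL.length = 20 ∧ bilL weylL weylL < 0 ∧
    (∀ i < 36, bilL (rootL i) weylL < 0) ∧ ∀ a : Fin 3, combL weylL (diagramMat a) = weylL := by
  decide +kernel

theorem wordEquiv_weylVector (w : List (Fin 3)) : wordEquiv w weylVector = weylVector := by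
  induction w with
  | nil => rfl
  | cons a w ih =>
    rw [wordEquiv_cons, ih, weylVector, diagramEquiv_apply, matMap_ofList weylL_spec.1,
      weylL_spec.2.2.2]

/-- The product `1` gives primitivity of the cusp. The last clause places the negative of the cusp
in the chamber. -/
theorem cuspPartnerL_spec (t : BoundaryType) : (cuspPartnerL t).length = 20 ∧
    bilL (cuspL t) (cuspPartnerL t) = 1 ∧ bilL (cuspL t) (cuspL t) = 0 ∧
    ∀ i < 36, bilL (rootL i) (cuspL t) ≤ 0 := by
  cases t <;> decide +kernel

theorem form1_cusp_partner (t : BoundaryType) :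
    form1 (cusp t) (ofList (cuspPartnerL t)) = 1 := by
  rw [cusp, form1_ofList (length_cuspL t) (cuspPartnerL_spec t).1, (cuspPartnerL_spec t).2.1]

theorem isPrimitiveVector_cusp (t : BoundaryType) : IsPrimitiveVector (cusp t) := by
  apply isPrimitiveVector_of_apply_eq_one (LinearMap.flip form1 (ofList (cuspPartnerL t)))
  exact form1_cusp_partner t

theorem form1_cusp (t : BoundaryType) : form1 (cusp t) (cusp t) = 0 := by
  rw [cusp, form1_ofList (length_cuspL t) (length_cuspL t), (cuspPartnerL_spec t).2.2.1]

theorem isForward_neg_cusp (t : BoundaryType) : IsForward (-cusp t) := by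
  constructor
  · cases t <;> decide +kernel
  · cases t <;> decide +kernel

theorem isForward_neg_weylVector : IsForward (-weylVector) := by
  constructor <;> decide +kernel

/-- The cut by `cutHigh` and `cutLow` is legitimate because a symmetry fixing the cusp interchanges
the two roots. Where no cut is needed, both numbers are `0` and the word is empty. -/
theorem swap_spec (t : BoundaryType) :
    (certificate t).cutHigh < 36 ∧ (certificate t).cutLow < 36 ∧
    wordLengths (certificate t).swap (cuspL t) = true ∧
    wordL (certificate t).swap (cuspL t) = cuspL t ∧
    wordLengths (certificate t).swap (rootL (certificate t).cutHigh) = true ∧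
    wordL (certificate t).swap (rootL (certificate t).cutHigh) = rootL (certificate t).cutLow ∧
    wordLengths (certificate t).swap (rootL (certificate t).cutLow) = true ∧
    wordL (certificate t).swap (rootL (certificate t).cutLow) = rootL (certificate t).cutHigh := by
  cases t <;> decide +kernel

theorem rivals_spec (t : BoundaryType) :
    ∀ r ∈ (certificate t).rivals, wordLengths r.2 (cuspL r.1) = true := by
  cases t <;> decide +kernel

end ChamberIsometries

/-! ### Reduction of isotropic vectors to the six cusps -/

section ClosestCusp

/-- The primitive isotropic vectors in the forward cone that are equivalent to `v`. -/
def forwardOrbit (v : Lambda1) : Set Lambda1 :=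
  {y | IsForward y ∧ ∃ g : form1.IsometryEquiv form1, g v = y}

variable {v : Lambda1}

theorem isPrimitiveVector_of_mem_forwardOrbit (hv : IsPrimitiveVector v) {y : Lambda1}
    (hy : y ∈ forwardOrbit v) : IsPrimitiveVector y := by
  obtain ⟨-, g, rfl⟩ := hy
  exact hv.map g.toLinearEquiv

theorem form1_of_mem_forwardOrbit (hv : form1 v v = 0) {y : Lambda1}
    (hy : y ∈ forwardOrbit v) : form1 y y = 0 := by
  obtain ⟨-, g, rfl⟩ := hy
  rw [g.map_app, hv]

theorem exists_mem_forwardOrbit (hv : form1 v v = 0) : ∃ y, y ∈ forwardOrbit v := by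
  rcases isForward_or_neg hv with h | h
  · exact ⟨v, h, LinearMap.BilinForm.IsometryEquiv.refl form1, rfl⟩
  · exact ⟨-v, h, negEquiv form1, rfl⟩

theorem map_mem_forwardOrbit {y : Lambda1} (hy : y ∈ forwardOrbit v)
    (g : form1.IsometryEquiv form1) (hg : IsForward (g y)) : g y ∈ forwardOrbit v := by
  obtain ⟨-, h, rfl⟩ := hy
  exact ⟨hg, h.trans g, rfl⟩

theorem form1_weylVector_pos (hv : IsPrimitiveVector v) (hv0 : form1 v v = 0) {y : Lambda1}
    (hy : y ∈ forwardOrbit v) : 0 < form1 y weylVector := by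
  have h := form1_neg_of_isForward (form1_of_mem_forwardOrbit hv0 hy)
    (isPrimitiveVector_of_mem_forwardOrbit hv hy).ne_zero (y := -weylVector)
    (by
      have := weylL_spec.2.1
      rw [← form1_ofList weylL_spec.1 weylL_spec.1] at this
      simpa [weylVector] using this) hy.1 isForward_neg_weylVector
  rw [map_neg] at h
  linarith

theorem form1_cusp_nonneg (hv0 : form1 v v = 0) {y : Lambda1}
    (hy : y ∈ forwardOrbit v) (t : BoundaryType) : 0 ≤ form1 y (cusp t) := by
  have h := form1_nonpos_of_isForward (form1_of_mem_forwardOrbit hv0 hy).le (y := -cusp t)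
    (by simp [form1_cusp]) hy.1 (isForward_neg_cusp t)
  rw [map_neg] at h
  linarith

theorem symm_wordEquiv_weylVector (w : List (Fin 3)) :
    (wordEquiv w).symm weylVector = weylVector := by
  conv_lhs => rw [← wordEquiv_weylVector w]
  exact (wordEquiv w).toLinearEquiv.symm_apply_apply weylVector

/-- `weylVector` has negative norm, so an isometry that fixes it cannot exchange the two halves of
the light cone. -/
theorem mem_forwardOrbit_of_fix (hv : IsPrimitiveVector v) (hv0 : form1 v v = 0) {y : Lambda1}
    (hy : y ∈ forwardOrbit v) (g : form1.IsometryEquiv form1) (hg : g weylVector = weylVector) :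
    g y ∈ forwardOrbit v := by
  refine map_mem_forwardOrbit hy g (isForward_of_form1_neg (x := -weylVector) ?_ ?_
    isForward_neg_weylVector ?_)
  · have := weylL_spec.2.1
    rw [← form1_ofList weylL_spec.1 weylL_spec.1] at this
    simpa [weylVector] using this.le
  · rw [g.map_app, form1_of_mem_forwardOrbit hv0 hy]
  · conv_lhs => rw [← hg]
    rw [← map_neg, g.map_app]
    rw [map_neg, LinearMap.neg_apply, form1_comm]
    have := form1_weylVector_pos hv hv0 hy
    linarith

/-- If `y` had a negative product with a simple root, reflecting it would not increase the product
with the cusp and would strictly decrease the product with `weylVector`, against the two minimality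
assumptions. -/
theorem form1_simpleRoot_nonneg (hv0 : form1 v v = 0)
    {t : BoundaryType} {y : Lambda1} (hy : y ∈ forwardOrbit v)
    (h1 : ∀ z ∈ forwardOrbit v, form1 y (cusp t) ≤ form1 z (cusp t))
    (h2 : ∀ z ∈ forwardOrbit v, form1 z (cusp t) = form1 y (cusp t) →
      form1 y weylVector ≤ form1 z weylVector) {i : ℕ} (hi : i < 36) :
    0 ≤ form1 y (simpleRoot i) := by
  by_contra hneg
  push Not at hneg
  have hk : 0 < rootDiv i := by
    unfold rootDiv
    split_ifs <;> norm_num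
  have hc : coroot i y < 0 := by
    rw [← rootDiv_mul_coroot hi] at hneg
    by_contra h
    push Not at h
    have := mul_nonneg hk.le h
    linarith
  set g := reflectionEquiv form1 form1_comm (simpleRoot i) (coroot i) (rootDiv i)
    (rootDiv_ne_zero i) (rootDiv_mul_coroot hi) (form1_simpleRoot hi)
  have hgy : g y = y - coroot i y • simpleRoot i := reflectionEquiv_apply ..
  have hyy := form1_of_mem_forwardOrbit hv0 hy
  have hz : g y ∈ forwardOrbit v := by
    refine map_mem_forwardOrbit hy g (isForward_of_form1_neg hyy.le ?_ hy.1 ?_)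
    · rw [g.map_app, hyy]
    -- The product of `y` with its mirror image is `-(coroot i y) * form1 y (simpleRoot i)`,
    -- negative because both factors `coroot i y` and `form1 y (simpleRoot i)` are; so the image
    -- stays in the forward cone.
    · rw [hgy, map_sub, map_smul, smul_eq_mul, hyy]
      have := mul_pos_of_neg_of_neg hc hneg
      linarith
  have e : ∀ z, form1 (g y) z = form1 y z - coroot i y * form1 (simpleRoot i) z := by
    intro z
    rw [hgy, map_sub, map_smul, LinearMap.sub_apply, LinearMap.smul_apply, smul_eq_mul]
  have hcu : form1 (simpleRoot i) (cusp t) ≤ 0 := by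
    rw [simpleRoot, cusp, form1_ofList (length_rootL i hi) (length_cuspL t)]
    exact (cuspPartnerL_spec t).2.2.2 i hi
  have hwe : form1 (simpleRoot i) weylVector < 0 := by
    rw [simpleRoot, weylVector, form1_ofList (length_rootL i hi) weylL_spec.1]
    exact weylL_spec.2.2.1 i hi
  have a1 := h1 _ hz
  have a2 := mul_nonneg_of_nonpos_of_nonpos hc.le hcu
  have a3 := h2 _ hz (by
    rw [e] at a1 ⊢
    linarith)
  rw [e] at a3
  have := mul_pos_of_neg_of_neg hc hwe
  linarith

theorem cuspWeight_pos (t : BoundaryType) : 0 < cuspWeight t := by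
  cases t <;> decide

/-- Three sources of inequalities: reflections for the simple roots, minimality over all cusps for
the rivals, and `h3` for the cut. -/
theorem form1_walls_nonneg (hv : IsPrimitiveVector v) (hv0 : form1 v v = 0)
    {t : BoundaryType} {y : Lambda1} (hy : y ∈ forwardOrbit v)
    (h1 : ∀ s, ∀ z ∈ forwardOrbit v,
      cuspWeight t * form1 y (cusp t) ≤ cuspWeight s * form1 z (cusp s))
    (h2 : ∀ z ∈ forwardOrbit v, form1 z (cusp t) = form1 y (cusp t) →
      form1 y weylVector ≤ form1 z weylVector)
    (h3 : form1 y (simpleRoot (certificate t).cutLow) ≤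
      form1 y (simpleRoot (certificate t).cutHigh)) {w : List ℤ} (hw : w ∈ wallsL t) :
    0 ≤ form1 y (ofList w) := by
  rcases List.mem_append.1 hw with hw | hw
  · obtain ⟨i, hi, rfl⟩ := List.getElem_of_mem hw
    have := form1_simpleRoot_nonneg hv0 hy
      (fun z hz => le_of_mul_le_mul_left (h1 t z hz) (cuspWeight_pos t)) h2 (i := i) hi
    rwa [simpleRoot, rootL, List.getD_eq_getElem _ _ hi] at this
  rcases List.mem_append.1 hw with hw | hw
  · obtain ⟨r, hr, rfl⟩ := List.mem_map.1 hw
    have e := (wordEquiv_ofList (rivals_spec t r hr)).2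
    -- The product of `y` with the image of a cusp under a word is the product of the inverse image
    -- of `y` with the cusp itself, and that inverse image competes in the minimum `h1`.
    have hz := mem_forwardOrbit_of_fix hv hv0 hy (wordEquiv r.2).symm
      (symm_wordEquiv_weylVector r.2)
    have := h1 r.1 _ hz
    have e2 : form1 ((wordEquiv r.2).symm y) (cusp r.1) =
        form1 y (wordEquiv r.2 (cusp r.1)) := by
      rw [← (wordEquiv r.2).map_app]
      congr 1
      exact congrArg form1 ((wordEquiv r.2).toLinearEquiv.apply_symm_apply y)
    rw [e2, show wordEquiv r.2 (cusp r.1) = _ from e] at this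
    rw [rivalL, ofList_addL, ofList_smulL, ofList_smulL, map_add, map_smul, map_smul, smul_eq_mul,
      smul_eq_mul]
    change cuspWeight t * form1 y (ofList (cuspL t)) ≤ _ at this
    linarith
  · rw [List.mem_singleton.1 hw, ofList_addL, ofList_smulL, map_add, map_smul]
    simp only [simpleRoot] at h3
    simp only [smul_eq_mul]
    linarith

/-- Every primitive isotropic vector of `Λ₁` is equivalent to one of the six cusps. -/
theorem exists_isometry_cusp (hv : IsPrimitiveVector v) (hv0 : form1 v v = 0) :
    ∃ (t : BoundaryType) (g : form1.IsometryEquiv form1), g v = cusp t := by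
  -- Orthogonal primitive isotropic vectors agree up to sign, and `-1` is an isometry.
  suffices h : ∃ t, ∃ y ∈ forwardOrbit v, form1 y (cusp t) = 0 by
    obtain ⟨t, y, hy, h⟩ := h
    obtain ⟨-, g, hg⟩ := id hy
    refine ⟨t, ?_⟩
    rcases eq_or_eq_neg_of_form1_eq_zero (isPrimitiveVector_of_mem_forwardOrbit hv hy)
      (isPrimitiveVector_cusp t) (form1_of_mem_forwardOrbit hv0 hy) (form1_cusp t) h with h | h
    · exact ⟨g, hg.trans h⟩
    · refine ⟨g.trans (negEquiv form1), ?_⟩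
      change negEquiv form1 (g v) = _
      rw [hg, h, negEquiv_apply, neg_neg]
  obtain ⟨y₀, hy₀⟩ := exists_mem_forwardOrbit hv0
  -- The weighted minimum is taken over the cusp and the orbit representative together, so that it
  -- also yields the comparisons with rival cusps.
  obtain ⟨⟨t, y₁⟩, hy₁, hmin₁⟩ := exists_min_of_nonneg
    (s := {p : BoundaryType × Lambda1 | p.2 ∈ forwardOrbit v}) ⟨(.D16, y₀), hy₀⟩
    (fun p => cuspWeight p.1 * form1 p.2 (cusp p.1))
    (fun p hp => mul_nonneg (cuspWeight_pos _).le (form1_cusp_nonneg hv0 hp p.1))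
  -- The representatives attaining the first minimum are still moved by reflections that fix the
  -- cusp; minimizing the product with `weylVector` settles this choice.
  obtain ⟨y, ⟨hy, hyt⟩, hmin₂⟩ := exists_min_of_nonneg
    (s := {y | y ∈ forwardOrbit v ∧ form1 y (cusp t) = form1 y₁ (cusp t)}) ⟨y₁, hy₁, rfl⟩
    (fun y => form1 y weylVector)
    (fun y hy => (form1_weylVector_pos hv hv0 hy.1).le)
  have key : ∀ z ∈ forwardOrbit v, form1 z (cusp t) = form1 y₁ (cusp t) →
      form1 z weylVector = form1 y weylVector →
      form1 z (simpleRoot (certificate t).cutLow) ≤ form1 z (simpleRoot (certificate t).cutHigh) →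
      ∃ t, ∃ y ∈ forwardOrbit v, form1 y (cusp t) = 0 := by
    intro z hz e1 e2 h3
    refine ⟨t, z, hz, form1_cuspL_eq_zero t (form1_of_mem_forwardOrbit hv0 hz) fun w hw =>
      form1_walls_nonneg hv hv0 hz ?_ ?_ h3 hw⟩
    · intro s u hu
      rw [e1]
      exact hmin₁ (s, u) hu
    · intro u hu hut
      rw [e2]
      exact hmin₂ u ⟨hu, hut.trans e1⟩
  rcases le_total (form1 y (simpleRoot (certificate t).cutLow))
    (form1 y (simpleRoot (certificate t).cutHigh)) with h3 | h3
  · exact key y hy hyt rfl h3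
  -- The cut inequality fails for `y`, so it holds for the image of `y` under the swap. Both minimal
  -- values are unchanged, since the swap fixes the cusp and `weylVector`.
  · obtain ⟨ha, hb, hc1, hc2, hh1, hh2, hl1, hl2⟩ := swap_spec t
    set g := wordEquiv (certificate t).swap
    have gw : g weylVector = weylVector := wordEquiv_weylVector _
    have gc : g (cusp t) = cusp t := by
      rw [cusp, (wordEquiv_ofList hc1).2, hc2]
    have gh : g (simpleRoot (certificate t).cutHigh) = simpleRoot (certificate t).cutLow := by
      rw [simpleRoot, (wordEquiv_ofList hh1).2, hh2, simpleRoot]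
    have gl : g (simpleRoot (certificate t).cutLow) = simpleRoot (certificate t).cutHigh := by
      rw [simpleRoot, (wordEquiv_ofList hl1).2, hl2, simpleRoot]
    refine key (g y) (mem_forwardOrbit_of_fix hv hv0 hy g gw) ?_ ?_ ?_
    · conv_lhs => rw [← gc]
      rw [g.map_app, hyt]
    · conv_lhs => rw [← gw]
      rw [g.map_app]
    · conv_lhs => rw [← gh]
      conv_rhs => rw [← gl]
      rw [g.map_app, g.map_app]
      exact h3

end ClosestCusp

/-! ### Lattices inside their rational spans -/

section RationalLattice

variable {M : Type*} [AddCommGroup M] (B : LinearMap.BilinForm ℤ M)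

theorem rationalForm_toRational (x y : M) :
    rationalForm B (toRational x) (toRational y) = B x y := by
  simp [rationalForm, toRational]

theorem toRational_add (x y : M) : toRational (x + y) = toRational x + toRational y :=
  TensorProduct.tmul_add _ _ _

theorem toRational_sub (x y : M) : toRational (x - y) = toRational x - toRational y :=
  TensorProduct.tmul_sub _ _ _

theorem toRational_smul (n : ℤ) (x : M) : toRational (n • x) = (n : ℚ) • toRational x := by
  rw [toRational, toRational, ← TensorProduct.smul_tmul, TensorProduct.smul_tmul']
  simp

theorem toRational_zero : toRational (0 : M) = 0 := TensorProduct.tmul_zero _ _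

theorem toRational_sum {ι : Type*} (s : Finset ι) (f : ι → M) :
    toRational (∑ i ∈ s, f i) = ∑ i ∈ s, toRational (f i) := TensorProduct.tmul_sum _ _ _

theorem exists_smul_eq_toRational (x : ℚ ⊗[ℤ] M) :
    ∃ (d : ℤ) (m : M), d ≠ 0 ∧ (d : ℚ) • x = toRational m := by
  induction x with
  | zero => exact ⟨1, 0, one_ne_zero, by simp⟩
  | tmul q m =>
    refine ⟨q.den, q.num • m, by exact_mod_cast q.den_nz, ?_⟩
    rw [toRational_smul, toRational, TensorProduct.smul_tmul', TensorProduct.smul_tmul']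
    congr 1
    simp only [smul_eq_mul, mul_one, Int.cast_natCast]
    exact Rat.den_mul_eq_num q
  | add x y hx hy =>
    obtain ⟨d, m, hd, h⟩ := hx
    obtain ⟨e, n, he, h'⟩ := hy
    refine ⟨d * e, e • m + d • n, mul_ne_zero hd he, ?_⟩
    rw [toRational_add, toRational_smul, toRational_smul, ← h, ← h']
    push_cast
    module

variable {B}

theorem rationalForm_comm (hB : ∀ x y, B x y = B y x) (x y : ℚ ⊗[ℤ] M) :
    rationalForm B x y = rationalForm B y x := by
  induction x with
  | zero => simp
  | tmul q m =>
    induction y with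
    | zero => simp
    | tmul q' m' =>
      rw [rationalForm, LinearMap.BilinForm.baseChange_tmul, LinearMap.BilinForm.baseChange_tmul,
        hB, mul_comm]
    | add y y' h h' => rw [map_add, map_add, LinearMap.add_apply, h, h']
  | add x x' h h' => rw [map_add, map_add, LinearMap.add_apply, h, h']

theorem mem_dualLattice_toRational (m : M) : toRational m ∈ dualLattice B :=
  fun n => ⟨B m n, rationalForm_toRational B m n⟩

theorem mem_dualLattice_of_mem_roots {x : ℚ ⊗[ℤ] M} (hx : x ∈ roots B) : x ∈ dualLattice B := by
  rcases hx with ⟨m, rfl, -⟩ | hx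
  · exact mem_dualLattice_toRational m
  · exact hx.1

theorem norm_of_mem_roots {x : ℚ ⊗[ℤ] M} (hx : x ∈ roots B) :
    rationalForm B x x = 2 ∨ rationalForm B x x = 2 / 3 := by
  rcases hx with ⟨m, rfl, h⟩ | hx
  · left
    rw [rationalForm_toRational, h]
    norm_num
  · exact Or.inr hx.2

end RationalLattice

/-! ### Abstract root data and root bases -/

section RootData

/-- The combinatorial data of a root basis: its Cartan matrix, half the square norms of the
members of the basis after multiplication by `3` of the short ones, and the inverse of the Gram
matrix up to a denominator. -/
structure RootDatum (n : ℕ) where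
  /-- The Cartan matrix. -/
  cartan : Fin n → Fin n → ℤ
  /-- `1` for long roots, `3` for short roots. -/
  div : Fin n → ℤ
  /-- A multiple of the inverse of the Gram matrix. -/
  inv : Fin n → Fin n → ℤ
  /-- The factor in the definition of `inv`. -/
  den : ℤ

/-- The weights (the lists of products with the simple coroots) of the roots in the Weyl group
orbits of the simple roots. -/
inductive RootDatum.IsRootWeight {n : ℕ} (D : RootDatum n) : (Fin n → ℤ) → Prop
  | simple (i : Fin n) : D.IsRootWeight (D.cartan i)
  | reflect (i : Fin n) (p : Fin n → ℤ) : D.IsRootWeight p →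
      D.IsRootWeight (fun j => p j - p i * D.cartan i j)

/-- The properties of the combinatorial data that are needed for the determination of the
root system from its root basis. -/
structure RootDatum.IsValid {n : ℕ} (D : RootDatum n) : Prop where
  div_eq : ∀ i, D.div i = 1 ∨ D.div i = 3
  cartan_self : ∀ i, D.cartan i i = 2
  symm : ∀ i j, D.div i * D.cartan i j = D.div j * D.cartan j i
  nonpos : ∀ i j, i ≠ j → D.cartan i j ≤ 0
  den_pos : 0 < D.den
  inv_pos : ∀ j, 0 < ∑ i, D.inv i j
  inv_mul : ∀ i j, ∑ l, D.inv i l * (D.div l * D.cartan l j) = if i = j then D.den else 0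
  dominant : ∀ p : Fin n → ℤ, (∀ i, 0 ≤ p i) →
    (∑ i, ∑ j, p i * D.inv i j * p j = 2 * D.den ∨
      3 * ∑ i, ∑ j, p i * D.inv i j * p j = 2 * D.den) → D.IsRootWeight p

/-- A family of vectors, proportional to a root basis of the orthogonal complement of `δ`. -/
structure IsRootBasis {M : Type*} [AddCommGroup M] (B : LinearMap.BilinForm ℤ M) (δ : M) {n : ℕ}
    (D : RootDatum n) (β : Fin n → M) : Prop where
  gram : ∀ i j, B (β i) (β j) = D.div i * D.cartan i j
  dvd : ∀ i x, D.div i ∣ B x (β i)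
  perp : ∀ i, B (β i) δ = 0
  isotropic : B δ δ = 0
  unimodular : δ = 0 ∨ ∃ z, B δ z = 1
  span : ∀ x, B x δ = 0 → ∃ d : ℤ, d ≠ 0 ∧ ∃ (a : Fin n → ℤ) (c : ℤ),
    d • x = ∑ i, a i • β i + c • δ

/-- The column sums of `inv` form a positive vector that the Gram matrix maps to the constant vector
`den`, which is what `sum_mul_mul_pos` needs. -/
theorem RootDatum.IsValid.gram_pos {n : ℕ} {D : RootDatum n} (hD : D.IsValid) {a : Fin n → ℚ}
    (ha : a ≠ 0) : 0 < ∑ i, ∑ j, a i * ((D.div i * D.cartan i j : ℤ) : ℚ) * a j := by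
  refine sum_mul_mul_pos (G := fun i j => ((D.div i * D.cartan i j : ℤ) : ℚ))
    (fun i j => by exact_mod_cast hD.symm i j) (fun i j hij => ?_)
    (fun j => ((∑ i, D.inv i j : ℤ) : ℚ)) (fun j => by exact_mod_cast hD.inv_pos j)
    (fun i => ?_) ha
  · have h1 := hD.nonpos i j hij
    have : D.div i * D.cartan i j ≤ 0 := by
      rcases hD.div_eq i with h | h <;> rw [h] <;> linarith
    exact_mod_cast this
  · have h : ∑ j, (D.div i * D.cartan i j) * ∑ l, D.inv l j = D.den := by
      calc ∑ j, (D.div i * D.cartan i j) * ∑ l, D.inv l j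
          = ∑ j, ∑ l, D.inv l j * (D.div j * D.cartan j i) := by
            refine Finset.sum_congr rfl fun j _ => ?_
            rw [Finset.mul_sum]
            refine Finset.sum_congr rfl fun l _ => ?_
            rw [hD.symm i j]
            ring
        _ = ∑ l, ∑ j, D.inv l j * (D.div j * D.cartan j i) := Finset.sum_comm
        _ = D.den := by simp [hD.inv_mul]
    have h2 := hD.den_pos
    rw [← h] at h2
    exact_mod_cast h2

end RootData

/-! ### The roots generated by a root basis -/

section RootSystemOfBasis

variable {M : Type*} [AddCommGroup M] {B : LinearMap.BilinForm ℤ M} {δ : M} {n : ℕ}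
  {D : RootDatum n} {β : Fin n → M}

/-- The root basis that is given by a family of vectors of the lattice. -/
noncomputable def rootBasis (D : RootDatum n) (β : Fin n → M) (i : Fin n) : ℚ ⊗[ℤ] M :=
  (D.div i : ℚ)⁻¹ • toRational (β i)

theorem RootDatum.IsValid.div_ne_zero (hD : D.IsValid) (i : Fin n) : (D.div i : ℚ) ≠ 0 := by
  rcases hD.div_eq i with h | h <;> rw [h] <;> norm_num

theorem rationalForm_rootBasis_toRational (hD : D.IsValid) (hβ : IsRootBasis B δ D β)
    (i j : Fin n) :
    rationalForm B (rootBasis D β i) (toRational (β j)) = D.cartan i j := by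
  rw [rootBasis, map_smul, LinearMap.smul_apply, rationalForm_toRational, hβ.gram, smul_eq_mul]
  have := hD.div_ne_zero i
  push_cast
  field_simp

theorem rationalForm_rootBasis (hD : D.IsValid) (hβ : IsRootBasis B δ D β) (i j : Fin n) :
    rationalForm B (rootBasis D β i) (rootBasis D β j) = (D.cartan i j : ℚ) / D.div j := by
  conv_lhs => rw [rootBasis.eq_1 D β j]
  rw [map_smul, rationalForm_rootBasis_toRational hD hβ, smul_eq_mul, inv_mul_eq_div]

/-- `rootBasis D β i` has norm `2 / div i`, so `β i` is its coroot. The products with the `β i` are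
therefore the weights, and the reflection is integral in them. -/
theorem reflect_rootBasis (hD : D.IsValid) (hβ : IsRootBasis B δ D β) (i : Fin n)
    (x : ℚ ⊗[ℤ] M) :
    x - (2 * rationalForm B x (rootBasis D β i) /
        rationalForm B (rootBasis D β i) (rootBasis D β i)) • rootBasis D β i =
      x - rationalForm B x (toRational (β i)) • rootBasis D β i := by
  rw [rationalForm_rootBasis hD hβ, hD.cartan_self]
  conv_lhs => rw [rootBasis.eq_1 D β i]
  rw [map_smul, smul_eq_mul, rootBasis]
  have := hD.div_ne_zero i
  congr 2
  push_cast
  field_simp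

theorem exists_int_rationalForm {x : ℚ ⊗[ℤ] M} (hx : x ∈ rootsPerp B δ) (m : M) :
    ∃ p : ℤ, rationalForm B x (toRational m) = p :=
  mem_dualLattice_of_mem_roots hx.1 m

theorem rationalForm_rootBasis_delta (hβ : IsRootBasis B δ D β) (i : Fin n) :
    rationalForm B (rootBasis D β i) (toRational δ) = 0 := by
  rw [rootBasis, map_smul, LinearMap.smul_apply, rationalForm_toRational, hβ.perp]
  simp

/-- Divisibility of the products with `β i` by `div i` is what makes the reflection preserve the
lattice and its dual. -/
theorem reflect_mem_rootsPerp (hB : ∀ x y, B x y = B y x) (hD : D.IsValid)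
    (hβ : IsRootBasis B δ D β) (i : Fin n) {x : ℚ ⊗[ℤ] M} (hx : x ∈ rootsPerp B δ) :
    x - rationalForm B x (toRational (β i)) • rootBasis D β i ∈ rootsPerp B δ := by
  have hk := hD.div_ne_zero i
  have hnorm : rationalForm B (x - rationalForm B x (toRational (β i)) • rootBasis D β i)
      (x - rationalForm B x (toRational (β i)) • rootBasis D β i) = rationalForm B x x := by
    have e : rationalForm B x (rootBasis D β i) =
        (D.div i : ℚ)⁻¹ * rationalForm B x (toRational (β i)) := by
      rw [rootBasis, map_smul, smul_eq_mul]
    simp only [map_sub, LinearMap.sub_apply, map_smul, LinearMap.smul_apply, smul_eq_mul,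
      rationalForm_rootBasis hD hβ, hD.cartan_self, rationalForm_comm hB (rootBasis D β i) x, e]
    push_cast
    field_simp
    ring
  refine ⟨?_, ?_⟩
  · rcases hx.1 with ⟨m, rfl, hm⟩ | hs
    · left
      obtain ⟨c, hc⟩ := hβ.dvd i m
      have e : toRational m - rationalForm B (toRational m) (toRational (β i)) • rootBasis D β i =
          toRational (m - c • β i) := by
        rw [toRational_sub, toRational_smul, rationalForm_toRational, hc, rootBasis, smul_smul]
        congr 2
        push_cast
        field_simp
      rw [e] at hnorm ⊢
      refine ⟨_, rfl, ?_⟩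
      rw [rationalForm_toRational, rationalForm_toRational, hm] at hnorm
      exact_mod_cast hnorm
    · right
      refine ⟨fun m => ?_, hnorm.trans hs.2⟩
      obtain ⟨c, hc⟩ := hβ.dvd i m
      obtain ⟨p, hp⟩ := hs.1 m
      obtain ⟨q, hq⟩ := hs.1 (β i)
      refine ⟨p - q * c, ?_⟩
      rw [map_sub, LinearMap.sub_apply, map_smul, LinearMap.smul_apply, hp, hq, rootBasis, map_smul,
        LinearMap.smul_apply, rationalForm_toRational, hB, hc, smul_eq_mul, smul_eq_mul]
      push_cast
      field_simp
  · rw [map_sub, LinearMap.sub_apply, map_smul, LinearMap.smul_apply,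
      rationalForm_rootBasis_delta hβ, hx.2]
    simp

theorem rootBasis_mem_rootsPerp (hB : ∀ x y, B x y = B y x) (hD : D.IsValid)
    (hβ : IsRootBasis B δ D β) (i : Fin n) : rootBasis D β i ∈ rootsPerp B δ := by
  refine ⟨?_, rationalForm_rootBasis_delta hβ i⟩
  have hn := rationalForm_rootBasis hD hβ i i
  rw [hD.cartan_self] at hn
  rcases hD.div_eq i with h | h
  · left
    refine ⟨β i, by simp [rootBasis, h], ?_⟩
    rw [hβ.gram, h, hD.cartan_self]
    norm_num
  · right
    refine ⟨fun m => ?_, by rw [hn, h]; norm_num⟩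
    obtain ⟨c, hc⟩ := hβ.dvd i m
    refine ⟨c, ?_⟩
    have := hD.div_ne_zero i
    rw [rootBasis, map_smul, LinearMap.smul_apply, rationalForm_toRational, hB, hc, smul_eq_mul]
    push_cast
    field_simp

theorem add_smul_mem_rootsPerp (hB : ∀ x y, B x y = B y x) (hβ : IsRootBasis B δ D β) (k : ℤ)
    {x : ℚ ⊗[ℤ] M} (hx : x ∈ rootsPerp B δ) : x + k • toRational δ ∈ rootsPerp B δ := by
  have hδ : rationalForm B (toRational δ) (toRational δ) = 0 := by
    rw [rationalForm_toRational, hβ.isotropic, Int.cast_zero]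
  have hx' : rationalForm B (toRational δ) x = 0 := by rw [rationalForm_comm hB, hx.2]
  rw [← Int.cast_smul_eq_zsmul ℚ k]
  have hnorm : rationalForm B (x + (k : ℚ) • toRational δ) (x + (k : ℚ) • toRational δ) =
      rationalForm B x x := by
    simp only [map_add, LinearMap.add_apply, map_smul, LinearMap.smul_apply, hδ, hx', hx.2]
    simp
  refine ⟨?_, ?_⟩
  · rcases hx.1 with ⟨m, rfl, hm⟩ | hs
    · left
      rw [← toRational_smul, ← toRational_add] at hnorm ⊢
      refine ⟨_, rfl, ?_⟩
      rw [rationalForm_toRational, rationalForm_toRational, hm] at hnorm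
      exact_mod_cast hnorm
    · right
      refine ⟨fun m => ?_, hnorm.trans hs.2⟩
      obtain ⟨p, hp⟩ := hs.1 m
      refine ⟨p + k * B δ m, ?_⟩
      rw [map_add, LinearMap.add_apply, map_smul, LinearMap.smul_apply, hp,
        rationalForm_toRational, smul_eq_mul]
      push_cast
      rfl
  · rw [map_add, LinearMap.add_apply, map_smul, LinearMap.smul_apply, hx.2, hδ]
    simp

theorem exists_eq_sum_of_perp (hβ : IsRootBasis B δ D β) {x : ℚ ⊗[ℤ] M}
    (hx : rationalForm B x (toRational δ) = 0) : ∃ (a : Fin n → ℚ) (c : ℚ),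
      x = ∑ i, a i • toRational (β i) + c • toRational δ := by
  obtain ⟨d, m, hd, h⟩ := exists_smul_eq_toRational x
  have hm : B m δ = 0 := by
    have h1 : rationalForm B (toRational m) (toRational δ) = 0 := by
      rw [← h, map_smul, LinearMap.smul_apply, hx, smul_zero]
    rw [rationalForm_toRational] at h1
    exact_mod_cast h1
  obtain ⟨e, he, a, c, hs⟩ := hβ.span m hm
  have hde : (e : ℚ) * d ≠ 0 := mul_ne_zero (by exact_mod_cast he) (by exact_mod_cast hd)
  refine ⟨fun i => ((e : ℚ) * d)⁻¹ * a i, ((e : ℚ) * d)⁻¹ * c, ?_⟩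
  have h2 : ((e : ℚ) * d) • x = ∑ i, (a i : ℚ) • toRational (β i) + (c : ℚ) • toRational δ := by
    rw [mul_smul, h, ← toRational_smul, hs, toRational_add, toRational_smul, toRational_sum]
    simp only [toRational_smul]
  rw [← inv_smul_smul₀ hde x, h2, smul_add, smul_smul, Finset.smul_sum]
  simp only [smul_smul]

/-- The coordinates of a vector of `δ^⊥` in the basis are recovered from its weights; only the
coefficient of `δ` is lost. -/
theorem sum_inv_mul (hB : ∀ x y, B x y = B y x) (hD : D.IsValid) (hβ : IsRootBasis B δ D β)
    {x : ℚ ⊗[ℤ] M} {a : Fin n → ℚ} {c : ℚ}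
    (hx : x = ∑ i, a i • toRational (β i) + c • toRational δ) (i : Fin n) :
    ∑ j, (D.inv i j : ℚ) * rationalForm B x (toRational (β j)) = D.den * a i := by
  have hp : ∀ j, rationalForm B x (toRational (β j)) =
      ∑ l, a l * ((D.div j * D.cartan j l : ℤ) : ℚ) := by
    intro j
    rw [hx, map_add, LinearMap.add_apply, map_smul, LinearMap.smul_apply, rationalForm_toRational,
      hB δ, hβ.perp, map_sum, LinearMap.sum_apply]
    simp only [map_smul, LinearMap.smul_apply, rationalForm_toRational, hβ.gram, smul_eq_mul,
      Int.cast_zero, mul_zero, add_zero, hD.symm j]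
  simp only [hp, Finset.mul_sum]
  rw [Finset.sum_comm]
  have : ∀ l, ∑ j, (D.inv i j : ℚ) * (a l * ((D.div j * D.cartan j l : ℤ) : ℚ)) =
      a l * ((if i = l then D.den else 0 : ℤ) : ℚ) := by
    intro l
    rw [← hD.inv_mul i l, Int.cast_sum, Finset.mul_sum]
    refine Finset.sum_congr rfl fun j _ => ?_
    push_cast
    ring
  simp only [this]
  rw [Finset.sum_eq_single i]
  · simp [mul_comm]
  · intro l _ hl
    simp [hl.symm]
  · simp

theorem rationalForm_self_eq {x : ℚ ⊗[ℤ] M}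
    (hxδ : rationalForm B x (toRational δ) = 0) {a : Fin n → ℚ} {c : ℚ}
    (hx : x = ∑ i, a i • toRational (β i) + c • toRational δ) :
    rationalForm B x x = ∑ i, a i * rationalForm B x (toRational (β i)) := by
  conv_lhs =>
    arg 2
    rw [hx]
  rw [map_add, map_smul, hxδ, map_sum]
  simp

theorem rationalForm_nonneg (hB : ∀ x y, B x y = B y x) (hD : D.IsValid)
    (hβ : IsRootBasis B δ D β) {x : ℚ ⊗[ℤ] M} (hx : rationalForm B x (toRational δ) = 0) :
    0 ≤ rationalForm B x x := by
  obtain ⟨a, c, h⟩ := exists_eq_sum_of_perp hβ hx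
  have hp : ∀ j, rationalForm B x (toRational (β j)) =
      ∑ l, ((D.div j * D.cartan j l : ℤ) : ℚ) * a l := by
    intro j
    rw [h, map_add, LinearMap.add_apply, map_smul, LinearMap.smul_apply, rationalForm_toRational,
      hB δ, hβ.perp, map_sum, LinearMap.sum_apply]
    simp only [map_smul, LinearMap.smul_apply, rationalForm_toRational, hβ.gram, smul_eq_mul,
      Int.cast_zero, mul_zero, add_zero, hD.symm j, mul_comm]
  rw [rationalForm_self_eq hx h]
  rcases eq_or_ne a 0 with h0 | h0
  · simp [h0]
  · have := hD.gram_pos h0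
    simp only [hp, Finset.mul_sum]
    simp only [mul_assoc] at this ⊢
    exact this.le

/-- Equal weights give equal coordinates in the basis, so `x - y` is a rational multiple of `δ`;
integrality of the roots makes the multiple integral. -/
theorem exists_eq_add_smul (hB : ∀ x y, B x y = B y x) (hD : D.IsValid)
    (hβ : IsRootBasis B δ D β) {x y : ℚ ⊗[ℤ] M} (hx : x ∈ rootsPerp B δ) (hy : y ∈ rootsPerp B δ)
    (h : ∀ i, rationalForm B x (toRational (β i)) = rationalForm B y (toRational (β i))) :
    ∃ k : ℤ, x = y + k • toRational δ := by
  obtain ⟨a, c, hxa⟩ := exists_eq_sum_of_perp hβ hx.2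
  obtain ⟨a', c', hya⟩ := exists_eq_sum_of_perp hβ hy.2
  have hden : (D.den : ℚ) ≠ 0 := by exact_mod_cast hD.den_pos.ne'
  have haa : a = a' := by
    funext i
    have h1 := sum_inv_mul hB hD hβ hxa i
    have h2 := sum_inv_mul hB hD hβ hya i
    simp only [h] at h1
    exact mul_left_cancel₀ hden (h1.symm.trans h2)
  have hxy : x = y + (c - c') • toRational δ := by
    rw [hxa, hya, haa]
    module
  -- In the finite case `δ = 0` and nothing is left to prove. Otherwise the multiple is read off
  -- from the integral products of `x` and `y` with a vector `z` such that `B δ z = 1`.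
  rcases hβ.unimodular with h0 | ⟨z, hz⟩
  · refine ⟨0, ?_⟩
    rw [hxy, h0, toRational_zero]
    simp
  · obtain ⟨p, hp⟩ := exists_int_rationalForm hx z
    obtain ⟨q, hq⟩ := exists_int_rationalForm hy z
    refine ⟨p - q, ?_⟩
    have : c - c' = ((p - q : ℤ) : ℚ) := by
      rw [hxy, map_add, LinearMap.add_apply, hq, map_smul, LinearMap.smul_apply,
        rationalForm_toRational, hz] at hp
      push_cast
      simp at hp
      linarith
    rw [← Int.cast_smul_eq_zsmul ℚ, ← this]
    exact hxy

theorem exists_weylOrbit_of_isRootWeight (hD : D.IsValid) (hβ : IsRootBasis B δ D β)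
    {p : Fin n → ℤ} (hp : D.IsRootWeight p) :
    ∃ α, WeylOrbit (rationalForm B) (rootBasis D β) α ∧
      ∀ j, rationalForm B α (toRational (β j)) = p j := by
  induction hp with
  | simple i =>
    exact ⟨_, .simple i, rationalForm_rootBasis_toRational hD hβ i⟩
  | reflect i p _ ih =>
    obtain ⟨α, h, hα⟩ := ih
    refine ⟨_, .reflect i α h, fun j => ?_⟩
    rw [reflect_rootBasis hD hβ, map_sub, LinearMap.sub_apply, map_smul, LinearMap.smul_apply, hα,
      hα, rationalForm_rootBasis_toRational hD hβ]
    push_cast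
    rfl

theorem weylOrbit_subset_rootsPerp (hB : ∀ x y, B x y = B y x) (hD : D.IsValid)
    (hβ : IsRootBasis B δ D β) {x : ℚ ⊗[ℤ] M}
    (hx : WeylOrbit (rationalForm B) (rootBasis D β) x) : x ∈ rootsPerp B δ := by
  induction hx with
  | simple i => exact rootBasis_mem_rootsPerp hB hD hβ i
  | reflect i x _ ih =>
    rw [reflect_rootBasis hD hβ]
    exact reflect_mem_rootsPerp hB hD hβ i ih

/-- The norm of a vector of `δ^⊥` is `1 / den` times the quadratic form `inv` in its weights. Hence
`dominant` applies, and some member of a Weyl orbit has the same weights as `x`. -/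
theorem exists_weylOrbit_of_dominant (hB : ∀ x y, B x y = B y x) (hD : D.IsValid)
    (hβ : IsRootBasis B δ D β) {x : ℚ ⊗[ℤ] M} (hx : x ∈ rootsPerp B δ)
    (h : ∀ i, 0 ≤ rationalForm B x (toRational (β i))) :
    ∃ (α : ℚ ⊗[ℤ] M) (k : ℤ), WeylOrbit (rationalForm B) (rootBasis D β) α ∧
      x = α + k • toRational δ := by
  choose p hp using fun i => exists_int_rationalForm hx (β i)
  obtain ⟨a, c, hxa⟩ := exists_eq_sum_of_perp hβ hx.2
  have hnorm : ((∑ i, ∑ j, p i * D.inv i j * p j : ℤ) : ℚ) = D.den * rationalForm B x x := by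
    rw [rationalForm_self_eq hx.2 hxa, Finset.mul_sum]
    push_cast
    refine Finset.sum_congr rfl fun i _ => ?_
    rw [← mul_assoc, ← sum_inv_mul hB hD hβ hxa i, Finset.sum_mul, hp]
    refine Finset.sum_congr rfl fun j _ => ?_
    rw [hp]
    ring
  have hw : D.IsRootWeight p := by
    refine hD.dominant p (fun i => ?_) ?_
    · have := h i
      rw [hp] at this
      exact_mod_cast this
    · rcases norm_of_mem_roots hx.1 with h2 | h2
      · left
        rw [h2] at hnorm
        have : ((∑ i, ∑ j, p i * D.inv i j * p j : ℤ) : ℚ) = ((2 * D.den : ℤ) : ℚ) := by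
          rw [hnorm]
          push_cast
          ring
        exact_mod_cast this
      · right
        rw [h2] at hnorm
        have : ((3 * ∑ i, ∑ j, p i * D.inv i j * p j : ℤ) : ℚ) = ((2 * D.den : ℤ) : ℚ) := by
          rw [Int.cast_mul, hnorm]
          push_cast
          ring
        exact_mod_cast this
  obtain ⟨α, hα, hαp⟩ := exists_weylOrbit_of_isRootWeight hD hβ hw
  obtain ⟨k, hk⟩ := exists_eq_add_smul hB hD hβ hx (weylOrbit_subset_rootsPerp hB hD hβ hα)
    (fun i => by rw [hp, hαp])
  exact ⟨α, k, hα, hk⟩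

/-- Reflecting a root in a simple root with negative product raises its product with `ρ`, which is
bounded on roots. After finitely many steps the root is dominant, and undoing the reflections
returns to it. -/
theorem exists_weylOrbit_of_mem_rootsPerp (hB : ∀ x y, B x y = B y x) (hD : D.IsValid)
    (hβ : IsRootBasis B δ D β) {x : ℚ ⊗[ℤ] M} (hx : x ∈ rootsPerp B δ) :
    ∃ (α : ℚ ⊗[ℤ] M) (k : ℤ), WeylOrbit (rationalForm B) (rootBasis D β) α ∧
      x = α + k • toRational δ := by
  -- This choice gives `ρ` the product `den / div i` with the `i`-th simple root: a positive
  -- integer, so at least `1`.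
  set m : Fin n → ℤ := fun j => ∑ i, D.inv i j with hm
  set ρ : ℚ ⊗[ℤ] M := ∑ j, (m j : ℚ) • toRational (β j) with hρ
  have hρδ : rationalForm B ρ (toRational δ) = 0 := by
    rw [hρ, map_sum, LinearMap.sum_apply]
    refine Finset.sum_eq_zero fun j _ => ?_
    rw [map_smul, LinearMap.smul_apply, rationalForm_toRational, hβ.perp]
    simp
  have hρb : ∀ i, rationalForm B (rootBasis D β i) ρ = ((∑ j, m j * D.cartan i j : ℤ) : ℚ) := by
    intro i
    rw [hρ, map_sum]
    push_cast
    refine Finset.sum_congr rfl fun j _ => ?_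
    rw [map_smul, rationalForm_rootBasis_toRational hD hβ, smul_eq_mul]
  have hs : ∀ i, 1 ≤ ∑ j, m j * D.cartan i j := by
    intro i
    have h1 : D.div i * ∑ j, m j * D.cartan i j = D.den := by
      rw [Finset.mul_sum]
      calc ∑ j, D.div i * (m j * D.cartan i j)
          = ∑ j, ∑ l, D.inv l j * (D.div j * D.cartan j i) := by
            refine Finset.sum_congr rfl fun j _ => ?_
            rw [← Finset.sum_mul, ← hD.symm i j]
            ring
        _ = ∑ l, ∑ j, D.inv l j * (D.div j * D.cartan j i) := Finset.sum_comm
        _ = D.den := by simp [hD.inv_mul]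
    have h2 := hD.den_pos
    rw [← h1] at h2
    have h3 : 0 ≤ D.div i := by rcases hD.div_eq i with h | h <;> rw [h] <;> norm_num
    exact pos_of_mul_pos_right h2 h3
  set bd : ℚ := (2 + rationalForm B ρ ρ) / 2 with hbd
  -- The bound comes from `0 ≤ (y - ρ)²`, semidefiniteness on `δ^⊥`, and the fact that roots have
  -- norm at most `2`.
  have hle : ∀ y ∈ rootsPerp B δ, rationalForm B y ρ ≤ bd := by
    intro y hy
    have h1 : 0 ≤ rationalForm B (y - ρ) (y - ρ) := by
      apply rationalForm_nonneg hB hD hβ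
      rw [map_sub, LinearMap.sub_apply, hy.2, hρδ, sub_zero]
    simp only [map_sub, LinearMap.sub_apply, rationalForm_comm hB ρ y] at h1
    have h2 : rationalForm B y y ≤ 2 := by
      rcases norm_of_mem_roots hy.1 with h | h <;> rw [h] <;> norm_num
    rw [hbd]
    linarith
  -- Induction on the distance to the bound; each reflection shortens it by at least `1`.
  have key : ∀ (N : ℕ), ∀ y ∈ rootsPerp B δ, bd - rationalForm B y ρ < N →
      ∃ (α : ℚ ⊗[ℤ] M) (k : ℤ), WeylOrbit (rationalForm B) (rootBasis D β) α ∧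
        y = α + k • toRational δ := by
    intro N
    induction N with
    | zero =>
      intro y hy h
      have := hle y hy
      simp at h
      linarith
    | succ N ih =>
      intro y hy h
      by_cases hdom : ∀ i, 0 ≤ rationalForm B y (toRational (β i))
      · exact exists_weylOrbit_of_dominant hB hD hβ hy hdom
      · push Not at hdom
        obtain ⟨i, hi⟩ := hdom
        set z := y - rationalForm B y (toRational (β i)) • rootBasis D β i with hz
        obtain ⟨p, hp⟩ := exists_int_rationalForm hy (β i)
        have hp1 : p ≤ -1 := by
          rw [hp] at hi
          have : p < 0 := by exact_mod_cast hi
          omega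
        have hzρ : rationalForm B y ρ + 1 ≤ rationalForm B z ρ := by
          rw [hz, map_sub, LinearMap.sub_apply, map_smul, LinearMap.smul_apply, hρb, hp,
            smul_eq_mul]
          have h3 : p * ∑ j, m j * D.cartan i j ≤ -1 := by
            have := hs i
            nlinarith
          have h4 : (p : ℚ) * ((∑ j, m j * D.cartan i j : ℤ) : ℚ) ≤ -1 := by
            exact_mod_cast h3
          linarith
        have hzm : z ∈ rootsPerp B δ := reflect_mem_rootsPerp hB hD hβ i hy
        obtain ⟨α, k, hα, hk⟩ := ih z hzm (by push_cast at h; linarith)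
        refine ⟨_, k, .reflect i α hα, ?_⟩
        rw [reflect_rootBasis hD hβ]
        have hαi : rationalForm B α (toRational (β i)) = -p := by
          have e1 : rationalForm B z (toRational (β i)) = -p := by
            rw [hz, map_sub, LinearMap.sub_apply, map_smul, LinearMap.smul_apply,
              rationalForm_rootBasis_toRational hD hβ, hD.cartan_self, hp, smul_eq_mul]
            push_cast
            ring
          rw [hk, map_add, LinearMap.add_apply, ← Int.cast_smul_eq_zsmul ℚ, map_smul,
            LinearMap.smul_apply, rationalForm_toRational, hB δ, hβ.perp] at e1
          simpa using e1
        rw [hαi]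
        have : y = z + (p : ℚ) • rootBasis D β i := by
          rw [hz, hp]
          module
        rw [this, hk]
        module
  obtain ⟨N, hN⟩ := exists_nat_gt (bd - rationalForm B x ρ)
  exact key N x hx hN

/-- The roots perpendicular to `δ` are the translates of the roots in the Weyl group orbits of the
members of a root basis. -/
theorem rootsPerp_eq (hB : ∀ x y, B x y = B y x) (hD : D.IsValid)
    (hβ : IsRootBasis B δ D β) : rootsPerp B δ =
      {x | ∃ (α : ℚ ⊗[ℤ] M) (k : ℤ), WeylOrbit (rationalForm B) (rootBasis D β) α ∧
        x = α + k • toRational δ} := by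
  ext x
  refine ⟨fun hx => exists_weylOrbit_of_mem_rootsPerp hB hD hβ hx, ?_⟩
  rintro ⟨α, k, hα, rfl⟩
  exact add_smul_mem_rootsPerp hB hβ k (weylOrbit_subset_rootsPerp hB hD hβ hα)

end RootSystemOfBasis

/-! ### Explicit root bases orthogonal to the cusps -/

section RootBasisData

/-- The simple roots of the chamber that form a root basis of the orthogonal complement of a
cusp. -/
def nodesL : BoundaryType → List ℕ
  | .twoE8 =>
    [16, 6, 7, 0, 8, 17, 5, 23, 19, 11, 10, 1, 9, 18, 3, 21, 22, 31]
  | .D16 =>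
    [6, 0, 7, 16, 4, 22, 13, 2, 12, 21, 3, 18, 9, 1, 10, 11, 23, 30]
  | .A17 =>
    [0, 6, 15, 3, 21, 12, 2, 14, 23, 5, 20, 11, 1, 10, 19, 4, 16, 28]
  | .E7D10 =>
    [16, 6, 7, 0, 8, 17, 5, 10, 1, 9, 18, 3, 21, 12, 2, 13, 14, 30]
  | .threeE6 =>
    [15, 7, 6, 0, 8, 17, 18, 10, 9, 1, 11, 20, 21, 13, 12, 2, 14, 23]
  | .D7A11 =>
    [6, 0, 7, 16, 4, 19, 22, 1, 9, 18, 3, 21, 12, 2, 14, 23, 5, 20]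

set_option maxHeartbeats 4000000 in
/-- A multiple of the inverse of the Gram matrix of a root basis. -/
def invL : BoundaryType → List (List ℤ)
  | .twoE8 =>
    [[12, 15, 21, 30, 24, 18, 12, 6, 0, 0, 0, 0, 0, 0, 0, 0, 0, 0], [15, 24, 30, 45, 36, 27, 18,
    9, 0, 0, 0, 0, 0, 0, 0, 0, 0, 0], [21, 30, 42, 60, 48, 36, 24, 12, 0, 0, 0, 0, 0, 0, 0, 0, 0,
    0], [30, 45, 60, 90, 72, 54, 36, 18, 0, 0, 0, 0, 0, 0, 0, 0, 0, 0], [24, 36, 48, 72, 60, 45,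
    30, 15, 0, 0, 0, 0, 0, 0, 0, 0, 0, 0], [18, 27, 36, 54, 45, 36, 24, 12, 0, 0, 0, 0, 0, 0, 0,
    0, 0, 0], [12, 18, 24, 36, 30, 24, 18, 9, 0, 0, 0, 0, 0, 0, 0, 0, 0, 0], [6, 9, 12, 18, 15,
    12, 9, 6, 0, 0, 0, 0, 0, 0, 0, 0, 0, 0], [0, 0, 0, 0, 0, 0, 0, 0, 12, 15, 21, 30, 24, 18, 12,
    6, 0, 0], [0, 0, 0, 0, 0, 0, 0, 0, 15, 24, 30, 45, 36, 27, 18, 9, 0, 0], [0, 0, 0, 0, 0, 0, 0,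
    0, 21, 30, 42, 60, 48, 36, 24, 12, 0, 0], [0, 0, 0, 0, 0, 0, 0, 0, 30, 45, 60, 90, 72, 54, 36,
    18, 0, 0], [0, 0, 0, 0, 0, 0, 0, 0, 24, 36, 48, 72, 60, 45, 30, 15, 0, 0], [0, 0, 0, 0, 0, 0,
    0, 0, 18, 27, 36, 54, 45, 36, 24, 12, 0, 0], [0, 0, 0, 0, 0, 0, 0, 0, 12, 18, 24, 36, 30, 24,
    18, 9, 0, 0], [0, 0, 0, 0, 0, 0, 0, 0, 6, 9, 12, 18, 15, 12, 9, 6, 0, 0], [0, 0, 0, 0, 0, 0,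
    0, 0, 0, 0, 0, 0, 0, 0, 0, 0, 6, 3], [0, 0, 0, 0, 0, 0, 0, 0, 0, 0, 0, 0, 0, 0, 0, 0, 3, 2]]
  | .D16 =>
    [[6, 6, 6, 6, 6, 6, 6, 6, 6, 6, 6, 6, 6, 6, 3, 3, 0, 0], [6, 12, 12, 12, 12, 12, 12, 12, 12,
    12, 12, 12, 12, 12, 6, 6, 0, 0], [6, 12, 18, 18, 18, 18, 18, 18, 18, 18, 18, 18, 18, 18, 9, 9,
    0, 0], [6, 12, 18, 24, 24, 24, 24, 24, 24, 24, 24, 24, 24, 24, 12, 12, 0, 0], [6, 12, 18, 24,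
    30, 30, 30, 30, 30, 30, 30, 30, 30, 30, 15, 15, 0, 0], [6, 12, 18, 24, 30, 36, 36, 36, 36, 36,
    36, 36, 36, 36, 18, 18, 0, 0], [6, 12, 18, 24, 30, 36, 42, 42, 42, 42, 42, 42, 42, 42, 21, 21,
    0, 0], [6, 12, 18, 24, 30, 36, 42, 48, 48, 48, 48, 48, 48, 48, 24, 24, 0, 0], [6, 12, 18, 24,
    30, 36, 42, 48, 54, 54, 54, 54, 54, 54, 27, 27, 0, 0], [6, 12, 18, 24, 30, 36, 42, 48, 54, 60,
    60, 60, 60, 60, 30, 30, 0, 0], [6, 12, 18, 24, 30, 36, 42, 48, 54, 60, 66, 66, 66, 66, 33, 33,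
    0, 0], [6, 12, 18, 24, 30, 36, 42, 48, 54, 60, 66, 72, 72, 72, 36, 36, 0, 0], [6, 12, 18, 24,
    30, 36, 42, 48, 54, 60, 66, 72, 78, 78, 39, 39, 0, 0], [6, 12, 18, 24, 30, 36, 42, 48, 54, 60,
    66, 72, 78, 84, 42, 42, 0, 0], [3, 6, 9, 12, 15, 18, 21, 24, 27, 30, 33, 36, 39, 42, 24, 21,
    0, 0], [3, 6, 9, 12, 15, 18, 21, 24, 27, 30, 33, 36, 39, 42, 21, 24, 0, 0], [0, 0, 0, 0, 0, 0,
    0, 0, 0, 0, 0, 0, 0, 0, 0, 0, 12, 6], [0, 0, 0, 0, 0, 0, 0, 0, 0, 0, 0, 0, 0, 0, 0, 0, 6, 4]]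
  | .A17 =>
    [[17, 16, 15, 14, 13, 12, 11, 10, 9, 8, 7, 6, 5, 4, 3, 2, 1, 0], [16, 32, 30, 28, 26, 24, 22,
    20, 18, 16, 14, 12, 10, 8, 6, 4, 2, 0], [15, 30, 45, 42, 39, 36, 33, 30, 27, 24, 21, 18, 15,
    12, 9, 6, 3, 0], [14, 28, 42, 56, 52, 48, 44, 40, 36, 32, 28, 24, 20, 16, 12, 8, 4, 0], [13,
    26, 39, 52, 65, 60, 55, 50, 45, 40, 35, 30, 25, 20, 15, 10, 5, 0], [12, 24, 36, 48, 60, 72,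
    66, 60, 54, 48, 42, 36, 30, 24, 18, 12, 6, 0], [11, 22, 33, 44, 55, 66, 77, 70, 63, 56, 49,
    42, 35, 28, 21, 14, 7, 0], [10, 20, 30, 40, 50, 60, 70, 80, 72, 64, 56, 48, 40, 32, 24, 16, 8,
    0], [9, 18, 27, 36, 45, 54, 63, 72, 81, 72, 63, 54, 45, 36, 27, 18, 9, 0], [8, 16, 24, 32, 40,
    48, 56, 64, 72, 80, 70, 60, 50, 40, 30, 20, 10, 0], [7, 14, 21, 28, 35, 42, 49, 56, 63, 70,
    77, 66, 55, 44, 33, 22, 11, 0], [6, 12, 18, 24, 30, 36, 42, 48, 54, 60, 66, 72, 60, 48, 36,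
    24, 12, 0], [5, 10, 15, 20, 25, 30, 35, 40, 45, 50, 55, 60, 65, 52, 39, 26, 13, 0], [4, 8, 12,
    16, 20, 24, 28, 32, 36, 40, 44, 48, 52, 56, 42, 28, 14, 0], [3, 6, 9, 12, 15, 18, 21, 24, 27,
    30, 33, 36, 39, 42, 45, 30, 15, 0], [2, 4, 6, 8, 10, 12, 14, 16, 18, 20, 22, 24, 26, 28, 30,
    32, 16, 0], [1, 2, 3, 4, 5, 6, 7, 8, 9, 10, 11, 12, 13, 14, 15, 16, 17, 0], [0, 0, 0, 0, 0, 0,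
    0, 0, 0, 0, 0, 0, 0, 0, 0, 0, 0, 3]]
  | .E7D10 =>
    [[12, 12, 18, 24, 18, 12, 6, 0, 0, 0, 0, 0, 0, 0, 0, 0, 0, 0], [12, 21, 24, 36, 27, 18, 9, 0,
    0, 0, 0, 0, 0, 0, 0, 0, 0, 0], [18, 24, 36, 48, 36, 24, 12, 0, 0, 0, 0, 0, 0, 0, 0, 0, 0, 0],
    [24, 36, 48, 72, 54, 36, 18, 0, 0, 0, 0, 0, 0, 0, 0, 0, 0, 0], [18, 27, 36, 54, 45, 30, 15, 0,
    0, 0, 0, 0, 0, 0, 0, 0, 0, 0], [12, 18, 24, 36, 30, 24, 12, 0, 0, 0, 0, 0, 0, 0, 0, 0, 0, 0],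
    [6, 9, 12, 18, 15, 12, 9, 0, 0, 0, 0, 0, 0, 0, 0, 0, 0, 0], [0, 0, 0, 0, 0, 0, 0, 6, 6, 6, 6,
    6, 6, 6, 6, 3, 3, 0], [0, 0, 0, 0, 0, 0, 0, 6, 12, 12, 12, 12, 12, 12, 12, 6, 6, 0], [0, 0, 0,
    0, 0, 0, 0, 6, 12, 18, 18, 18, 18, 18, 18, 9, 9, 0], [0, 0, 0, 0, 0, 0, 0, 6, 12, 18, 24, 24,
    24, 24, 24, 12, 12, 0], [0, 0, 0, 0, 0, 0, 0, 6, 12, 18, 24, 30, 30, 30, 30, 15, 15, 0], [0,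
    0, 0, 0, 0, 0, 0, 6, 12, 18, 24, 30, 36, 36, 36, 18, 18, 0], [0, 0, 0, 0, 0, 0, 0, 6, 12, 18,
    24, 30, 36, 42, 42, 21, 21, 0], [0, 0, 0, 0, 0, 0, 0, 6, 12, 18, 24, 30, 36, 42, 48, 24, 24,
    0], [0, 0, 0, 0, 0, 0, 0, 3, 6, 9, 12, 15, 18, 21, 24, 15, 12, 0], [0, 0, 0, 0, 0, 0, 0, 3, 6,
    9, 12, 15, 18, 21, 24, 12, 15, 0], [0, 0, 0, 0, 0, 0, 0, 0, 0, 0, 0, 0, 0, 0, 0, 0, 0, 1]]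
  | .threeE6 =>
    [[4, 3, 5, 6, 4, 2, 0, 0, 0, 0, 0, 0, 0, 0, 0, 0, 0, 0], [3, 6, 6, 9, 6, 3, 0, 0, 0, 0, 0, 0,
    0, 0, 0, 0, 0, 0], [5, 6, 10, 12, 8, 4, 0, 0, 0, 0, 0, 0, 0, 0, 0, 0, 0, 0], [6, 9, 12, 18,
    12, 6, 0, 0, 0, 0, 0, 0, 0, 0, 0, 0, 0, 0], [4, 6, 8, 12, 10, 5, 0, 0, 0, 0, 0, 0, 0, 0, 0, 0,
    0, 0], [2, 3, 4, 6, 5, 4, 0, 0, 0, 0, 0, 0, 0, 0, 0, 0, 0, 0], [0, 0, 0, 0, 0, 0, 4, 3, 5, 6,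
    4, 2, 0, 0, 0, 0, 0, 0], [0, 0, 0, 0, 0, 0, 3, 6, 6, 9, 6, 3, 0, 0, 0, 0, 0, 0], [0, 0, 0, 0,
    0, 0, 5, 6, 10, 12, 8, 4, 0, 0, 0, 0, 0, 0], [0, 0, 0, 0, 0, 0, 6, 9, 12, 18, 12, 6, 0, 0, 0,
    0, 0, 0], [0, 0, 0, 0, 0, 0, 4, 6, 8, 12, 10, 5, 0, 0, 0, 0, 0, 0], [0, 0, 0, 0, 0, 0, 2, 3,
    4, 6, 5, 4, 0, 0, 0, 0, 0, 0], [0, 0, 0, 0, 0, 0, 0, 0, 0, 0, 0, 0, 4, 3, 5, 6, 4, 2], [0, 0,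
    0, 0, 0, 0, 0, 0, 0, 0, 0, 0, 3, 6, 6, 9, 6, 3], [0, 0, 0, 0, 0, 0, 0, 0, 0, 0, 0, 0, 5, 6,
    10, 12, 8, 4], [0, 0, 0, 0, 0, 0, 0, 0, 0, 0, 0, 0, 6, 9, 12, 18, 12, 6], [0, 0, 0, 0, 0, 0,
    0, 0, 0, 0, 0, 0, 4, 6, 8, 12, 10, 5], [0, 0, 0, 0, 0, 0, 0, 0, 0, 0, 0, 0, 2, 3, 4, 6, 5, 4]]
  | .D7A11 =>
    [[12, 12, 12, 12, 12, 6, 6, 0, 0, 0, 0, 0, 0, 0, 0, 0, 0, 0], [12, 24, 24, 24, 24, 12, 12, 0,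
    0, 0, 0, 0, 0, 0, 0, 0, 0, 0], [12, 24, 36, 36, 36, 18, 18, 0, 0, 0, 0, 0, 0, 0, 0, 0, 0, 0],
    [12, 24, 36, 48, 48, 24, 24, 0, 0, 0, 0, 0, 0, 0, 0, 0, 0, 0], [12, 24, 36, 48, 60, 30, 30, 0,
    0, 0, 0, 0, 0, 0, 0, 0, 0, 0], [6, 12, 18, 24, 30, 21, 15, 0, 0, 0, 0, 0, 0, 0, 0, 0, 0, 0],
    [6, 12, 18, 24, 30, 15, 21, 0, 0, 0, 0, 0, 0, 0, 0, 0, 0, 0], [0, 0, 0, 0, 0, 0, 0, 11, 10, 9,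
    8, 7, 6, 5, 4, 3, 2, 1], [0, 0, 0, 0, 0, 0, 0, 10, 20, 18, 16, 14, 12, 10, 8, 6, 4, 2], [0, 0,
    0, 0, 0, 0, 0, 9, 18, 27, 24, 21, 18, 15, 12, 9, 6, 3], [0, 0, 0, 0, 0, 0, 0, 8, 16, 24, 32,
    28, 24, 20, 16, 12, 8, 4], [0, 0, 0, 0, 0, 0, 0, 7, 14, 21, 28, 35, 30, 25, 20, 15, 10, 5],
    [0, 0, 0, 0, 0, 0, 0, 6, 12, 18, 24, 30, 36, 30, 24, 18, 12, 6], [0, 0, 0, 0, 0, 0, 0, 5, 10,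
    15, 20, 25, 30, 35, 28, 21, 14, 7], [0, 0, 0, 0, 0, 0, 0, 4, 8, 12, 16, 20, 24, 28, 32, 24,
    16, 8], [0, 0, 0, 0, 0, 0, 0, 3, 6, 9, 12, 15, 18, 21, 24, 27, 18, 9], [0, 0, 0, 0, 0, 0, 0,
    2, 4, 6, 8, 10, 12, 14, 16, 18, 20, 10], [0, 0, 0, 0, 0, 0, 0, 1, 2, 3, 4, 5, 6, 7, 8, 9, 10,
    11]]

/-- The factor in the definition of `invL`. -/
def invDen : BoundaryType → ℤ
  | .twoE8 =>
    3
  | .D16 =>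
    6
  | .A17 =>
    18
  | .E7D10 =>
    6
  | .threeE6 =>
    3
  | .D7A11 =>
    12

/-- A further factor that is needed to express vectors by the root basis and a cusp. -/
def spanScale : BoundaryType → ℤ
  | .twoE8 =>
    1
  | .D16 =>
    1
  | .A17 =>
    1
  | .E7D10 =>
    1
  | .threeE6 =>
    1
  | .D7A11 =>
    1

/-- The coefficients of a cusp, if the basis vectors are expressed by the root basis and the
cusp. -/
def spanCoeffL : BoundaryType → List ℤ
  | .twoE8 =>
    [0, 0, 0, 0, 0, 0, 0, 0, 0, 0, 0, 0, 0, 0, 0, 0, 0, 0, 3, 0]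
  | .D16 =>
    [0, 0, 0, 0, 6, 0, 6, 0, 36, 0, 0, 0, 0, 0, 0, 0, 0, 72, 72, -72]
  | .A17 =>
    [0, 0, 18, 0, 0, 18, 0, 0, 0, 0, 0, 0, 24, 6, 0, 0, -6, 120, 144, -144]
  | .E7D10 =>
    [0, 0, 0, 0, 0, 0, 0, 0, -9, 6, 0, 0, 0, 0, 0, 0, -9, 9, 0, 0]
  | .threeE6 =>
    [3, 0, 0, 0, 0, 0, 0, 0, 3, 0, 0, 0, 0, 0, 0, 0, 3, 3, 6, -6]
  | .D7A11 =>
    [0, 0, 0, 0, 12, 0, 0, 0, 0, 12, 6, 0, 0, 0, 0, 0, 0, 42, 60, -60]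

/-- A multiple of a vector that is orthogonal to the root basis. -/
def spanDualL : BoundaryType → List ℤ
  | .twoE8 =>
    [0, 0, 0, 0, 0, 0, 0, 0, 0, 0, 0, 0, 0, 0, 0, 0, 0, 0, 0, 3]
  | .D16 =>
    [0, 0, 0, 0, 0, -6, 0, 0, 0, 0, 0, 0, 0, 0, 0, 0, 0, 0, 0, 0]
  | .A17 =>
    [346, 510, 692, 1020, 838, 648, 432, 216, 340, 510, 680, 1020, 850, 648, 432, 216, 60, 118,
    -216, 216]
  | .E7D10 =>
    [42, 63, 84, 126, 105, 84, 63, 42, 78, 108, 144, 210, 168, 126, 84, 42, 18, 24, -42, 42]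
  | .threeE6 =>
    [36, 51, 69, 102, 84, 66, 48, 24, 36, 51, 69, 102, 84, 66, 48, 24, 9, 15, -24, 24]
  | .D7A11 =>
    [72, 108, 144, 216, 180, 132, 88, 44, 74, 116, 148, 220, 176, 132, 88, 44, 10, 20, -44, 44]

end RootBasisData

section ListFunctions

theorem getD_addL (l m : List ℤ) (n : ℕ) :
    (addL l m).getD n 0 = l.getD n 0 + m.getD n 0 := by
  induction l generalizing m n with
  | nil => simp [addL]
  | cons a l ih =>
    cases m with
    | nil => simp [addL]
    | cons b m =>
      cases n with
      | zero => simp [addL]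
      | succ n => simpa [addL] using ih m n

theorem getD_smulL (c : ℤ) (l : List ℤ) (n : ℕ) : (smulL c l).getD n 0 = c * l.getD n 0 := by
  induction l generalizing n with
  | nil => simp [smulL]
  | cons a l ih =>
    cases n with
    | zero => simp [smulL]
    | succ n => simpa [smulL] using ih n

theorem dotL_eq_sum {n : ℕ} {l : List ℤ} (h : l.length ≤ n) (m : List ℤ) :
    dotL l m = ∑ i : Fin n, l.getD i 0 * m.getD i 0 := by
  induction n generalizing l m with
  | zero =>
    have : l = [] := List.eq_nil_of_length_eq_zero (by omega)
    subst this
    cases m <;> rfl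
  | succ n ih =>
    cases l with
    | nil => cases m <;> simp [dotL]
    | cons a l =>
      cases m with
      | nil => simp [dotL]
      | cons b m =>
        rw [dotL, Fin.sum_univ_succ, ih (by simpa using h)]
        simp

theorem getD_combL {n : ℕ} {q : List ℤ} (h : q.length ≤ n) (F : List (List ℤ)) (j : ℕ) :
    (combL q F).getD j 0 = ∑ i : Fin n, q.getD i 0 * (F.getD i []).getD j 0 := by
  induction n generalizing q F with
  | zero =>
    have : q = [] := List.eq_nil_of_length_eq_zero (by omega)
    subst this
    cases F <;> simp [combL]
  | succ n ih =>
    cases q with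
    | nil => cases F <;> simp [combL]
    | cons a q =>
      cases F with
      | nil => simp [combL]
      | cons b F =>
        rw [combL, Fin.sum_univ_succ]
        have := ih (by simpa using h) F (q := q)
        split_ifs with h0
        · rw [this]
          simp [h0]
        · rw [getD_addL, getD_smulL, this]
          simp

end ListFunctions

/-! ### Exhaustive search for dominant weights -/

section DominantSearch

/-- The quadratic form of a matrix that is given by a list of rows. -/
def quadL (F : List (List ℤ)) (q : List ℤ) : ℤ := dotL q (combL q F)

/-- The list with an increased entry. -/
def incrL (q : List ℤ) (i : ℕ) : List ℤ := q.set i (q.getD i 0 + 1)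

/-- The verification that the vectors of square norm `2` or `2/3`, whose entries are at least those
of the given nonnegative vector, and equal to them before a given position, are in a list. -/
def searchL (n : ℕ) (F : List (List ℤ)) (den : ℤ) (ws : List (List ℤ)) : ℕ → ℕ → List ℤ → Bool
  | 0, _, _ => false
  | fuel + 1, k, q => decide (2 * den < quadL F q) ||
      ((decide (quadL F q ≠ 2 * den ∧ 3 * quadL F q ≠ 2 * den) || ws.contains q) &&
        (List.range' k (n - k)).all fun i => searchL n F den ws fuel i (incrL q i))

theorem getD_incrL {q : List ℤ} {i : ℕ} (hi : i < q.length) (j : ℕ) :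
    (incrL q i).getD j 0 = q.getD j 0 + if i = j then 1 else 0 := by
  rw [incrL]
  split_ifs with h
  · subst h
    simp [List.getD_eq_getElem?_getD, hi]
  · simp [List.getD_eq_getElem?_getD, List.getElem?_set_ne h]

theorem exists_minimal_of_not_forall {n : ℕ} {P : Fin n → Prop} (h : ¬ ∀ i, P i) :
    ∃ i, ¬ P i ∧ ∀ j : Fin n, (j : ℕ) < i → P j := by
  classical
  push Not at h
  obtain ⟨i, hi, hmin⟩ := (measure fun i : Fin n => (i : ℕ)).wf.has_min {i | ¬ P i} h
  exact ⟨i, hi, fun j hj => by_contra fun hj' => hmin j hj' hj⟩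

/-- All entries of `F` are nonnegative, so the quadratic form is monotone on nonnegative vectors and
a branch may be cut once its value exceeds `2 * den`. The invariant is that `q` lies below `p` and
agrees with it before position `k`. -/
theorem exists_of_searchL {n : ℕ} {F : List (List ℤ)} {den : ℤ} (hden : 0 < den)
    {ws : List (List ℤ)} (hF : ∀ i j : Fin n, 0 ≤ (F.getD i []).getD j 0) {fuel : ℕ}
    {k : ℕ} {q : List ℤ} (hs : searchL n F den ws fuel k q = true) (hq : q.length = n)
    (hq0 : ∀ i : Fin n, 0 ≤ q.getD i 0) {p : Fin n → ℤ} (hqp : ∀ i : Fin n, q.getD i 0 ≤ p i)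
    (hk : ∀ i : Fin n, (i : ℕ) < k → q.getD i 0 = p i)
    (hp : ∑ i : Fin n, ∑ j : Fin n, p i * (F.getD i []).getD j 0 * p j = 2 * den ∨
      3 * ∑ i : Fin n, ∑ j : Fin n, p i * (F.getD i []).getD j 0 * p j = 2 * den) :
    ∃ w ∈ ws, ∀ i : Fin n, p i = w.getD i 0 := by
  have hquad : ∀ q : List ℤ, q.length = n → quadL F q =
      ∑ i : Fin n, ∑ j : Fin n, q.getD i 0 * (F.getD i []).getD j 0 * q.getD j 0 := by
    intro q hq
    rw [quadL, dotL_eq_sum hq.le, Finset.sum_comm]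
    refine Finset.sum_congr rfl fun j _ => ?_
    rw [getD_combL hq.le, Finset.mul_sum]
    refine Finset.sum_congr rfl fun i _ => ?_
    ring
  induction fuel generalizing q k with
  | zero => simp [searchL] at hs
  | succ fuel ih =>
    simp only [searchL, Bool.or_eq_true, Bool.and_eq_true, decide_eq_true_eq, List.all_eq_true,
      List.mem_range'_1, List.contains_iff_mem] at hs
    have hle : quadL F q ≤ ∑ i : Fin n, ∑ j : Fin n, p i * (F.getD i []).getD j 0 * p j := by
      rw [hquad q hq]
      refine Finset.sum_le_sum fun i _ => Finset.sum_le_sum fun j _ => ?_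
      have := hF i j
      have := hqp i
      have := hqp j
      have := hq0 i
      have := hq0 j
      gcongr
      exact mul_nonneg ((hq0 i).trans (hqp i)) (hF i j)
    rcases hs with hs | ⟨h1, h2⟩
    · exfalso
      rcases hp with h | h <;> linarith
    · by_cases he : ∀ i : Fin n, q.getD i 0 = p i
      · rcases h1 with h1 | h1
        · exfalso
          have e : quadL F q = ∑ i : Fin n, ∑ j : Fin n, p i * (F.getD i []).getD j 0 * p j := by
            rw [hquad q hq]
            simp only [he]
          rw [e] at h1
          rcases hp with h | h
          · exact h1.1 h
          · exact h1.2 h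
        · exact ⟨q, h1, fun i => (he i).symm⟩
      -- Increasing the first entry in which `q` falls short of `p` keeps the invariant; increments
      -- at nondecreasing positions reach every vector.
      · obtain ⟨i, hi, hmin⟩ := exists_minimal_of_not_forall he
        have hki : k ≤ i := by
          by_contra h
          exact hi (hk i (by omega))
        have hiq : (i : ℕ) < q.length := by rw [hq]; exact i.2
        refine ih (h2 i ⟨hki, by have := i.2; omega⟩) (by simp [incrL, hq]) (fun j => ?_)
          (fun j => ?_) (fun j hj => ?_)
        · rw [getD_incrL hiq]
          have := hq0 j
          split_ifs <;> linarith
        · rw [getD_incrL hiq]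
          have h3 := hqp j
          split_ifs with hij
          · have : i = j := Fin.ext hij
            subst this
            have := lt_of_le_of_ne h3 hi
            linarith
          · linarith
        · rw [getD_incrL hiq, ← hmin j hj, if_neg (by omega), add_zero]

/-- Repeated reflection of a weight in the first simple coroot with a negative product. -/
def climbL (C : List (List ℤ)) : ℕ → List ℤ → List ℤ
  | 0, p => p
  | fuel + 1, p =>
    match (List.range p.length).find? fun i => decide (p.getD i 0 < 0) with
    | none => p
    | some i => climbL C fuel (addL p (smulL (-p.getD i 0) (C.getD i [])))

/-- Every step of the climb is one of the reflections in the definition of `IsRootWeight`, so the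
result is a root weight whether or not the climb has ended. -/
theorem isRootWeight_climbL {n : ℕ} {D : RootDatum n} {C : List (List ℤ)}
    (hC : ∀ i j : Fin n, D.cartan i j = (C.getD i []).getD j 0) (fuel : ℕ) {p : List ℤ}
    (hl : p.length = n) (hCl : ∀ i < n, (C.getD i []).length = n)
    (hp : D.IsRootWeight fun j => p.getD j 0) :
    D.IsRootWeight fun j => (climbL C fuel p).getD j 0 := by
  induction fuel generalizing p with
  | zero => exact hp
  | succ fuel ih =>
    rw [climbL]
    split
    · exact hp
    · rename_i i hi
      have hin : i < n := by
        have := List.mem_of_find?_eq_some hi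
        rw [← hl]
        simpa using this
      have hlen : ∀ l m : List ℤ, l.length = n → m.length = n → (addL l m).length = n := by
        clear * -
        intro l m
        induction l generalizing m n with
        | nil => simp +contextual [addL]
        | cons a l ih =>
          cases m with
          | nil => simp +contextual [addL]
          | cons b m =>
            intro h1 h2
            subst h1
            simpa [addL] using ih (n := l.length) m rfl (by simpa using h2)
      have hlen' : ∀ (c : ℤ) (l : List ℤ), (smulL c l).length = l.length := by
        intro c l
        induction l with
        | nil => rfl
        | cons a l ih => simp [smulL, ih]
      apply ih (hlen _ _ hl ((hlen' _ _).trans (hCl i hin)))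
      have h := RootDatum.IsRootWeight.reflect ⟨i, hin⟩ _ hp
      convert h using 2 with j
      rw [getD_addL, getD_smulL, hC]
      ring

end DominantSearch

/-! ### Validity of the six root data -/

section CuspRootData

/-- The Cartan matrix of the root basis of the orthogonal complement of a cusp. -/
def cartanL (t : BoundaryType) : List (List ℤ) :=
  (nodesL t).map fun i => (nodesL t).map fun j => dotL (corootL i) (rootL j)

/-- The root datum of the orthogonal complement of a cusp. -/
def cuspDatum (t : BoundaryType) : RootDatum 18 where
  cartan i j := ((cartanL t).getD i []).getD j 0
  div i := rootDiv ((nodesL t).getD i 0)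
  inv i j := ((invL t).getD i []).getD j 0
  den := invDen t

/-- The weights of the roots that are found by climbing from the simple roots. -/
def dominantL (t : BoundaryType) : List (List ℤ) :=
  (cartanL t).map (climbL (cartanL t) 40)

/-- With fuel `6` the search visits coordinate sums up to `5`; its success includes that every
branch has exceeded the bound by then. -/
theorem searchL_cusp (t : BoundaryType) :
    searchL 18 (invL t) (invDen t) (dominantL t) 6 0 (List.replicate 18 0) = true := by
  cases t <;> decide +kernel

theorem cartanL_spec (t : BoundaryType) : (cartanL t).length = 18 ∧
    ∀ i < 18, ((cartanL t).getD i []).length = 18 := by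
  cases t <;> decide +kernel

theorem invL_nonneg (t : BoundaryType) :
    ∀ i j : Fin 18, 0 ≤ ((invL t).getD i []).getD j 0 := by
  cases t <;> decide +kernel

theorem isValid_cuspDatum (t : BoundaryType) : (cuspDatum t).IsValid where
  div_eq i := by
    change rootDiv _ = 1 ∨ rootDiv _ = 3
    unfold rootDiv
    split_ifs <;> simp
  cartan_self := by cases t <;> decide +kernel
  symm := by cases t <;> decide +kernel
  nonpos := by cases t <;> decide +kernel
  den_pos := by cases t <;> decide +kernel
  inv_pos := by cases t <;> decide +kernel
  inv_mul := by cases t <;> decide +kernel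
  dominant p hp h := by
    have h0 : ∀ i : Fin 18, (List.replicate 18 (0 : ℤ)).getD i 0 = 0 := by decide
    obtain ⟨w, hw, e⟩ := exists_of_searchL (by cases t <;> decide +kernel) (invL_nonneg t)
      (searchL_cusp t) (by simp) (fun i => (h0 i).ge)
      (fun i => (h0 i).trans_le (hp i)) (fun i hi => absurd hi (Nat.not_lt_zero _)) h
    rw [funext e]
    obtain ⟨c, hc, rfl⟩ := List.mem_map.1 hw
    obtain ⟨i, hi, rfl⟩ := List.getElem_of_mem hc
    obtain ⟨h1, h2⟩ := cartanL_spec t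
    have hi' : i < 18 := by omega
    -- The number `40` needs no justification here: the search has already matched the weight with
    -- the result of the climb.
    refine isRootWeight_climbL (fun _ _ => rfl) 40 ?_ h2 ?_
    · rw [← h2 i hi', List.getD_eq_getElem _ _ hi]
    · have := RootDatum.IsRootWeight.simple (D := cuspDatum t) ⟨i, hi'⟩
      convert this using 2
      change _ = ((cartanL t).getD i []).getD _ 0
      rw [List.getD_eq_getElem _ _ hi]

end CuspRootData

/-! ### Affine root systems at the six cusps -/

section AffineType

theorem weylOrbit_comp_iff {V : Type*} [AddCommGroup V] [Module ℚ V]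
    (Q : LinearMap.BilinForm ℚ V) {ι κ : Type} (b : κ → V) {e : ι → κ}
    (he : Function.Surjective e) (x : V) : WeylOrbit Q (fun i => b (e i)) x ↔ WeylOrbit Q b x := by
  constructor
  · intro h
    induction h with
    | simple i => exact .simple _
    | reflect i x _ ih => exact .reflect _ x ih
  · intro h
    induction h with
    | simple j =>
      obtain ⟨i, rfl⟩ := he j
      exact WeylOrbit.simple (b := fun i => b (e i)) i
    | reflect j x _ ih =>
      obtain ⟨i, rfl⟩ := he j
      exact WeylOrbit.reflect (b := fun i => b (e i)) i x ih

theorem toRational_ne_zero_of_apply_eq_one {M : Type*} [AddCommGroup M]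
    {B : LinearMap.BilinForm ℤ M} {v z : M} (h : B v z = 1) : toRational v ≠ 0 := by
  intro h0
  have := rationalForm_toRational B v z
  rw [h0, h, map_zero, LinearMap.zero_apply] at this
  norm_num at this

variable {M : Type*} [AddCommGroup M] {B : LinearMap.BilinForm ℤ M} {δ : M} {n : ℕ}
  {D : RootDatum n} {β : Fin n → M}

theorem isOfAffineType_of_isRootBasis (hB : ∀ x y, B x y = B y x) (hD : D.IsValid)
    (hβ : IsRootBasis B δ D β) (hδ : toRational δ ≠ 0) {ι : Type} {e : ι → Fin n}
    (he : Function.Surjective e) {G : Matrix ι ι ℚ}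
    (hG : ∀ i j, (D.cartan (e i) (e j) : ℚ) / D.div (e j) = G i j) :
    IsOfAffineType (rationalForm B) (rootsPerp B δ) (toRational δ) G := by
  refine ⟨hδ, by rw [rationalForm_toRational, hβ.isotropic, Int.cast_zero],
    fun i => rootBasis D β (e i), fun i j => ?_, fun i => ?_, ?_⟩
  · rw [rationalForm_rootBasis hD hβ, hG]
  · rw [rationalForm_comm hB, rationalForm_rootBasis_delta hβ]
  · rw [rootsPerp_eq hB hD hβ]
    ext x
    simp only [weylOrbit_comp_iff _ _ he]

end AffineType

section CuspRootBasis

/-- The root basis of the orthogonal complement of a cusp, with the short roots multiplied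
by `3`. -/
def cuspBasis (t : BoundaryType) (i : Fin 18) : Lambda1 := simpleRoot ((nodesL t).getD i 0)

/-- The coefficients of the linear functions that express the multiple of a vector by the root
basis. -/
def spanFnsL (t : BoundaryType) : List (List ℤ) :=
  (invL t).map fun F => smulL (spanScale t) (combL F ((nodesL t).map fun j => gramMulL (rootL j)))

theorem nodesL_spec (t : BoundaryType) : (nodesL t).length = 18 ∧ (∀ i ∈ nodesL t, i < 36) ∧
    ∀ i ∈ nodesL t, bilL (rootL i) (cuspL t) = 0 := by
  cases t <;> decide +kernel

/-- On basis vectors, a multiple of `x` is a combination of the eighteen roots and the cusp, plus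
`form1 x (cusp t)` times an auxiliary vector `spanDualL t`. -/
theorem spanFnsL_spec (t : BoundaryType) : (spanFnsL t).length = 18 ∧
    invDen t * spanScale t ≠ 0 ∧ ∀ i < 20,
    combL ((spanFnsL t ++ [spanCoeffL t, gramMulL (cuspL t)]).map fun p => dotL p (unitL i))
      ((nodesL t).map rootL ++ [cuspL t, spanDualL t]) =
        smulL (invDen t * spanScale t) (unitL i) := by
  cases t <;> decide +kernel

theorem lincomb_append {M N : Type*} [AddCommGroup M] [AddCommGroup N]
    {fs : List (M →ₗ[ℤ] ℤ)} {vs : List N} (h : fs.length = vs.length) (fs' : List (M →ₗ[ℤ] ℤ))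
    (vs' : List N) : lincomb (fs ++ fs') (vs ++ vs') = lincomb fs vs + lincomb fs' vs' := by
  induction fs generalizing vs with
  | nil =>
    have : vs = [] := List.eq_nil_of_length_eq_zero h.symm
    subst this
    simp [lincomb]
  | cons f fs ih =>
    cases vs with
    | nil => simp at h
    | cons v vs =>
      simp only [List.cons_append, lincomb]
      rw [ih (by simpa using h), add_assoc]

theorem exists_lincomb_eq_sum {M N : Type*} [AddCommGroup M] [AddCommGroup N] {n : ℕ}
    (fs : List (M →ₗ[ℤ] ℤ)) {vs : List N} (h : vs.length = n) (x : M) :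
    ∃ a : Fin n → ℤ, lincomb fs vs x = ∑ i : Fin n, a i • vs.getD i 0 := by
  induction n generalizing fs vs with
  | zero =>
    have : vs = [] := List.eq_nil_of_length_eq_zero h
    subst this
    exact ⟨0, by cases fs <;> simp [lincomb]⟩
  | succ n ih =>
    cases vs with
    | nil => simp at h
    | cons v vs =>
      cases fs with
      | nil => exact ⟨0, by simp [lincomb]⟩
      | cons f fs =>
        obtain ⟨a, ha⟩ := ih fs (vs := vs) (by simpa using h)
        refine ⟨Fin.cons (f x) a, ?_⟩
        rw [lincomb, LinearMap.add_apply, ha, Fin.sum_univ_succ]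
        simp

theorem getD_nodesL_mem (t : BoundaryType) (i : Fin 18) : (nodesL t).getD i 0 ∈ nodesL t := by
  have h : (i : ℕ) < (nodesL t).length := by rw [(nodesL_spec t).1]; exact i.2
  rw [List.getD_eq_getElem _ _ h]
  exact List.getElem_mem h

theorem cartan_cuspDatum (t : BoundaryType) (i j : Fin 18) : (cuspDatum t).cartan i j =
    dotL (corootL ((nodesL t).getD i 0)) (rootL ((nodesL t).getD j 0)) := by
  have hi : (i : ℕ) < (nodesL t).length := by rw [(nodesL_spec t).1]; exact i.2
  have hj : (j : ℕ) < (nodesL t).length := by rw [(nodesL_spec t).1]; exact j.2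
  change ((cartanL t).getD i []).getD j 0 = _
  rw [cartanL, List.getD_eq_getElem (l := List.map _ (nodesL t)) _ (by simpa using hi),
    List.getElem_map, List.getD_eq_getElem _ _ (by simpa using hj), List.getElem_map,
    List.getD_eq_getElem _ _ hi, List.getD_eq_getElem _ _ hj]

theorem isRootBasis_cuspBasis (t : BoundaryType) :
    IsRootBasis form1 (cusp t) (cuspDatum t) (cuspBasis t) where
  gram i j := by
    have hi := (nodesL_spec t).2.1 _ (getD_nodesL_mem t i)
    have hj := (nodesL_spec t).2.1 _ (getD_nodesL_mem t j)
    rw [cartan_cuspDatum, ← dotWith_ofList _ (length_rootL _ hj), form1_comm]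
    exact (rootDiv_mul_coroot hi _).symm
  dvd i x := by
    have hi := (nodesL_spec t).2.1 _ (getD_nodesL_mem t i)
    exact ⟨_, (rootDiv_mul_coroot hi x).symm⟩
  perp i := by
    have hi := (nodesL_spec t).2.1 _ (getD_nodesL_mem t i)
    rw [cuspBasis, simpleRoot, cusp, form1_ofList (length_rootL _ hi) (length_cuspL t)]
    exact (nodesL_spec t).2.2 _ (getD_nodesL_mem t i)
  isotropic := form1_cusp t
  unimodular := Or.inr ⟨_, form1_cusp_partner t⟩
  span x hx := by
    obtain ⟨hl, hd, hs⟩ := spanFnsL_spec t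
    refine ⟨invDen t * spanScale t, hd, ?_⟩
    have key : (invDen t * spanScale t) • LinearMap.id =
        lincomb ((spanFnsL t ++ [spanCoeffL t, gramMulL (cuspL t)]).map dotWith)
          (((nodesL t).map rootL ++ [cuspL t, spanDualL t]).map ofList) := by
      refine ext_unitL fun i hi => ?_
      rw [lincomb_apply, List.map_map]
      have e : (fun f : Lambda1 →ₗ[ℤ] ℤ => f (ofList (unitL i))) ∘ dotWith =
          fun p => dotL p (unitL i) := by
        funext p
        exact dotWith_ofList _ (length_unitL i)
      rw [e, hs i hi, ofList_smulL]
      rfl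
    have key2 := congrArg (fun f => f x) key
    simp only [LinearMap.smul_apply, LinearMap.id_apply] at key2
    rw [List.map_append, List.map_append, lincomb_append
      (by rw [List.length_map, List.length_map, List.length_map, hl, (nodesL_spec t).1]),
      LinearMap.add_apply] at key2
    obtain ⟨a, ha⟩ := exists_lincomb_eq_sum (n := 18) ((spanFnsL t).map dotWith)
      (vs := ((nodesL t).map rootL).map ofList)
      (by rw [List.length_map, List.length_map, (nodesL_spec t).1]) x
    refine ⟨a, dotWith (spanCoeffL t) x, ?_⟩
    rw [key2, ha]
    congr 1
    · refine Finset.sum_congr rfl fun i _ => ?_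
      have hi : (i : ℕ) < (nodesL t).length := by rw [(nodesL_spec t).1]; exact i.2
      rw [cuspBasis, simpleRoot, List.getD_eq_getElem _ _ (by simpa using hi), List.getElem_map,
        List.getElem_map, List.getD_eq_getElem _ _ hi]
    · simp only [List.map_cons, List.map_nil, lincomb, LinearMap.add_apply,
        LinearMap.smulRight_apply, add_zero]
      -- The auxiliary vector enters with coefficient `form1 x (cusp t)`, which vanishes on the
      -- orthogonal complement of the cusp.
      rw [← form1_eq_dotWith (length_cuspL t)]
      change _ + form1 x (cusp t) • _ = _
      rw [hx, zero_smul, add_zero]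
      rfl

end CuspRootBasis

section CuspTypes

/-- The numbering of the vertices of a diagram with two parts. -/
def indexTwo (a b : ℕ) (h : a + b = 18) : Fin a ⊕ Fin b → Fin 18 :=
  Sum.elim (fun i => ⟨i, by omega⟩) (fun i => ⟨a + i, by omega⟩)

/-- The numbering of the vertices of a diagram with three parts. -/
def indexThree (a b c : ℕ) (h : a + b + c = 18) : Fin a ⊕ Fin b ⊕ Fin c → Fin 18 :=
  Sum.elim (fun i => ⟨i, by omega⟩)
    (Sum.elim (fun i => ⟨a + i, by omega⟩) (fun i => ⟨a + b + i, by omega⟩))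

theorem indexTwo_surjective {a b : ℕ} (h : a + b = 18) : Function.Surjective (indexTwo a b h) := by
  intro y
  by_cases h1 : (y : ℕ) < a
  · exact ⟨Sum.inl ⟨y, h1⟩, rfl⟩
  · refine ⟨Sum.inr ⟨y - a, by omega⟩, Fin.ext ?_⟩
    change a + (y - a : ℕ) = y
    omega

theorem indexThree_surjective {a b c : ℕ} (h : a + b + c = 18) :
    Function.Surjective (indexThree a b c h) := by
  intro y
  by_cases h1 : (y : ℕ) < a
  · exact ⟨Sum.inl ⟨y, h1⟩, rfl⟩
  · by_cases h2 : (y : ℕ) < a + b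
    · refine ⟨Sum.inr (Sum.inl ⟨y - a, by omega⟩), Fin.ext ?_⟩
      change a + (y - a : ℕ) = y
      omega
    · refine ⟨Sum.inr (Sum.inr ⟨y - (a + b), by omega⟩), Fin.ext ?_⟩
      change a + b + (y - (a + b) : ℕ) = y
      omega

/-- The Gram matrix of the root basis. -/
def cuspGram (t : BoundaryType) (i j : Fin 18) : ℚ :=
  ((cuspDatum t).cartan i j : ℚ) / (cuspDatum t).div j

theorem cuspGram_twoE8 : ∀ p : (Fin 8 ⊕ Fin 8 ⊕ Fin 2) × (Fin 8 ⊕ Fin 8 ⊕ Fin 2),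
    cuspGram .twoE8 (indexThree 8 8 2 rfl p.1) (indexThree 8 8 2 rfl p.2) =
      (gramE8 ⊥ₗ gramE8 ⊥ₗ gramG2) p.1 p.2 := by
  decide +kernel

theorem cuspGram_D16 : ∀ p : (Fin 16 ⊕ Fin 2) × (Fin 16 ⊕ Fin 2),
    cuspGram .D16 (indexTwo 16 2 rfl p.1) (indexTwo 16 2 rfl p.2) =
      (gramD 16 ⊥ₗ gramG2) p.1 p.2 := by
  decide +kernel

theorem cuspGram_A17 : ∀ p : (Fin 17 ⊕ Fin 1) × (Fin 17 ⊕ Fin 1),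
    cuspGram .A17 (indexTwo 17 1 rfl p.1) (indexTwo 17 1 rfl p.2) =
      (gramA 17 ⊥ₗ gramA1s) p.1 p.2 := by
  decide +kernel

theorem cuspGram_E7D10 : ∀ p : (Fin 7 ⊕ Fin 10 ⊕ Fin 1) × (Fin 7 ⊕ Fin 10 ⊕ Fin 1),
    cuspGram .E7D10 (indexThree 7 10 1 rfl p.1) (indexThree 7 10 1 rfl p.2) =
      (gramE7 ⊥ₗ gramD 10 ⊥ₗ gramA1s) p.1 p.2 := by
  decide +kernel

theorem cuspGram_threeE6 : ∀ p : (Fin 6 ⊕ Fin 6 ⊕ Fin 6) × (Fin 6 ⊕ Fin 6 ⊕ Fin 6),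
    cuspGram .threeE6 (indexThree 6 6 6 rfl p.1) (indexThree 6 6 6 rfl p.2) =
      (gramE6 ⊥ₗ gramE6 ⊥ₗ gramE6) p.1 p.2 := by
  decide +kernel

theorem cuspGram_D7A11 : ∀ p : (Fin 7 ⊕ Fin 11) × (Fin 7 ⊕ Fin 11),
    cuspGram .D7A11 (indexTwo 7 11 rfl p.1) (indexTwo 7 11 rfl p.2) =
      (gramD 7 ⊥ₗ gramA 11) p.1 p.2 := by
  decide +kernel

theorem hasAffineType_cusp (t : BoundaryType) : HasAffineType (rationalForm form1)
    (rootsPerp form1 (cusp t)) (toRational (cusp t)) t := by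
  have hδ := toRational_ne_zero_of_apply_eq_one (form1_cusp_partner t)
  have hD := isValid_cuspDatum t
  have hβ := isRootBasis_cuspBasis t
  cases t
  · exact isOfAffineType_of_isRootBasis form1_comm hD hβ hδ (indexThree_surjective rfl)
      fun i j => cuspGram_twoE8 (i, j)
  · exact isOfAffineType_of_isRootBasis form1_comm hD hβ hδ (indexTwo_surjective rfl)
      fun i j => cuspGram_D16 (i, j)
  · exact isOfAffineType_of_isRootBasis form1_comm hD hβ hδ (indexTwo_surjective rfl)
      fun i j => cuspGram_A17 (i, j)
  · exact isOfAffineType_of_isRootBasis form1_comm hD hβ hδ (indexThree_surjective rfl)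
      fun i j => cuspGram_E7D10 (i, j)
  · exact isOfAffineType_of_isRootBasis form1_comm hD hβ hδ (indexThree_surjective rfl)
      fun i j => cuspGram_threeE6 (i, j)
  · exact isOfAffineType_of_isRootBasis form1_comm hD hβ hδ (indexTwo_surjective rfl)
      fun i j => cuspGram_D7A11 (i, j)

end CuspTypes

/-! ### Determinants of the Cartan matrices -/

section Determinants

/-- An upper triangular `T` with `A * T` lower triangular turns the determinant into two products of
diagonal entries; this avoids expanding determinants of size up to `17`. -/
theorem det_mul_prod_of_triangular {n : ℕ} {A T : Matrix (Fin n) (Fin n) ℤ}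
    
    (hT : ∀ p : Fin n × Fin n, p.2 < p.1 → T p.1 p.2 = 0)
    (hAT : ∀ p : Fin n × Fin n, p.1 < p.2 → (A * T) p.1 p.2 = 0) :
    A.det * ∏ i, T i i = ∏ i, (A * T) i i := by
  rw [← Matrix.det_of_isUpperTriangular (M := T) (fun i j h => hT (i, j) h),
    ← Matrix.det_of_isLowerTriangular (A * T) (fun i j h => hAT (i, j) h), Matrix.det_mul]

/-- A triangular matrix that makes the Cartan matrix of type `A` triangular. -/
def triangleA (n : ℕ) : Matrix (Fin n) (Fin n) ℤ :=
  Matrix.of fun i j => if i ≤ j then (i : ℤ) + 1 else 0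

/-- A triangular matrix that makes the Cartan matrix of type `D` triangular. -/
def triangleD (n : ℕ) : Matrix (Fin n) (Fin n) ℤ :=
  Matrix.of fun i j =>
    if (j : ℕ) + 2 < n then (if i ≤ j then (i : ℤ) + 1 else 0)
    else if (j : ℕ) + 1 < n then
      (if (i : ℕ) + 2 < n then (i : ℤ) + 1 else if (i : ℕ) + 1 < n then (n : ℤ) - 1 else 0)
    else
      (if (i : ℕ) + 2 < n then 2 * ((i : ℤ) + 1)
        else if (i : ℕ) + 1 < n then (n : ℤ) - 2 else (n : ℤ))

theorem det_A17 : (CartanMatrix.A 17).det = 18 := by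
  have h := det_mul_prod_of_triangular (A := CartanMatrix.A 17) (T := triangleA 17)
    (by decide +kernel) (by decide +kernel)
  have h1 : ∏ i, triangleA 17 i i ≠ 0 := by decide +kernel
  have h2 : ∏ i, (CartanMatrix.A 17 * triangleA 17) i i = 18 * ∏ i, triangleA 17 i i := by
    decide +kernel
  exact mul_right_cancel₀ h1 (h.trans h2)

theorem det_A11 : (CartanMatrix.A 11).det = 12 := by
  have h := det_mul_prod_of_triangular (A := CartanMatrix.A 11) (T := triangleA 11)
    (by decide +kernel) (by decide +kernel)
  have h1 : ∏ i, triangleA 11 i i ≠ 0 := by decide +kernel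
  have h2 : ∏ i, (CartanMatrix.A 11 * triangleA 11) i i = 12 * ∏ i, triangleA 11 i i := by
    decide +kernel
  exact mul_right_cancel₀ h1 (h.trans h2)

theorem det_D16 : (CartanMatrix.D 16).det = 4 := by
  have h := det_mul_prod_of_triangular (A := CartanMatrix.D 16) (T := triangleD 16)
    (by decide +kernel) (by decide +kernel)
  have h1 : ∏ i, triangleD 16 i i ≠ 0 := by decide +kernel
  have h2 : ∏ i, (CartanMatrix.D 16 * triangleD 16) i i = 4 * ∏ i, triangleD 16 i i := by
    decide +kernel
  exact mul_right_cancel₀ h1 (h.trans h2)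

theorem det_D10 : (CartanMatrix.D 10).det = 4 := by
  have h := det_mul_prod_of_triangular (A := CartanMatrix.D 10) (T := triangleD 10)
    (by decide +kernel) (by decide +kernel)
  have h1 : ∏ i, triangleD 10 i i ≠ 0 := by decide +kernel
  have h2 : ∏ i, (CartanMatrix.D 10 * triangleD 10) i i = 4 * ∏ i, triangleD 10 i i := by
    decide +kernel
  exact mul_right_cancel₀ h1 (h.trans h2)

theorem det_D7 : (CartanMatrix.D 7).det = 4 := by
  have h := det_mul_prod_of_triangular (A := CartanMatrix.D 7) (T := triangleD 7)
    (by decide +kernel) (by decide +kernel)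
  have h1 : ∏ i, triangleD 7 i i ≠ 0 := by decide +kernel
  have h2 : ∏ i, (CartanMatrix.D 7 * triangleD 7) i i = 4 * ∏ i, triangleD 7 i i := by
    decide +kernel
  exact mul_right_cancel₀ h1 (h.trans h2)

theorem det_map_intCast {n : ℕ} (A : Matrix (Fin n) (Fin n) ℤ) :
    (A.map (Int.cast : ℤ → ℚ)).det = A.det :=
  ((Int.castRingHom ℚ).map_det A).symm

theorem det_orthSum {ι κ : Type} [Fintype ι] [DecidableEq ι] [Fintype κ] [DecidableEq κ]
    (G : Matrix ι ι ℚ) (H : Matrix κ κ ℚ) : (G ⊥ₗ H).det = G.det * H.det :=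
  Matrix.det_fromBlocks_zero₂₁ G 0 H

theorem det_gramE6 : gramE6.det = 3 := by
  rw [gramE6, det_map_intCast, CartanMatrix.E₆_det]
  norm_num

theorem det_gramE7 : gramE7.det = 2 := by
  rw [gramE7, det_map_intCast, CartanMatrix.E₇_det]
  norm_num

theorem det_gramE8 : gramE8.det = 1 := by
  rw [gramE8, det_map_intCast, CartanMatrix.E₈_det]
  norm_num

theorem det_gramA1s : gramA1s.det = 2 / 3 := by
  simp [gramA1s]

theorem det_gramG2 : gramG2.det = 1 / 3 := by
  rw [gramG2, Matrix.det_fin_two_of]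
  norm_num

end Determinants

/-! ### The type is determined by the root system -/

section TypeInvariance

/-- Integrality of the Cartan matrix. -/
def IsCartanIntegral {ι : Type} (G : Matrix ι ι ℚ) : Prop :=
  ∀ i j, ∃ z : ℤ, 2 * G i j / G j j = z

/-- Stating integrality through denominators makes it decidable for the explicit Gram matrices. -/
theorem isCartanIntegral_of_den {ι : Type} {G : Matrix ι ι ℚ}
    (h : ∀ p : ι × ι, (2 * G p.1 p.2 / G p.2 p.2).den = 1) : IsCartanIntegral G := fun i j =>
  ⟨_, ((Rat.den_eq_one_iff _).1 (h (i, j))).symm⟩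

variable {V : Type*} [AddCommGroup V] [Module ℚ V] {Q : LinearMap.BilinForm ℚ V}

/-- A reflection changes a vector by a Cartan integer times a member of `b`, so the orbits stay in
the lattice spanned by `b`. -/
theorem exists_int_sum_of_weylOrbit {ι : Type} [Fintype ι] {G : Matrix ι ι ℚ}
    (hG : IsCartanIntegral G) {b : ι → V} (hb : ∀ i j, Q (b i) (b j) = G i j) {x : V}
    (hx : WeylOrbit Q b x) : ∃ c : ι → ℤ, x = ∑ i, (c i : ℚ) • b i := by
  classical
  have hs : ∀ (i : ι) (w : ℤ),
      ∑ j, ((Pi.single i w : ι → ℤ) j : ℚ) • b j = (w : ℚ) • b i := by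
    intro i w
    rw [Finset.sum_eq_single i]
    · simp
    · intro j _ hj
      simp [hj]
    · simp
  induction hx with
  | simple i => exact ⟨Pi.single i 1, by rw [hs, Int.cast_one, one_smul]⟩
  | reflect i x _ ih =>
    obtain ⟨c, rfl⟩ := ih
    choose z hz using hG
    refine ⟨c - Pi.single i (∑ j, c j * z j i), ?_⟩
    have h1 : 2 * Q (∑ j, (c j : ℚ) • b j) (b i) / Q (b i) (b i) =
        ((∑ j, c j * z j i : ℤ) : ℚ) := by
      rw [map_sum, LinearMap.sum_apply, Finset.mul_sum, Finset.sum_div]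
      push_cast
      refine Finset.sum_congr rfl fun j _ => ?_
      rw [map_smul, LinearMap.smul_apply, hb, hb, ← hz, smul_eq_mul]
      ring
    rw [h1, ← hs]
    simp only [Pi.sub_apply, Int.cast_sub, sub_smul, Finset.sum_sub_distrib]

/-- Two families that express each other integrally modulo the radical vector `δ` are related by
mutually inverse integer matrices, and the Gram determinants differ by the square of a unit. The
index types are not identified in advance, so that square is taken as `det (PᵀP)`. -/
theorem det_eq_of_sum {ι κ : Type} [Fintype ι] [DecidableEq ι] [Fintype κ] [DecidableEq κ]
    {G : Matrix ι ι ℚ} {H : Matrix κ κ ℚ} {δ : V} {b : ι → V} {c : κ → V}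
    (hb : ∀ i j, Q (b i) (b j) = G i j) (hc : ∀ i j, Q (c i) (c j) = H i j)
    (hδb : ∀ i, Q δ (b i) = 0) (hδc : ∀ i, Q δ (c i) = 0)
    (hQ : ∀ x y, Q x y = Q y x) (hG : 0 < G.det) (hH : 0 < H.det)
    (hbc : ∀ i, ∃ (p : κ → ℤ) (n : ℚ), b i = ∑ j, (p j : ℚ) • c j + n • δ)
    (hcb : ∀ i, ∃ (p : ι → ℤ) (n : ℚ), c i = ∑ j, (p j : ℚ) • b j + n • δ) :
    G.det = H.det := by
  obtain ⟨P, n, hP⟩ : ∃ (P : Matrix ι κ ℤ) (n : ι → ℚ),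
      ∀ i, b i = ∑ j, (P i j : ℚ) • c j + n i • δ := by
    choose P n hP using hbc
    exact ⟨P, n, hP⟩
  obtain ⟨R, m, hR⟩ : ∃ (R : Matrix κ ι ℤ) (m : κ → ℚ),
      ∀ i, c i = ∑ j, (R i j : ℚ) • b j + m i • δ := by
    choose R m hR using hcb
    exact ⟨R, m, hR⟩
  have main : ∀ {ι κ : Type} [Fintype ι] [DecidableEq ι] [Fintype κ] [DecidableEq κ]
      {G : Matrix ι ι ℚ} {H : Matrix κ κ ℚ} {b : ι → V} {c : κ → V},
      (∀ i j, Q (b i) (b j) = G i j) → (∀ i j, Q (c i) (c j) = H i j) →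
      (∀ i, Q δ (b i) = 0) → (∀ i, Q δ (c i) = 0) → 0 < G.det →
      ∀ (P : Matrix ι κ ℤ) (n : ι → ℚ), (∀ i, b i = ∑ j, (P i j : ℚ) • c j + n i • δ) →
      ∀ (R : Matrix κ ι ℤ) (m : κ → ℚ), (∀ i, c i = ∑ j, (R i j : ℚ) • b j + m i • δ) →
      P * R = 1 ∧ G = P.map (Int.cast : ℤ → ℚ) * H * (P.map (Int.cast : ℤ → ℚ)).transpose := by
    intro ι κ _ _ _ _ G H b c hb hc hδb hδc hG P n hP R m hR
    have h1 : ∀ i k, Q (b i) (c k) = ∑ j, (P i j : ℚ) * H j k := by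
      intro i k
      rw [hP, map_add, LinearMap.add_apply, map_smul, LinearMap.smul_apply, hδc, map_sum,
        LinearMap.sum_apply]
      simp [hc]
    have h2 : ∀ i k, Q (c i) (b k) = ∑ j, (R i j : ℚ) * G j k := by
      intro i k
      rw [hR, map_add, LinearMap.add_apply, map_smul, LinearMap.smul_apply, hδb, map_sum,
        LinearMap.sum_apply]
      simp [hb]
    constructor
    -- Substituting one expression into the other and pairing with `b` removes `δ`; the invertible
    -- `G` then cancels.
    · have h3 : G = (P * R).map (Int.cast : ℤ → ℚ) * G := by
        ext i k
        rw [Matrix.mul_apply, ← hb]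
        conv_lhs => rw [hP i]
        rw [map_add, LinearMap.add_apply, map_smul, LinearMap.smul_apply, hδb, map_sum,
          LinearMap.sum_apply]
        simp only [map_smul, LinearMap.smul_apply, h2, smul_eq_mul, mul_zero, add_zero,
          Finset.mul_sum, Matrix.map_apply, Matrix.mul_apply, Int.cast_sum, Int.cast_mul,
          Finset.sum_mul]
        rw [Finset.sum_comm]
        simp only [mul_assoc]
      have h4 : (P * R).map (Int.cast : ℤ → ℚ) = 1 := by
        have hu : IsUnit G.det := hG.ne'.isUnit
        have := congrArg (fun X => X * G⁻¹) h3
        simp only [Matrix.mul_assoc, Matrix.mul_nonsing_inv _ hu, Matrix.mul_one] at this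
        exact this.symm
      ext i k
      have := congrFun (congrFun h4 i) k
      rw [Matrix.map_apply] at this
      have h5 : ((1 : Matrix ι ι ℚ) i k) = (((1 : Matrix ι ι ℤ) i k : ℤ) : ℚ) := by
        simp [Matrix.one_apply]
      rw [h5] at this
      exact_mod_cast this
    · ext i k
      rw [← hb]
      conv_lhs => rw [hP k]
      rw [map_add, map_smul, hQ (b i) δ, hδb, map_sum]
      simp only [map_smul, h1, smul_eq_mul, mul_zero, add_zero, Matrix.mul_apply,
        Matrix.transpose_apply, Matrix.map_apply]
      refine Finset.sum_congr rfl fun j _ => ?_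
      ring
  obtain ⟨h1, h2⟩ := main hb hc hδb hδc hG P n hP R m hR
  obtain ⟨h3, -⟩ := main hc hb hδc hδb hH R m hR P n hP
  set Pq := P.map (Int.cast : ℤ → ℚ) with hPq
  set Rq := R.map (Int.cast : ℤ → ℚ) with hRq
  have h1q : Pq * Rq = 1 := by
    have := Matrix.map_mul (L := P) (M := R) (f := Int.castRingHom ℚ)
    rw [h1] at this
    refine Eq.trans this.symm ?_
    simp
  have h3q : Rq * Pq = 1 := by
    have := Matrix.map_mul (L := R) (M := P) (f := Int.castRingHom ℚ)
    rw [h3] at this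
    refine Eq.trans this.symm ?_
    simp
  -- Conjugation by the rectangular inverse pair moves the determinant from the index set `ι` to
  -- `κ`.
  have h4 : G.det = H.det * (Pq.transpose * Pq).det := by
    have e : G = Pq * (H * (Pq.transpose * Pq)) * Rq := by
      rw [h2]
      simp only [Matrix.mul_assoc, h1q, Matrix.mul_one]
    conv_lhs => rw [e]
    rw [Matrix.det_conj_of_mul_eq_one h1q h3q, Matrix.det_mul]
  have h5 : (Pq.transpose * Pq).det =
      ((Matrix.det (P.transpose * P) : ℤ) : ℚ) := by
    have := (Int.castRingHom ℚ).map_det (P.transpose * P)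
    rw [eq_intCast] at this
    rw [this]
    congr 1
    exact (Matrix.map_mul (L := P.transpose) (M := P) (f := Int.castRingHom ℚ)).symm
  -- An integer matrix with integer inverse `R * Rᵀ` has determinant `± 1`; the value `-1` is
  -- excluded by positivity of both Gram determinants.
  have h6 : IsUnit (Matrix.det (P.transpose * P)) := by
    refine IsUnit.of_mul_eq_one (Matrix.det (R * R.transpose)) ?_
    rw [← Matrix.det_mul]
    have : P.transpose * P *
        (R * R.transpose) = 1 := by
      calc _ = P.transpose * (P * R) *
            R.transpose := by simp only [Matrix.mul_assoc]
        _ = (R * P).transpose := by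
          rw [h1, Matrix.mul_one, Matrix.transpose_mul]
        _ = 1 := by rw [h3, Matrix.transpose_one]
    rw [this, Matrix.det_one]
  rw [h5] at h4
  rcases Int.isUnit_iff.1 h6 with h | h
  · rw [h] at h4
    simpa using h4
  · rw [h] at h4
    push_cast at h4
    linarith

/-- Each member of one root basis is itself a root, hence an integral combination of the other basis
up to a multiple of `δ`. -/
theorem IsOfAffineType.det_eq {ι κ : Type} [Fintype ι] [DecidableEq ι] [Fintype κ]
    [DecidableEq κ] {G : Matrix ι ι ℚ} {H : Matrix κ κ ℚ} {R : Set V} {δ : V}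
    (hQ : ∀ x y, Q x y = Q y x) (hR : IsOfAffineType Q R δ G) (hR' : IsOfAffineType Q R δ H)
    (iG : IsCartanIntegral G) (iH : IsCartanIntegral H) (hG : 0 < G.det) (hH : 0 < H.det) :
    G.det = H.det := by
  obtain ⟨-, -, b, hb, hδb, hRb⟩ := hR
  obtain ⟨-, -, c, hc, hδc, hRc⟩ := hR'
  have aux : ∀ {ι κ : Type} [Fintype κ] {H : Matrix κ κ ℚ} {b : ι → V} {c : κ → V},
      (∀ i j, Q (c i) (c j) = H i j) → IsCartanIntegral H →
      R = {x | ∃ (α : V) (n : ℤ), WeylOrbit Q b α ∧ x = α + n • δ} →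
      R = {x | ∃ (α : V) (n : ℤ), WeylOrbit Q c α ∧ x = α + n • δ} →
      ∀ i, ∃ (p : κ → ℤ) (n : ℚ), b i = ∑ j, (p j : ℚ) • c j + n • δ := by
    intro ι κ _ H b c hc iH hRb hRc i
    have : b i ∈ R := by
      rw [hRb]
      exact ⟨b i, 0, .simple i, by simp⟩
    rw [hRc] at this
    obtain ⟨α, n, hα, hn⟩ := this
    obtain ⟨p, rfl⟩ := exists_int_sum_of_weylOrbit iH hc hα
    exact ⟨p, n, by rw [hn, Int.cast_smul_eq_zsmul]⟩
  exact det_eq_of_sum hb hc hδb hδc hQ hG hH (aux hc iH hRb hRc) (aux hb iG hRc hRb)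

theorem IsOfFiniteType.det_eq {ι κ : Type} [Fintype ι] [DecidableEq ι] [Fintype κ]
    [DecidableEq κ] {G : Matrix ι ι ℚ} {H : Matrix κ κ ℚ} {R : Set V}
    (hQ : ∀ x y, Q x y = Q y x) (hR : IsOfFiniteType Q R G) (hR' : IsOfFiniteType Q R H)
    (iG : IsCartanIntegral G) (iH : IsCartanIntegral H) (hG : 0 < G.det) (hH : 0 < H.det) :
    G.det = H.det := by
  obtain ⟨b, hb, hRb⟩ := hR
  obtain ⟨c, hc, hRc⟩ := hR'
  have aux : ∀ {ι κ : Type} [Fintype κ] {H : Matrix κ κ ℚ} {b : ι → V} {c : κ → V},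
      (∀ i j, Q (c i) (c j) = H i j) → IsCartanIntegral H →
      R = {x | WeylOrbit Q b x} → R = {x | WeylOrbit Q c x} →
      ∀ i, ∃ (p : κ → ℤ) (n : ℚ), b i = ∑ j, (p j : ℚ) • c j + n • (0 : V) := by
    intro ι κ _ H b c hc iH hRb hRc i
    have : b i ∈ R := by
      rw [hRb]
      exact .simple i
    rw [hRc] at this
    obtain ⟨p, hp⟩ := exists_int_sum_of_weylOrbit iH hc this
    exact ⟨p, 0, by rw [smul_zero, add_zero]; exact hp⟩
  exact det_eq_of_sum (δ := 0) hb hc (by simp) (by simp) hQ hG hH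
    (aux hc iH hRb hRc) (aux hb iG hRc hRb)

/-- The determinants of the Gram matrices of the affine types. -/
def affineDet : BoundaryType → ℚ
  | .twoE8 => 1 / 3
  | .D16 => 4 / 3
  | .A17 => 12
  | .E7D10 => 16 / 3
  | .threeE6 => 27
  | .D7A11 => 48

/-- The determinants of the Gram matrices of the finite types. -/
def finiteDet : BoundaryType → ℚ
  | .twoE8 => 1
  | .D16 => 4
  | .A17 => 18
  | .E7D10 => 8
  | .threeE6 => 27
  | .D7A11 => 48

theorem affineDet_pos (t : BoundaryType) : 0 < affineDet t := by
  cases t <;> norm_num [affineDet]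

theorem finiteDet_pos (t : BoundaryType) : 0 < finiteDet t := by
  cases t <;> norm_num [finiteDet]

theorem affineDet_injective : Function.Injective affineDet := by
  intro s t h
  cases s <;> cases t <;> first | rfl | (norm_num [affineDet] at h)

theorem finiteDet_injective : Function.Injective finiteDet := by
  intro s t h
  cases s <;> cases t <;> first | rfl | (norm_num [finiteDet] at h)

theorem HasAffineType.exists_gram {R : Set V} {δ : V} {t : BoundaryType}
    (h : HasAffineType Q R δ t) : ∃ (ι : Type) (_ : Fintype ι) (_ : DecidableEq ι)
      (G : Matrix ι ι ℚ), IsOfAffineType Q R δ G ∧ IsCartanIntegral G ∧ G.det = affineDet t := by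
  cases t
  · refine ⟨_, inferInstance, inferInstance, _, h, isCartanIntegral_of_den (by decide +kernel), ?_⟩
    rw [det_orthSum, det_orthSum, det_gramE8, det_gramG2]
    norm_num [affineDet]
  · refine ⟨_, inferInstance, inferInstance, _, h, isCartanIntegral_of_den (by decide +kernel), ?_⟩
    rw [det_orthSum, gramD, det_map_intCast, det_D16, det_gramG2]
    norm_num [affineDet]
  · refine ⟨_, inferInstance, inferInstance, _, h, isCartanIntegral_of_den (by decide +kernel), ?_⟩
    rw [det_orthSum, gramA, det_map_intCast, det_A17, det_gramA1s]
    norm_num [affineDet]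
  · refine ⟨_, inferInstance, inferInstance, _, h, isCartanIntegral_of_den (by decide +kernel), ?_⟩
    rw [det_orthSum, det_orthSum, gramD, det_map_intCast, det_D10, det_gramA1s, det_gramE7]
    norm_num [affineDet]
  · refine ⟨_, inferInstance, inferInstance, _, h, isCartanIntegral_of_den (by decide +kernel), ?_⟩
    rw [det_orthSum, det_orthSum, det_gramE6]
    norm_num [affineDet]
  · refine ⟨_, inferInstance, inferInstance, _, h, isCartanIntegral_of_den (by decide +kernel), ?_⟩
    rw [det_orthSum, gramD, det_map_intCast, det_D7, gramA, det_map_intCast, det_A11]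
    norm_num [affineDet]

theorem HasFiniteType.exists_gram {R : Set V} {t : BoundaryType}
    (h : HasFiniteType Q R t) : ∃ (ι : Type) (_ : Fintype ι) (_ : DecidableEq ι)
      (G : Matrix ι ι ℚ), IsOfFiniteType Q R G ∧ IsCartanIntegral G ∧ G.det = finiteDet t := by
  cases t
  · refine ⟨_, inferInstance, inferInstance, _, h, isCartanIntegral_of_den (by decide +kernel), ?_⟩
    rw [det_orthSum, det_gramE8]
    norm_num [finiteDet]
  · refine ⟨_, inferInstance, inferInstance, _, h, isCartanIntegral_of_den (by decide +kernel), ?_⟩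
    rw [gramD, det_map_intCast, det_D16]
    norm_num [finiteDet]
  · refine ⟨_, inferInstance, inferInstance, _, h, isCartanIntegral_of_den (by decide +kernel), ?_⟩
    rw [gramA, det_map_intCast, det_A17]
    norm_num [finiteDet]
  · refine ⟨_, inferInstance, inferInstance, _, h, isCartanIntegral_of_den (by decide +kernel), ?_⟩
    rw [det_orthSum, gramD, det_map_intCast, det_D10, det_gramE7]
    norm_num [finiteDet]
  · refine ⟨_, inferInstance, inferInstance, _, h, isCartanIntegral_of_den (by decide +kernel), ?_⟩
    rw [det_orthSum, det_orthSum, det_gramE6]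
    norm_num [finiteDet]
  · refine ⟨_, inferInstance, inferInstance, _, h, isCartanIntegral_of_den (by decide +kernel), ?_⟩
    rw [det_orthSum, gramD, det_map_intCast, det_D7, gramA, det_map_intCast, det_A11]
    norm_num [finiteDet]

/-- The six determinants are pairwise different, so the determinant alone tells the types apart. -/
theorem HasAffineType.unique {R : Set V} {δ : V} {s t : BoundaryType}
    (hQ : ∀ x y, Q x y = Q y x) (hs : HasAffineType Q R δ s) (ht : HasAffineType Q R δ t) :
    s = t := by
  obtain ⟨ι, _, _, G, h, iG, hG⟩ := hs.exists_gram
  obtain ⟨κ, _, _, H, h', iH, hH⟩ := ht.exists_gram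
  apply affineDet_injective
  rw [← hG, ← hH]
  exact IsOfAffineType.det_eq hQ h h' iG iH (hG ▸ affineDet_pos s) (hH ▸ affineDet_pos t)

theorem HasFiniteType.unique {R : Set V} {s t : BoundaryType}
    (hQ : ∀ x y, Q x y = Q y x) (hs : HasFiniteType Q R s) (ht : HasFiniteType Q R t) :
    s = t := by
  obtain ⟨ι, _, _, G, h, iG, hG⟩ := hs.exists_gram
  obtain ⟨κ, _, _, H, h', iH, hH⟩ := ht.exists_gram
  apply finiteDet_injective
  rw [← hG, ← hH]
  exact IsOfFiniteType.det_eq hQ h h' iG iH (hG ▸ finiteDet_pos s) (hH ▸ finiteDet_pos t)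

end TypeInvariance

/-! ### Transport of roots and types along isometries -/

section Transport

variable {V W : Type*} [AddCommGroup V] [Module ℚ V] [AddCommGroup W] [Module ℚ W]
  {Q : LinearMap.BilinForm ℚ V} {Q' : LinearMap.BilinForm ℚ W} {e : V ≃ₗ[ℚ] W}

theorem weylOrbit_map_iff (he : ∀ x y, Q' (e x) (e y) = Q x y) {ι : Type} (b : ι → V) (x : V) :
    WeylOrbit Q' (fun i => e (b i)) (e x) ↔ WeylOrbit Q b x := by
  constructor
  · intro h
    have key : ∀ y, WeylOrbit Q' (fun i => e (b i)) y → WeylOrbit Q b (e.symm y) := by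
      intro y hy
      induction hy with
      | simple i =>
        rw [LinearEquiv.symm_apply_apply]
        exact .simple i
      | reflect i y _ ih =>
        have := WeylOrbit.reflect i _ ih
        rw [← he, ← he, LinearEquiv.apply_symm_apply] at this
        rw [map_sub, map_smul, LinearEquiv.symm_apply_apply]
        exact this
    simpa using key _ h
  · intro h
    induction h with
    | simple i => exact WeylOrbit.simple (b := fun i => e (b i)) i
    | reflect i x _ ih =>
      have := WeylOrbit.reflect (b := fun i => e (b i)) i _ ih
      rw [he, he] at this
      rwa [map_sub, map_smul]

theorem IsOfFiniteType.map (he : ∀ x y, Q' (e x) (e y) = Q x y) {ι : Type} {G : Matrix ι ι ℚ}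
    {R : Set V} {R' : Set W} (hR : ∀ x, e x ∈ R' ↔ x ∈ R) (h : IsOfFiniteType Q R G) :
    IsOfFiniteType Q' R' G := by
  obtain ⟨b, hb, h⟩ := h
  refine ⟨fun i => e (b i), fun i j => by rw [he, hb], ?_⟩
  ext y
  obtain ⟨x, rfl⟩ := e.surjective y
  rw [hR, h]
  exact (weylOrbit_map_iff he b x).symm

theorem IsOfAffineType.map (he : ∀ x y, Q' (e x) (e y) = Q x y) {ι : Type} {G : Matrix ι ι ℚ}
    {R : Set V} {R' : Set W} (hR : ∀ x, e x ∈ R' ↔ x ∈ R) {δ : V}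
    (h : IsOfAffineType Q R δ G) : IsOfAffineType Q' R' (e δ) G := by
  obtain ⟨hδ, hδδ, b, hb, hδb, h⟩ := h
  refine ⟨fun h0 => hδ (e.map_eq_zero_iff.1 h0), by rw [he, hδδ],
    fun i => e (b i), fun i j => by rw [he, hb], fun i => by rw [he, hδb], ?_⟩
  ext y
  obtain ⟨x, rfl⟩ := e.surjective y
  rw [hR, h]
  constructor
  · rintro ⟨α, n, hα, rfl⟩
    exact ⟨e α, n, (weylOrbit_map_iff he b α).2 hα, by rw [map_add, map_zsmul]⟩
  · rintro ⟨α, n, hα, hx⟩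
    obtain ⟨α, rfl⟩ := e.surjective α
    refine ⟨α, n, (weylOrbit_map_iff he b α).1 hα, e.injective ?_⟩
    rw [hx, map_add, map_zsmul]

theorem HasFiniteType.map (he : ∀ x y, Q' (e x) (e y) = Q x y) {t : BoundaryType}
    {R : Set V} {R' : Set W} (hR : ∀ x, e x ∈ R' ↔ x ∈ R) (h : HasFiniteType Q R t) :
    HasFiniteType Q' R' t := by
  cases t <;> exact IsOfFiniteType.map he hR h

theorem HasAffineType.map (he : ∀ x y, Q' (e x) (e y) = Q x y) {t : BoundaryType}
    {R : Set V} {R' : Set W} (hR : ∀ x, e x ∈ R' ↔ x ∈ R) {δ : V} (h : HasAffineType Q R δ t) :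
    HasAffineType Q' R' (e δ) t := by
  cases t <;> exact IsOfAffineType.map he hR h

theorem mem_componentsWithoutShort_map (he : ∀ x y, Q' (e x) (e y) = Q x y)
    {R : Set V} {R' : Set W} (hR : ∀ x, e x ∈ R' ↔ x ∈ R) (x : V) :
    e x ∈ componentsWithoutShort Q' R' ↔ x ∈ componentsWithoutShort Q R := by
  have h1 : ∀ x y, Relation.ReflTransGen (fun a b => a ∈ R ∧ b ∈ R ∧ Q a b ≠ 0) x y →
      Relation.ReflTransGen (fun a b => a ∈ R' ∧ b ∈ R' ∧ Q' a b ≠ 0) (e x) (e y) := by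
    intro x y h
    induction h with
    | refl => exact .refl
    | tail _ hab ih => exact ih.tail (by rwa [hR, hR, he])
  have h2 : ∀ x y, Relation.ReflTransGen (fun a b => a ∈ R' ∧ b ∈ R' ∧ Q' a b ≠ 0) x y →
      Relation.ReflTransGen (fun a b => a ∈ R ∧ b ∈ R ∧ Q a b ≠ 0) (e.symm x) (e.symm y) := by
    intro x y h
    induction h with
    | refl => exact .refl
    | @tail a b _ hab ih =>
      refine ih.tail ?_
      rwa [← hR, ← hR, ← he, LinearEquiv.apply_symm_apply, LinearEquiv.apply_symm_apply]
  constructor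
  · rintro ⟨hx, h⟩
    refine ⟨(hR x).1 hx, fun y hy => ?_⟩
    rw [← he]
    exact h _ (h1 x y hy)
  · rintro ⟨hx, h⟩
    refine ⟨(hR x).2 hx, fun y hy => ?_⟩
    obtain ⟨y, rfl⟩ := e.surjective y
    rw [he]
    apply h
    simpa using h2 _ _ hy

variable {M N : Type*} [AddCommGroup M] [AddCommGroup N] {B : LinearMap.BilinForm ℤ M}
  {B' : LinearMap.BilinForm ℤ N}

/-- The rational isometry that extends an isometry of lattices. -/
noncomputable def rationalEquiv (g : M ≃ₗ[ℤ] N) : (ℚ ⊗[ℤ] M) ≃ₗ[ℚ] (ℚ ⊗[ℤ] N) :=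
  LinearEquiv.baseChange ℤ ℚ M N g

theorem rationalEquiv_toRational (g : M ≃ₗ[ℤ] N) (m : M) :
    rationalEquiv g (toRational m) = toRational (g m) := by
  simp [rationalEquiv, toRational]

theorem rationalForm_rationalEquiv (g : B.IsometryEquiv B') (x y : ℚ ⊗[ℤ] M) :
    rationalForm B' (rationalEquiv g.toLinearEquiv x) (rationalEquiv g.toLinearEquiv y) =
      rationalForm B x y := by
  obtain ⟨d, m, hd, hx⟩ := exists_smul_eq_toRational x
  obtain ⟨d', m', hd', hy⟩ := exists_smul_eq_toRational y
  have hd0 : (d : ℚ) ≠ 0 := by exact_mod_cast hd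
  have hd0' : (d' : ℚ) ≠ 0 := by exact_mod_cast hd'
  rw [← inv_smul_smul₀ hd0 x, ← inv_smul_smul₀ hd0' y, hx, hy]
  simp only [map_smul, LinearMap.smul_apply, rationalEquiv_toRational, rationalForm_toRational]
  congr 3
  exact_mod_cast g.map_app m' m

theorem mem_roots_rationalEquiv (g : B.IsometryEquiv B') (x : ℚ ⊗[ℤ] M) :
    rationalEquiv g.toLinearEquiv x ∈ roots B' ↔ x ∈ roots B := by
  have hd : rationalEquiv g.toLinearEquiv x ∈ dualLattice B' ↔ x ∈ dualLattice B := by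
    constructor
    · intro h m
      obtain ⟨n, hn⟩ := h (g m)
      refine ⟨n, ?_⟩
      rw [← hn, ← rationalForm_rationalEquiv g, rationalEquiv_toRational]
      rfl
    · intro h m
      obtain ⟨m, rfl⟩ := g.toLinearEquiv.surjective m
      obtain ⟨n, hn⟩ := h m
      exact ⟨n, by rw [← rationalEquiv_toRational, rationalForm_rationalEquiv, hn]⟩
  refine or_congr ⟨?_, ?_⟩ (and_congr hd (by rw [rationalForm_rationalEquiv]))
  · rintro ⟨m, hm, h⟩
    obtain ⟨m, rfl⟩ := g.toLinearEquiv.surjective m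
    rw [← rationalEquiv_toRational] at hm
    refine ⟨m, (rationalEquiv g.toLinearEquiv).injective hm, ?_⟩
    rw [← h]
    exact (g.map_app m m).symm
  · rintro ⟨m, rfl, h⟩
    exact ⟨g m, rationalEquiv_toRational _ _, by rw [g.map_app, h]⟩

theorem mem_rootsPerp_rationalEquiv (g : B.IsometryEquiv B') (v : M) (x : ℚ ⊗[ℤ] M) :
    rationalEquiv g.toLinearEquiv x ∈ rootsPerp B' (g v) ↔ x ∈ rootsPerp B v := by
  refine and_congr (mem_roots_rationalEquiv g x) ?_
  have : toRational (g v) = rationalEquiv g.toLinearEquiv (toRational v) :=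
    (rationalEquiv_toRational _ _).symm
  rw [this, rationalForm_rationalEquiv]

end Transport

/-! ### Orbits of primitive isotropic vectors of `Λ₁` -/

section FirstPart

theorem hasAffineType_map (g : form1.IsometryEquiv form1) {v : Lambda1} {t : BoundaryType}
    (h : HasAffineType (rationalForm form1) (rootsPerp form1 v) (toRational v) t) :
    HasAffineType (rationalForm form1) (rootsPerp form1 (g v)) (toRational (g v)) t := by
  have := HasAffineType.map (rationalForm_rationalEquiv g) (mem_rootsPerp_rationalEquiv g v) h
  rwa [rationalEquiv_toRational] at this

theorem symm_apply_eq {M N : Type*} [AddCommGroup M] [AddCommGroup N]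
    {B : LinearMap.BilinForm ℤ M} {B' : LinearMap.BilinForm ℤ N} (g : B.IsometryEquiv B')
    {v : M} {w : N} (h : g v = w) : g.symm w = v := by
  rw [← h]
  exact g.toLinearEquiv.symm_apply_apply v

theorem existsUnique_hasAffineType {v : Lambda1} (hv : IsPrimitiveVector v)
    (hv0 : form1 v v = 0) : ∃! t : BoundaryType,
      HasAffineType (rationalForm form1) (rootsPerp form1 v) (toRational v) t := by
  obtain ⟨t, g, hg⟩ := exists_isometry_cusp hv hv0
  have h := hasAffineType_map g.symm (hasAffineType_cusp t)
  rw [symm_apply_eq g hg] at h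
  exact ⟨t, h, fun s hs => hs.unique (rationalForm_comm form1_comm) h⟩

theorem exists_isometry_iff_hasAffineType {v w : Lambda1} (hv : IsPrimitiveVector v)
    (hv0 : form1 v v = 0) (hw : IsPrimitiveVector w) (hw0 : form1 w w = 0) :
    (∃ g : form1.IsometryEquiv form1, g v = w) ↔ ∀ t : BoundaryType,
      HasAffineType (rationalForm form1) (rootsPerp form1 v) (toRational v) t ↔
      HasAffineType (rationalForm form1) (rootsPerp form1 w) (toRational w) t := by
  constructor
  · rintro ⟨g, rfl⟩ t
    refine ⟨hasAffineType_map g, fun h => ?_⟩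
    have := hasAffineType_map g.symm h
    rwa [symm_apply_eq g rfl] at this
  · intro h
    obtain ⟨s, g, hg⟩ := exists_isometry_cusp hv hv0
    obtain ⟨t, g', hg'⟩ := exists_isometry_cusp hw hw0
    have h1 := hasAffineType_map g.symm (hasAffineType_cusp s)
    rw [symm_apply_eq g hg] at h1
    have h2 := hasAffineType_map g'.symm (hasAffineType_cusp t)
    rw [symm_apply_eq g' hg'] at h2
    have hst : s = t := ((h s).1 h1).unique (rationalForm_comm form1_comm) h2
    subst hst
    refine ⟨g.trans g'.symm, ?_⟩
    change g'.symm (g v) = w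
    rw [hg, symm_apply_eq g' hg']

end FirstPart

/-! ### Components without short roots -/

section Components

variable {V : Type*} [AddCommGroup V] [Module ℚ V] {Q : LinearMap.BilinForm ℚ V}

theorem reflect_apply_reflect (hQ : ∀ x y, Q x y = Q y x) {r : V} (hr : Q r r ≠ 0) (x y : V) :
    Q (x - (2 * Q x r / Q r r) • r) (y - (2 * Q y r / Q r r) • r) = Q x y := by
  simp only [map_sub, LinearMap.sub_apply, map_smul, LinearMap.smul_apply, smul_eq_mul, hQ r y]
  field_simp
  ring

theorem weylOrbit_apply_self (hQ : ∀ x y, Q x y = Q y x) {ι : Type} {b : ι → V} {c : ℚ}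
    (hc : c ≠ 0) (hb : ∀ i, Q (b i) (b i) = c) {x : V} (hx : WeylOrbit Q b x) : Q x x = c := by
  induction hx with
  | simple i => exact hb i
  | reflect i x _ ih => rw [reflect_apply_reflect hQ (by rwa [hb]), ih]

theorem weylOrbit_apply_eq_zero {ι : Type} {b : ι → V} {y : V} (h : ∀ i, Q (b i) y = 0) {x : V}
    (hx : WeylOrbit Q b x) : Q x y = 0 := by
  induction hx with
  | simple i => exact h i
  | reflect i x _ ih =>
    rw [map_sub, LinearMap.sub_apply, ih, map_smul, LinearMap.smul_apply, h, smul_zero, sub_zero]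

/-- Reflections in one orthogonal part fix the orbits of the other part pointwise, so no mixed
vectors arise. -/
theorem weylOrbit_iff_or (hQ : ∀ x y, Q x y = Q y x) {ι₁ ι₂ κ : Type} {b : κ → V} {e₁ : ι₁ → κ}
    {e₂ : ι₂ → κ} (he : ∀ k, (∃ i, e₁ i = k) ∨ ∃ j, e₂ j = k)
    (h : ∀ i j, Q (b (e₁ i)) (b (e₂ j)) = 0) (x : V) :
    WeylOrbit Q b x ↔
      WeylOrbit Q (fun i => b (e₁ i)) x ∨ WeylOrbit Q (fun j => b (e₂ j)) x := by
  constructor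
  · intro hx
    induction hx with
    | simple k =>
      rcases he k with ⟨i, rfl⟩ | ⟨j, rfl⟩
      · exact Or.inl (.simple (b := fun i => b (e₁ i)) i)
      · exact Or.inr (.simple (b := fun j => b (e₂ j)) j)
    | reflect k x _ ih =>
      rcases he k with ⟨i, rfl⟩ | ⟨j, rfl⟩ <;> rcases ih with ih | ih
      · exact Or.inl (.reflect (b := fun i => b (e₁ i)) i x ih)
      · rw [weylOrbit_apply_eq_zero (fun j => by rw [hQ, h]) ih]
        right
        simpa using ih
      · rw [weylOrbit_apply_eq_zero (fun i => h i j) ih]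
        left
        simpa using ih
      · exact Or.inr (.reflect (b := fun j => b (e₂ j)) j x ih)
  · rintro (hx | hx)
    · induction hx with
      | simple i => exact .simple _
      | reflect i x _ ih => exact .reflect _ x ih
    · induction hx with
      | simple i => exact .simple _
      | reflect i x _ ih => exact .reflect _ x ih

/-- A simple root is short or meets a short simple root. For other roots the whole chain to a short
root is carried along by the reflections, which preserve products and norms. -/
theorem exists_short_of_weylOrbit (hQ : ∀ x y, Q x y = Q y x) {ι : Type} {b : ι → V}
    (hb : ∀ i, Q (b i) (b i) ≠ 0)
    (hs : ∀ i, ∃ j, Q (b j) (b j) = 2 / 3 ∧ (i = j ∨ Q (b i) (b j) ≠ 0)) {x : V}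
    (hx : WeylOrbit Q b x) : ∃ y, Relation.ReflTransGen
      (fun u v => WeylOrbit Q b u ∧ WeylOrbit Q b v ∧ Q u v ≠ 0) x y ∧ Q y y = 2 / 3 := by
  induction hx with
  | simple i =>
    obtain ⟨j, hj, rfl | h⟩ := hs i
    · exact ⟨_, .refl, hj⟩
    · exact ⟨_, .single ⟨.simple i, .simple j, h⟩, hj⟩
  | reflect i x _ ih =>
    obtain ⟨y, hxy, hy⟩ := ih
    refine ⟨y - (2 * Q y (b i) / Q (b i) (b i)) • b i, ?_, ?_⟩
    · clear hy
      induction hxy with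
      | refl => exact .refl
      | tail _ huv ih =>
        refine ih.tail ⟨.reflect i _ huv.1, .reflect i _ huv.2.1, ?_⟩
        rw [reflect_apply_reflect hQ (hb i)]
        exact huv.2.2
    · rw [reflect_apply_reflect hQ (hb i), hy]

/-- The components without short roots of a root system that is the orthogonal sum of a system
of roots of square norm `2` and a system all of whose components contain short roots. -/
theorem componentsWithoutShort_eq (hQ : ∀ x y, Q x y = Q y x) {ι₁ ι₂ κ : Type} {b : κ → V}
    {e₁ : ι₁ → κ} {e₂ : ι₂ → κ} (he : ∀ k, (∃ i, e₁ i = k) ∨ ∃ j, e₂ j = k)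
    (h : ∀ i j, Q (b (e₁ i)) (b (e₂ j)) = 0) (h₁ : ∀ i, Q (b (e₁ i)) (b (e₁ i)) = 2)
    (h₂ : ∀ j, Q (b (e₂ j)) (b (e₂ j)) ≠ 0)
    (hs : ∀ i, ∃ j, Q (b (e₂ j)) (b (e₂ j)) = 2 / 3 ∧ (i = j ∨ Q (b (e₂ i)) (b (e₂ j)) ≠ 0)) :
    componentsWithoutShort Q {x | WeylOrbit Q b x} =
      {x | WeylOrbit Q (fun i => b (e₁ i)) x} := by
  have hor := weylOrbit_iff_or hQ he h
  ext x
  simp only [componentsWithoutShort, Set.mem_ofPred_eq]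
  constructor
  · rintro ⟨hx, hns⟩
    rcases (hor x).1 hx with hx | hx
    · exact hx
    · obtain ⟨y, hxy, hy⟩ := exists_short_of_weylOrbit hQ h₂ hs hx
      refine absurd hy (hns y ?_)
      refine Relation.ReflTransGen.mono (fun u v huv => ?_) _ _ hxy
      exact ⟨(hor u).2 (.inr huv.1), (hor v).2 (.inr huv.2.1), huv.2.2⟩
  · intro hx
    refine ⟨(hor x).2 (.inl hx), fun y hy => ?_⟩
    -- A chain that starts in the first part cannot leave it, because the second part is orthogonal
    -- to it; and all norms in the first part are `2`.
    have hy' : WeylOrbit Q (fun i => b (e₁ i)) y := by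
      induction hy with
      | refl => exact hx
      | @tail u v _ huv ih =>
        rcases (hor v).1 huv.2.1 with hv | hv
        · exact hv
        · refine absurd ?_ huv.2.2
          refine weylOrbit_apply_eq_zero (fun i => ?_) ih
          rw [hQ]
          exact weylOrbit_apply_eq_zero (fun j => by rw [hQ, h]) hv
    rw [weylOrbit_apply_self hQ two_ne_zero h₁ hy']
    norm_num

end Components

/-! ### Finite root systems: the case of nil vector `0` -/

section FiniteType

variable {M : Type*} [AddCommGroup M] {B : LinearMap.BilinForm ℤ M} {n : ℕ} {D : RootDatum n}
  {β : Fin n → M}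

theorem roots_eq_of_isRootBasis (hB : ∀ x y, B x y = B y x) (hD : D.IsValid)
    (hβ : IsRootBasis B 0 D β) :
    roots B = {x | WeylOrbit (rationalForm B) (rootBasis D β) x} := by
  have h := rootsPerp_eq hB hD hβ
  simp only [rootsPerp, toRational_zero, smul_zero, add_zero, map_zero, and_true,
    exists_and_left, exists_const] at h
  ext x
  have := Set.ext_iff.1 h x
  simpa using this

/-- A root basis spans rationally and its Gram matrix is positive definite. Absence of torsion
ensures that a nonzero vector has nonzero coordinates. -/
theorem apply_self_pos_of_isRootBasis (hD : D.IsValid) (hβ : IsRootBasis B 0 D β)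
    (hM : ∀ (d : ℤ) (x : M), d ≠ 0 → d • x = 0 → x = 0) {x : M} (hx : x ≠ 0) : 0 < B x x := by
  obtain ⟨d, hd, a, c, h⟩ := hβ.span x (by simp)
  rw [smul_zero, add_zero] at h
  have ha : (fun i => (a i : ℚ)) ≠ 0 := by
    intro ha
    refine hx (hM d x hd ?_)
    rw [h]
    refine Finset.sum_eq_zero fun i _ => ?_
    have : (a i : ℚ) = 0 := congrFun ha i
    rw [Int.cast_eq_zero.1 this, zero_smul]
  have h1 := hD.gram_pos ha
  have h2 : d * d * B x x = ∑ i, ∑ j, a i * (D.div i * D.cartan i j) * a j := by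
    have : d * d * B x x = B (d • x) (d • x) := by
      simp only [map_smul, LinearMap.smul_apply, smul_eq_mul]
      ring
    rw [this, h]
    simp only [map_sum, LinearMap.sum_apply, map_smul, LinearMap.smul_apply, hβ.gram, smul_eq_mul,
      Finset.mul_sum]
    rw [Finset.sum_comm]
    refine Finset.sum_congr rfl fun i _ => Finset.sum_congr rfl fun j _ => ?_
    ring
  have h3 : 0 < d * d * B x x := by
    rw [h2]
    exact_mod_cast h1
  exact pos_of_mul_pos_right h3 (mul_self_nonneg d)

end FiniteType

section FiniteCuspTypes

variable {M : Type*} [AddCommGroup M] {B : LinearMap.BilinForm ℤ M}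

/-- `e₁` numbers the vertices of the components that survive, and `e₂` those of the components with
short roots. All hypotheses concern the explicit matrix `cuspGram`, so they are finite checks. -/
theorem isOfFiniteType_of_isRootBasis (hB : ∀ x y, B x y = B y x) {t : BoundaryType}
    {β : Fin 18 → M} (hβ : IsRootBasis B 0 (cuspDatum t) β) {ι₁ ι₂ : Type} {e₁ : ι₁ → Fin 18}
    {e₂ : ι₂ → Fin 18} (he : ∀ k, (∃ i, e₁ i = k) ∨ ∃ j, e₂ j = k)
    (h : ∀ p : ι₁ × ι₂, cuspGram t (e₁ p.1) (e₂ p.2) = 0)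
    (h₁ : ∀ i, cuspGram t (e₁ i) (e₁ i) = 2) (h₂ : ∀ j, cuspGram t (e₂ j) (e₂ j) ≠ 0)
    (hs : ∀ i, ∃ j, cuspGram t (e₂ j) (e₂ j) = 2 / 3 ∧ (i = j ∨ cuspGram t (e₂ i) (e₂ j) ≠ 0))
    {G : Matrix ι₁ ι₁ ℚ} (hG : ∀ p : ι₁ × ι₁, cuspGram t (e₁ p.1) (e₁ p.2) = G p.1 p.2) :
    IsOfFiniteType (rationalForm B) (componentsWithoutShort (rationalForm B) (roots B)) G := by
  have hD := isValid_cuspDatum t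
  have hb : ∀ i j, rationalForm B (rootBasis (cuspDatum t) β i) (rootBasis (cuspDatum t) β j) =
      cuspGram t i j := rationalForm_rootBasis hD hβ
  refine ⟨fun i => rootBasis (cuspDatum t) β (e₁ i), fun i j => (hb _ _).trans (hG (i, j)), ?_⟩
  rw [roots_eq_of_isRootBasis hB hD hβ]
  refine componentsWithoutShort_eq (rationalForm_comm hB) he (fun i j => (hb _ _).trans (h (i, j)))
    (fun i => (hb _ _).trans (h₁ i)) (fun j => ?_) fun i => ?_
  · rw [hb]
    exact h₂ j
  · obtain ⟨j, hj⟩ := hs i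
    exact ⟨j, by rwa [hb, hb]⟩

/-- The last `k` vertices of the diagram. -/
def lastVertices (k : ℕ) (h : k ≤ 18) (i : Fin k) : Fin 18 := ⟨18 - k + i, by omega⟩

/-- The first `a + b` vertices of the diagram. -/
def firstVertices (a b : ℕ) (h : a + b ≤ 18) : Fin a ⊕ Fin b → Fin 18 :=
  Sum.elim (fun i => ⟨i, by omega⟩) (fun i => ⟨a + i, by omega⟩)

theorem hasFiniteType_of_isRootBasis (hB : ∀ x y, B x y = B y x) {t : BoundaryType}
    {β : Fin 18 → M} (hβ : IsRootBasis B 0 (cuspDatum t) β) :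
    HasFiniteType (rationalForm B) (componentsWithoutShort (rationalForm B) (roots B)) t := by
  cases t
  · exact isOfFiniteType_of_isRootBasis hB hβ (e₁ := firstVertices 8 8 (by norm_num))
      (e₂ := lastVertices 2 (by norm_num)) (by decide +kernel) (by decide +kernel)
      (by decide +kernel) (by decide +kernel) (by decide +kernel) (by decide +kernel)
  · exact isOfFiniteType_of_isRootBasis hB hβ (e₁ := Fin.castLE (by norm_num))
      (e₂ := lastVertices 2 (by norm_num)) (by decide +kernel) (by decide +kernel)
      (by decide +kernel) (by decide +kernel) (by decide +kernel) (by decide +kernel)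
  · exact isOfFiniteType_of_isRootBasis hB hβ (e₁ := Fin.castLE (by norm_num))
      (e₂ := lastVertices 1 (by norm_num)) (by decide +kernel) (by decide +kernel)
      (by decide +kernel) (by decide +kernel) (by decide +kernel) (by decide +kernel)
  · exact isOfFiniteType_of_isRootBasis hB hβ (e₁ := firstVertices 7 10 (by norm_num))
      (e₂ := lastVertices 1 (by norm_num)) (by decide +kernel) (by decide +kernel)
      (by decide +kernel) (by decide +kernel) (by decide +kernel) (by decide +kernel)
  -- There are no short simple roots for this type or the next one, so the second family of vertices
  -- is empty.
  · exact isOfFiniteType_of_isRootBasis hB hβ (e₁ := indexThree 6 6 6 rfl)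
      (e₂ := lastVertices 0 (by norm_num)) (by decide +kernel) (by decide +kernel)
      (by decide +kernel) (by decide +kernel) (by decide +kernel) (by decide +kernel)
  · exact isOfFiniteType_of_isRootBasis hB hβ (e₁ := indexTwo 7 11 rfl)
      (e₂ := lastVertices 0 (by norm_num)) (by decide +kernel) (by decide +kernel)
      (by decide +kernel) (by decide +kernel) (by decide +kernel) (by decide +kernel)

end FiniteCuspTypes

/-! ### Coordinates on `Λ` adapted to `U ⊥ Λ₁` and `η` -/

section Coordinates

/-- The coefficients at the simple roots of `A₂` in `Λ₁`. -/
abbrev aZero (y : Lambda1) : ℤ := y (Sum.inr (Sum.inr (Sum.inl 0)))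
/-- The coefficients at the simple roots of `A₂` in `Λ₁`. -/
abbrev aOne (y : Lambda1) : ℤ := y (Sum.inr (Sum.inr (Sum.inl 1)))

/-- The vector of `Λ = U ⊥ (2E₈ ⊥ U ⊥ 3I)` with coefficients `a` and `b` at the basis of `U`, whose
component in `2E₈ ⊥ U ⊥ 3I` is the sum of `y`, a vector of `Λ₁ = 2E₈ ⊥ U ⊥ A₂`, and the `s`-fold
multiple of the first basis vector of `3I`. -/
def point (y : Lambda1) (a b s : ℤ) : Lambda :=
  Sum.elim (fun i => y (Sum.inl i)) (Sum.elim (fun i => y (Sum.inr (Sum.inl i)))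
    (Sum.elim ![a, b] (Sum.elim (fun i => y (Sum.inr (Sum.inr (Sum.inr i))))
      ![aZero y + s, aOne y - aZero y, -aOne y])))

/-- The component in `Λ₁` of a vector of `Λ`. -/
def pointFst (x : Lambda) : Lambda1 :=
  Sum.elim (fun i => x (Sum.inl i)) (Sum.elim (fun i => x (Sum.inr (Sum.inl i)))
    (Sum.elim ![-x (Sum.inr (Sum.inr (Sum.inr (Sum.inr 1)))) -
        x (Sum.inr (Sum.inr (Sum.inr (Sum.inr 2)))),
      -x (Sum.inr (Sum.inr (Sum.inr (Sum.inr 2))))]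
      (fun i => x (Sum.inr (Sum.inr (Sum.inr (Sum.inl i)))))))

/-- The coordinates on `Λ` given by `point`. -/
def pointEquiv : (Lambda1 × ℤ × ℤ × ℤ) ≃ₗ[ℤ] Lambda where
  toFun p := point p.1 p.2.1 p.2.2.1 p.2.2.2
  map_add' p q := by
    funext i
    rcases i with i | i | i | i | i
    · rfl
    · rfl
    · fin_cases i <;> rfl
    · rfl
    · fin_cases i <;> simp [point] <;> ring
  map_smul' c p := by
    funext i
    rcases i with i | i | i | i | i
    · rfl
    · rfl
    · fin_cases i <;> rfl
    · rfl
    · fin_cases i <;> simp [point] <;> ring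
  invFun x := (pointFst x, x (Sum.inr (Sum.inr (Sum.inl 0))), x (Sum.inr (Sum.inr (Sum.inl 1))),
    x (Sum.inr (Sum.inr (Sum.inr (Sum.inr 0)))) + x (Sum.inr (Sum.inr (Sum.inr (Sum.inr 1)))) +
      x (Sum.inr (Sum.inr (Sum.inr (Sum.inr 2)))))
  left_inv p := by
    obtain ⟨y, a, b, s⟩ := p
    refine Prod.ext ?_ (Prod.ext rfl (Prod.ext rfl ?_))
    · funext i
      rcases i with i | i | i | i
      · rfl
      · rfl
      · fin_cases i <;> simp [point, pointFst]
      · rfl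
    · simp [point]
      ring
  right_inv x := by
    funext i
    rcases i with i | i | i | i | i
    · rfl
    · rfl
    · fin_cases i <;> rfl
    · rfl
    · fin_cases i <;> simp [point, pointFst]
      ring

theorem exists_eq_point (x : Lambda) : ∃ y a b s, x = point y a b s :=
  ⟨_, _, _, _, (pointEquiv.apply_symm_apply x).symm⟩

theorem point_add (y y' : Lambda1) (a b s a' b' s' : ℤ) :
    point y a b s + point y' a' b' s' = point (y + y') (a + a') (b + b') (s + s') :=
  (pointEquiv.map_add (y, a, b, s) (y', a', b', s')).symm

theorem point_sub (y y' : Lambda1) (a b s a' b' s' : ℤ) :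
    point y a b s - point y' a' b' s' = point (y - y') (a - a') (b - b') (s - s') :=
  (pointEquiv.map_sub (y, a, b, s) (y', a', b', s')).symm

theorem smul_point (c : ℤ) (y : Lambda1) (a b s : ℤ) :
    c • point y a b s = point (c • y) (c * a) (c * b) (c * s) :=
  (pointEquiv.map_smul c (y, a, b, s)).symm

theorem point_zero : point 0 0 0 0 = 0 := pointEquiv.map_zero

theorem point_inj {y y' : Lambda1} {a b s a' b' s' : ℤ} (h : point y a b s = point y' a' b' s') :
    y = y' ∧ a = a' ∧ b = b' ∧ s = s' := by
  have := pointEquiv.injective (a₁ := (y, a, b, s)) (a₂ := (y', a', b', s')) h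
  simpa using this

/-- The coordinate `s` counts the first generator of `3I`, whose product with the `A₂`-part of `y`
is `aZero y`; this is the only interaction between `s` and `Λ₁`. -/
theorem form_point (y y' : Lambda1) (a b s a' b' s' : ℤ) :
    form (point y a b s) (point y' a' b' s') =
      form1 y y' + (a * b' + b * a') + (s * aZero y' + s' * aZero y + s * s') := by
  rw [form1_eq, formN_apply, form, gramLambda, toBilin'_orthSum, toBilin'_orthSum,
    toBilin'_orthSum, toBilin'_orthSum, formU_apply, formU_apply, formA2_apply]
  simp only [point, Sum.elim_inl, Sum.elim_inr, Matrix.toBilin'_apply, Fin.sum_univ_three]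
  simp
  ring

/-- The vector of `A₂ ⊆ Λ₁` whose product with `y` is three times `aZero y`. -/
def glue : Lambda1 := Sum.elim 0 (Sum.elim 0 (Sum.elim ![2, 1] 0))

theorem form1_glue (y : Lambda1) : form1 glue y = 3 * aZero y := by
  rw [form1_eq, formN_apply, formA2_apply]
  have e1 : (fun i => glue (Sum.inl i)) = 0 := rfl
  have e2 : (fun i => glue (Sum.inr (Sum.inl i))) = 0 := rfl
  rw [e1, e2, map_zero, LinearMap.zero_apply, LinearMap.zero_apply]
  simp [glue]
  ring

/-- Three times the first generator of `3I` differs from `η` by the vector `glue` of `A₂`: this is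
the gluing of `A₂` to `ℤη` inside `3I`. -/
theorem eta_eq : eta = point (-glue) 0 0 3 := by
  funext i
  rcases i with i | i | i | i | i
  · simp [eta, point, glue]
  · simp [eta, point, glue]
  · fin_cases i <;> rfl
  · simp [eta, point, glue]
  · fin_cases i <;> simp [eta, point, glue]

/-- Hence `Λ_o` is the hyperplane `s = 0`, that is, `U ⊥ Λ₁`. -/
theorem form_point_eta (y : Lambda1) (a b s : ℤ) : form (point y a b s) eta = s := by
  rw [eta_eq, form_point, map_neg, form1_comm, form1_glue]
  simp [glue]
  ring

theorem mem_LambdaO {x : Lambda} : x ∈ LambdaO ↔ form x eta = 0 := by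
  rw [LambdaO, LinearMap.BilinForm.mem_orthogonal_iff]
  constructor
  · intro h
    rw [form_comm]
    exact h eta (Submodule.mem_span_singleton_self _)
  · intro h z hz
    obtain ⟨c, rfl⟩ := Submodule.mem_span_singleton.1 hz
    change form (c • eta) x = 0
    rw [map_smul, LinearMap.smul_apply, form_comm, h, smul_zero]

theorem point_mem_LambdaO (y : Lambda1) (a b : ℤ) : point y a b 0 ∈ LambdaO :=
  mem_LambdaO.2 (form_point_eta y a b 0)

theorem exists_eq_point_of_mem {x : Lambda} (hx : x ∈ LambdaO) : ∃ y a b, x = point y a b 0 := by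
  obtain ⟨y, a, b, s, rfl⟩ := exists_eq_point x
  rw [mem_LambdaO, form_point_eta] at hx
  exact ⟨y, a, b, by rw [hx]⟩

end Coordinates

/-! ### Planes spanned by `e` and a vector of `Λ₁`, and their quotients -/

section StandardPlane

/-- The embedding of `Λ₁` in `Λ_o`. -/
noncomputable def embed (y : Lambda1) : LambdaO := ⟨point y 0 0 0, point_mem_LambdaO y 0 0⟩

/-- The first basis vector of the first hyperbolic plane. -/
noncomputable def vecE : LambdaO := ⟨point 0 1 0 0, point_mem_LambdaO 0 1 0⟩

/-- The sublattice spanned by the first basis vector of the first hyperbolic plane and a vector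
of `Λ₁`. -/
noncomputable def plane (w : Lambda1) : Submodule ℤ LambdaO :=
  Submodule.span ℤ (Set.range ![vecE, embed w])

theorem smul_vecE_add_smul_embed (a c : ℤ) (w : Lambda1) :
    ((a • vecE + c • embed w : LambdaO) : Lambda) = point (c • w) a 0 0 := by
  change a • point 0 1 0 0 + c • point w 0 0 0 = _
  rw [smul_point, smul_point, point_add]
  simp

theorem mem_plane {w : Lambda1} {x : LambdaO} :
    x ∈ plane w ↔ ∃ a c : ℤ, (x : Lambda) = point (c • w) a 0 0 := by
  rw [plane, Matrix.range_cons, Matrix.range_cons, Matrix.range_empty, Set.union_empty,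
    Set.singleton_union, Submodule.mem_span_pair]
  refine exists_congr fun a => exists_congr fun c => ?_
  rw [← smul_vecE_add_smul_embed, Subtype.ext_iff]
  exact eq_comm

theorem formO_apply (x y : LambdaO) : formO x y = form x y := rfl

theorem isPrimitiveIsotropicPlane_plane {w : Lambda1} (hw : IsPrimitiveVector w)
    (hw0 : form1 w w = 0) : IsPrimitiveIsotropicPlane formO (plane w) where
  primitive n x hn hx := by
    obtain ⟨a, c, h⟩ := mem_plane.1 hx
    obtain ⟨y, a', b', hy⟩ := exists_eq_point_of_mem x.2
    have h1 : (n • x : LambdaO) = n • (x : Lambda) := rfl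
    rw [h1, hy, smul_point] at h
    obtain ⟨h2, h3, h4, -⟩ := point_inj h
    have hb : b' = 0 := (mul_eq_zero.1 h4).resolve_left hn
    -- After division by the greatest common divisor, `n'` divides the primitive vector `w`, so it
    -- is a unit.
    obtain ⟨g, n', c', hg, hc, rfl, rfl⟩ := Int.exists_gcd_one' (m := n) (n := c)
      (Int.gcd_pos_of_ne_zero_left c hn)
    have hg0 : (g : ℤ) ≠ 0 := by positivity
    have h5 : n' • y = c' • w := by
      have : (g : ℤ) • (n' • y - c' • w) = 0 := by
        rw [smul_sub, smul_smul, smul_smul, mul_comm _ n', mul_comm _ c', h2, sub_self]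
      rcases smul_eq_zero.1 this with h0 | h0
      · exact absurd h0 hg0
      · exact sub_eq_zero.1 h0
    have hco : IsCoprime n' c' := Int.isCoprime_iff_gcd_eq_one.2 hc
    have hn' : IsUnit n' := by
      obtain ⟨z, hz⟩ := exists_smul_of_dvd (x := w) (n := n') fun i =>
        hco.dvd_of_dvd_mul_left ⟨y i, (congrFun h5 i).symm⟩
      exact hw _ _ hz
    refine mem_plane.2 ⟨a', n' * c', ?_⟩
    rw [hy, hb, mul_smul, ← h5, smul_smul]
    rcases Int.isUnit_iff.1 hn' with rfl | rfl <;> simp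
  isotropic x hx y hy := by
    obtain ⟨a, c, h⟩ := mem_plane.1 hx
    obtain ⟨a', c', h'⟩ := mem_plane.1 hy
    rw [formO_apply, h, h', form_point, map_smul, map_smul, LinearMap.smul_apply, hw0]
    simp
  rank_two := by
    rw [plane, finrank_span_eq_card, Fintype.card_fin]
    rw [LinearIndependent.pair_iff]
    intro a c h
    have h1 := smul_vecE_add_smul_embed a c w
    rw [h] at h1
    obtain ⟨h2, h3, -, -⟩ := point_inj (point_zero.trans h1)
    exact ⟨h3.symm, (smul_eq_zero.1 h2.symm).resolve_right hw.ne_zero⟩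

/-- The vectors of the orthogonal complement of the standard plane. -/
theorem mem_orthogonal_plane {w : Lambda1} {x : LambdaO} :
    x ∈ formO.orthogonal (plane w) ↔
      ∃ (y : Lambda1) (a : ℤ), form1 y w = 0 ∧ (x : Lambda) = point y a 0 0 := by
  rw [LinearMap.BilinForm.mem_orthogonal_iff]
  obtain ⟨y, a, b, hy⟩ := exists_eq_point_of_mem x.2
  constructor
  · intro h
    have h1 : form (point 0 1 0 0) x = 0 := h vecE (mem_plane.2 ⟨1, 0, by simp [vecE]⟩)
    have h2 : form (point w 0 0 0) x = 0 := h (embed w) (mem_plane.2 ⟨0, 1, by simp [embed]⟩)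
    rw [hy, form_point] at h1 h2
    simp at h1 h2
    exact ⟨y, a, by rw [form1_comm, h2], by rw [hy, h1]⟩
  · rintro ⟨y, a, h0, h⟩ z hz
    obtain ⟨a', c, hz⟩ := mem_plane.1 hz
    change form z x = 0
    rw [h, hz, form_point, map_smul, LinearMap.smul_apply, form1_comm, h0]
    simp

/-- The class in `K^⊥ / K` of a vector of `Λ₁`, for the standard plane `K`. -/
noncomputable def planeClass (w : Lambda1) (y : Lambda1) (h : form1 y w = 0) :
    PerpQuot formO (plane w) :=
  Submodule.Quotient.mk ⟨embed y, mem_orthogonal_plane.2 ⟨y, 0, h, rfl⟩⟩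

theorem exists_eq_planeClass {w : Lambda1} (x : PerpQuot formO (plane w)) :
    ∃ y h, x = planeClass w y h := by
  obtain ⟨⟨x, hx⟩, rfl⟩ := Submodule.Quotient.mk_surjective _ x
  obtain ⟨y, a, h, hxy⟩ := mem_orthogonal_plane.1 hx
  refine ⟨y, h, (Submodule.Quotient.eq _).2 (mem_plane.2 ⟨a, 0, ?_⟩)⟩
  change (x : Lambda) - point y 0 0 0 = _
  rw [hxy, point_sub]
  simp

theorem quotForm_planeClass {w y z : Lambda1} (hy : form1 y w = 0) (hz : form1 z w = 0) :
    quotForm (plane w) (planeClass w y hy) (planeClass w z hz) = form1 y z := by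
  rw [quotForm, planeClass, planeClass, perpQuotForm_mk]
  change form (point y 0 0 0) (point z 0 0 0) = _
  rw [form_point]
  simp

theorem planeClass_eq_zero {w y : Lambda1} (h : form1 y w = 0) :
    planeClass w y h = 0 ↔ ∃ c : ℤ, y = c • w := by
  rw [planeClass, Submodule.Quotient.mk_eq_zero]
  refine (mem_plane (x := embed y)).trans ⟨?_, ?_⟩
  · rintro ⟨a, c, hc⟩
    exact ⟨c, (point_inj hc).1⟩
  · rintro ⟨c, rfl⟩
    exact ⟨0, c, rfl⟩

/-- The projection from the orthogonal complement of `w` to `K^⊥ / K`, for the standard plane `K`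
that contains `w`. -/
noncomputable def planeProj (w : Lambda1) :
    ↥(LinearMap.ker (form1.flip w)) →ₗ[ℤ] PerpQuot formO (plane w) where
  toFun y := planeClass w y.1 y.2
  map_add' y z := congrArg Submodule.Quotient.mk
    (Subtype.ext (Subtype.ext (point_add y.1 z.1 0 0 0 0 0 0).symm))
  map_smul' c y := congrArg Submodule.Quotient.mk
    (Subtype.ext (Subtype.ext (by
      change point (c • y.1) 0 0 0 = c • point y.1 0 0 0
      rw [smul_point, mul_zero])))

theorem eq_zero_of_smul_eq_zero {w : Lambda1} (hw : IsPrimitiveVector w) (hw0 : form1 w w = 0)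
    (d : ℤ) (x : PerpQuot formO (plane w)) (hd : d ≠ 0) (h : d • x = 0) : x = 0 := by
  obtain ⟨x, rfl⟩ := Submodule.Quotient.mk_surjective _ x
  rw [← Submodule.Quotient.mk_smul, Submodule.Quotient.mk_eq_zero] at h
  exact (Submodule.Quotient.mk_eq_zero _).2
    ((isPrimitiveIsotropicPlane_plane hw hw0).primitive d x.1 hd h)

theorem even_quotForm_plane {w : Lambda1} (x : PerpQuot formO (plane w)) :
    Even (quotForm (plane w) x x) := by
  obtain ⟨y, h, rfl⟩ := exists_eq_planeClass x
  rw [quotForm_planeClass]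
  exact form1_even y

/-- For this plane the quotient `K^⊥ / K` is `cusp^⊥ / cusp`, so the affine root basis descends with
nil vector `0`. -/
theorem isRootBasis_planeClass (t : BoundaryType) :
    IsRootBasis (quotForm (plane (cusp t))) 0 (cuspDatum t)
      fun i => planeClass (cusp t) (cuspBasis t i) ((isRootBasis_cuspBasis t).perp i) where
  gram i j := by
    rw [quotForm_planeClass]
    exact (isRootBasis_cuspBasis t).gram i j
  dvd i x := by
    obtain ⟨y, h, rfl⟩ := exists_eq_planeClass x
    rw [quotForm_planeClass]
    exact (isRootBasis_cuspBasis t).dvd i y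
  perp i := map_zero _
  isotropic := map_zero _
  unimodular := Or.inl rfl
  span x _ := by
    obtain ⟨y, h, rfl⟩ := exists_eq_planeClass x
    obtain ⟨d, hd, a, c, hs⟩ := (isRootBasis_cuspBasis t).span y h
    refine ⟨d, hd, a, 0, ?_⟩
    have hp := fun i => (isRootBasis_cuspBasis t).perp i
    have e : (d • ⟨y, h⟩ : ↥(LinearMap.ker (form1.flip (cusp t)))) =
        ∑ i, a i • ⟨cuspBasis t i, hp i⟩ + c • ⟨cusp t, form1_cusp t⟩ := by
      refine Subtype.ext ?_
      simpa using hs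
    have e' := congrArg (planeProj (cusp t)) e
    simp only [map_add, map_smul, map_sum] at e'
    have h0 : planeProj (cusp t) ⟨cusp t, form1_cusp t⟩ = 0 :=
      (planeClass_eq_zero (form1_cusp t)).2 ⟨1, (one_smul _ _).symm⟩
    rw [h0, smul_zero] at e'
    rw [smul_zero]
    exact e'

end StandardPlane

/-! ### Divisibility in `Λ₁` -/

section Divisibility

/-- The vectors of `A₂`, in `Λ₁`. -/
def vecA (α β : ℤ) : Lambda1 := Sum.elim 0 (Sum.elim 0 (Sum.elim ![α, β] 0))

theorem form1_vecA (y : Lambda1) (α β : ℤ) :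
    form1 y (vecA α β) = aZero y * (2 * α - β) + aOne y * (2 * β - α) := by
  rw [form1_eq, formN_apply, formA2_apply]
  have e1 : (fun i => vecA α β (Sum.inl i)) = 0 := rfl
  have e2 : (fun i => vecA α β (Sum.inr (Sum.inl i))) = 0 := rfl
  rw [e1, e2, map_zero, map_zero]
  simp [vecA]

theorem dvd_of_dvd_mulVec {n : ℕ} {A : Matrix (Fin n) (Fin n) ℤ} (hA : IsUnit A.det) {b : ℤ}
    {y : Fin n → ℤ} (h : ∀ i, b ∣ A.mulVec y i) : ∃ z, y = b • z := by
  obtain ⟨p, hp⟩ := exists_smul_of_dvd h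
  refine ⟨A⁻¹.mulVec p, ?_⟩
  rw [← Matrix.mulVec_smul, ← hp, Matrix.mulVec_mulVec, Matrix.nonsing_inv_mul A hA,
    Matrix.one_mulVec]

/-- The summands `2E₈` and `U` are unimodular, so divisibility of products by `b` means divisibility
of the component. Only `A₂`, of discriminant `3`, can obstruct. -/
theorem exists_eq_smul_add_vecA {y : Lambda1} {b : ℤ} (h : ∀ z, b ∣ form1 y z) :
    ∃ (ν : Lambda1) (α β : ℤ), aZero ν = 0 ∧ aOne ν = 0 ∧ b ∣ 2 * α - β ∧ b ∣ 2 * β - α ∧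
      y = b • ν + vecA α β := by
  have hs : ∀ i, b ∣ (CartanMatrix.E₈ ⊥ₗ CartanMatrix.E₈ ⊥ₗ CartanMatrix.A 2 ⊥ₗ gramU).mulVec
      y i := by
    intro i
    have := h (Pi.single i 1)
    rwa [form1_comm, form1, Matrix.toBilin'_apply', single_one_dotProduct] at this
  have hE : IsUnit CartanMatrix.E₈.det := by
    rw [CartanMatrix.E₈_det]
    exact isUnit_one
  obtain ⟨z1, h1⟩ := dvd_of_dvd_mulVec hE (y := fun i => y (Sum.inl i)) (b := b) fun i => by
    simpa [orthSum, Matrix.fromBlocks_mulVec, Function.comp_def] using hs (Sum.inl i)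
  obtain ⟨z2, h2⟩ := dvd_of_dvd_mulVec hE (y := fun i => y (Sum.inr (Sum.inl i))) (b := b)
    fun i => by
      simpa [orthSum, Matrix.fromBlocks_mulVec, Function.comp_def] using hs (Sum.inr (Sum.inl i))
  obtain ⟨c, hc⟩ := h (Sum.elim 0 (Sum.elim 0 (Sum.elim 0 ![0, 1])))
  obtain ⟨d, hd⟩ := h (Sum.elim 0 (Sum.elim 0 (Sum.elim 0 ![1, 0])))
  have h3 := h (vecA 1 0)
  have h4 := h (vecA 0 1)
  rw [form1_vecA] at h3 h4
  rw [form1_eq, formN_apply] at hc hd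
  simp only [Sum.elim_inl, Sum.elim_inr] at hc hd
  refine ⟨Sum.elim z1 (Sum.elim z2 (Sum.elim 0 ![c, d])), aZero y, aOne y, rfl, rfl, ?_, ?_, ?_⟩
  · convert h3 using 1
    ring
  · convert h4 using 1
    ring
  · have e0 : (fun i : Fin 8 => (0 : Fin 8 → ℤ) i) = 0 := rfl
    have e1 : (fun i : Fin 2 => (0 : Fin 2 → ℤ) i) = 0 := rfl
    rw [e0, e1, map_zero, map_zero, map_zero] at hc hd
    funext i
    rcases i with i | i | i | i
    · simpa [vecA] using congrFun h1 i
    · simpa [vecA] using congrFun h2 i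
    · fin_cases i <;> simp [vecA]
    · fin_cases i
      · simpa [vecA] using hc
      · simpa [vecA] using hd

/-- A vector is divisible by `b` if its products are divisible by `b` and its square norm is
divisible by `2 b²`. -/
theorem exists_eq_smul_of_dvd {y : Lambda1} {b : ℤ} (h : ∀ z, b ∣ form1 y z)
    (hy : 2 * (b * b) ∣ form1 y y) : ∃ ν, y = b • ν := by
  rcases eq_or_ne b 0 with rfl | hb
  · obtain ⟨ν, α, β, -, -, h1, h2, rfl⟩ := exists_eq_smul_add_vecA h
    rw [zero_dvd_iff] at h1 h2
    have hα : α = 0 := by linarith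
    have hβ : β = 0 := by linarith
    refine ⟨0, ?_⟩
    subst hα hβ
    funext i
    rcases i with i | i | i | i <;> try fin_cases i
    all_goals simp [vecA]
  obtain ⟨ν, α, β, ν0, ν1, ⟨s, hs⟩, -, rfl⟩ := exists_eq_smul_add_vecA h
  have hβ : β = 2 * α - b * s := by linarith
  have h1 : form1 (b • ν + vecA α β) (b • ν + vecA α β) =
      b * b * form1 ν ν + 2 * (α ^ 2 - α * β + β ^ 2) := by
    have h0 : form1 ν (vecA α β) = 0 := by rw [form1_vecA, ν0, ν1]; ring
    have h0' : form1 (vecA α β) ν = 0 := by rw [form1_comm, h0]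
    simp only [map_add, LinearMap.add_apply, map_smul, LinearMap.smul_apply, h0, h0', form1_vecA,
      smul_eq_mul]
    simp [vecA]
    ring
  rw [h1] at hy
  obtain ⟨q, hq⟩ := hy
  obtain ⟨r, hr⟩ := form1_even ν
  rw [hr] at hq
  have h2 : 3 * α ^ 2 - 3 * α * b * s = b * b * (q - r - s ^ 2) := by
    rw [hβ] at hq
    linarith
  obtain ⟨t, ht⟩ : b ∣ 3 * α := by
    obtain ⟨-, h4⟩ : True ∧ b ∣ 2 * β - α := ⟨trivial, by
      have := h (vecA 0 1)
      rw [form1_vecA] at this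
      have e : aZero (b • ν + vecA α β) * (2 * 0 - 1) + aOne (b • ν + vecA α β) * (2 * 1 - 0) =
          b * (2 * aOne ν - aZero ν) + (2 * β - α) := by
        simp [vecA]
        ring
      rw [e] at this
      exact (dvd_add_right (Dvd.intro _ rfl)).1 this⟩
    obtain ⟨u, hu⟩ := h4
    exact ⟨u + 2 * s, by linarith⟩
  -- With `3α = bt`, the norm condition, multiplied by `3` and divided by `b²`, shows `3 ∣ t²`.
  -- Hence `3 ∣ t`, so `b ∣ α`, and the obstruction in `A₂` disappears.
  have h3 : t ^ 2 = 3 * (q - r - s ^ 2 + t * s) := by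
    have : b * b * t ^ 2 = b * b * (3 * (q - r - s ^ 2 + t * s)) := by
      have e : b * b * t ^ 2 = (3 * α) * (3 * α) := by rw [ht]; ring
      rw [e]
      linear_combination 3 * h2 + 3 * b * s * ht
    exact mul_left_cancel₀ (mul_ne_zero hb hb) this
  obtain ⟨t', rfl⟩ : (3 : ℤ) ∣ t := Int.prime_three.dvd_of_dvd_pow (n := 2) ⟨_, h3⟩
  have hα : α = b * t' := by linarith
  refine ⟨ν + vecA t' (2 * t' - s), ?_⟩
  rw [smul_add, hβ, hα]
  congr 1
  funext i
  rcases i with i | i | i | i <;> try fin_cases i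
  all_goals simp [vecA]
  ring

end Divisibility

/-! ### Extension of isometries of `Λ₁` to the stabilizer of `η` -/

section Extension

theorem glue_eq : glue = vecA 2 1 := rfl

/-- `glue / 3` generates the discriminant group of `Λ₁`, which has order `3`, so every isometry acts
on it by `1` or `-1`. -/
theorem exists_glue (h : form1.IsometryEquiv form1) :
    ∃ ρ, h glue = glue + (3 : ℤ) • ρ ∨ h glue = -glue + (3 : ℤ) • ρ := by
  have hdvd : ∀ z, 3 ∣ form1 (h glue) z := by
    intro z
    obtain ⟨z, rfl⟩ := h.toLinearEquiv.surjective z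
    refine ⟨aZero z, ?_⟩
    rw [← form1_glue]
    exact h.map_app _ _
  obtain ⟨ν, α, β, ν0, ν1, ⟨s, hs⟩, -, hy⟩ := exists_eq_smul_add_vecA hdvd
  have hβ : β = 2 * α - 3 * s := by linarith
  have key : ∀ α' β' c d : ℤ, vecA (c + 3 * α') (d + 3 * β') = vecA c d + (3 : ℤ) • vecA α' β' := by
    intro α' β' c d
    funext i
    rcases i with i | i | i | i <;> try fin_cases i
    all_goals simp [vecA]
  have hα : α % 3 = 0 ∨ α % 3 = 1 ∨ α % 3 = 2 := by omega
  rcases hα with hα | hα | hα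
  -- Here `h glue` would be divisible by `3`, although its norm is `6`.
  · exfalso
    have e : h glue = (3 : ℤ) • (ν + vecA (α / 3) (2 * (α / 3) - s)) := by
      rw [hy, smul_add]
      congr 1
      rw [← zero_add ((3 : ℤ) • vecA _ _), show (0 : Lambda1) = vecA 0 0 from ?_, ← key]
      · congr 1 <;> omega
      · funext i
        rcases i with i | i | i | i <;> try fin_cases i
        all_goals simp [vecA]
    have h1 : form1 (h glue) (h glue) = form1 glue glue := h.map_app _ _
    rw [form1_glue, e] at h1
    simp only [map_smul, LinearMap.smul_apply, smul_eq_mul] at h1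
    have h2 : aZero glue = 2 := rfl
    rw [h2] at h1
    omega
  · refine ⟨ν + vecA (α / 3 + 1) (2 * (α / 3) - s + 1), Or.inr ?_⟩
    rw [hy, smul_add, add_left_comm]
    congr 1
    rw [show -glue = vecA (-2) (-1) from ?_, ← key]
    · congr 1 <;> omega
    · funext i
      rcases i with i | i | i | i <;> try fin_cases i
      all_goals simp [vecA, glue]
  · refine ⟨ν + vecA (α / 3) (2 * (α / 3) - s + 1), Or.inl ?_⟩
    rw [hy, smul_add, add_left_comm, glue_eq]
    congr 1
    rw [← key]
    congr 1 <;> omega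

/-- The extension to `Λ` of an isometry of `Λ₁` that acts trivially on the discriminant group. -/
noncomputable def extend (h : form1.IsometryEquiv form1) (ρ : Lambda1)
    (hρ : h glue = glue + (3 : ℤ) • ρ) : form.IsometryEquiv form where
  toLinearEquiv := pointEquiv.symm.trans <| LinearEquiv.trans
    -- The shift by `s • ρ` is forced by the requirement that `η = point (-glue) 0 0 3` be fixed.
    { toFun := fun p => (h p.1 + p.2.2.2 • ρ, p.2)
      invFun := fun p => (h.toLinearEquiv.symm (p.1 - p.2.2.2 • ρ), p.2)
      map_add' := fun p q => by
        refine Prod.ext ?_ rfl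
        simp only [Prod.fst_add, Prod.snd_add, map_add]
        module
      map_smul' := fun c p => by
        refine Prod.ext ?_ rfl
        simp only [Prod.smul_fst, Prod.smul_snd, map_smul, RingHom.id_apply, smul_eq_mul]
        module
      left_inv := fun p => by
        refine Prod.ext ?_ rfl
        change h.toLinearEquiv.symm (h.toLinearEquiv p.1 + p.2.2.2 • ρ - p.2.2.2 • ρ) = p.1
        rw [add_sub_cancel_right, LinearEquiv.symm_apply_apply]
      right_inv := fun p => by
        refine Prod.ext ?_ rfl
        change h.toLinearEquiv (h.toLinearEquiv.symm (p.1 - p.2.2.2 • ρ)) + p.2.2.2 • ρ = p.1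
        rw [LinearEquiv.apply_symm_apply, sub_add_cancel] } pointEquiv
  map_app' x x' := by
    obtain ⟨⟨y, a, b, s⟩, rfl⟩ := pointEquiv.surjective x
    obtain ⟨⟨y', a', b', s'⟩, rfl⟩ := pointEquiv.surjective x'
    have hh : ∀ y y', form1 (h y) (h y') = form1 y y' := fun y y' => h.map_app y' y
    -- Since `3ρ = h glue - glue`, the products with `ρ` follow from those with `glue`; comparing
    -- the norms of `glue` and `h glue` then gives `h2`.
    have h1 : ∀ y, form1 ρ (h y) = aZero y - aZero (h y) := by
      intro y
      have e := hh glue y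
      rw [hρ, map_add, LinearMap.add_apply, map_smul, LinearMap.smul_apply, form1_glue,
        form1_glue, smul_eq_mul] at e
      linarith
    have h1' : ∀ y, form1 (h y) ρ = aZero y - aZero (h y) := fun y => by rw [form1_comm, h1]
    have h2 : form1 ρ ρ = -2 * aZero ρ := by
      have e := hh glue glue
      have e' : form1 ρ glue = 3 * aZero ρ := by rw [form1_comm, form1_glue]
      rw [hρ] at e
      simp only [map_add, LinearMap.add_apply, map_smul, LinearMap.smul_apply, e', form1_glue,
        smul_eq_mul] at e
      linarith
    simp only [LinearEquiv.trans_apply, AddHom.toFun_eq_coe, LinearMap.coe_toAddHom,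
      LinearEquiv.coe_coe, LinearEquiv.symm_apply_apply]
    change form (point (h y + s • ρ) a b s) (point (h y' + s' • ρ) a' b' s') =
      form (point y a b s) (point y' a' b' s')
    rw [form_point, form_point]
    simp only [map_add, LinearMap.add_apply, map_smul, LinearMap.smul_apply, smul_eq_mul, hh, h1,
      h1', h2, Pi.add_apply, Pi.smul_apply, aZero]
    ring

theorem extend_point (h : form1.IsometryEquiv form1) (ρ : Lambda1)
    (hρ : h glue = glue + (3 : ℤ) • ρ) (y : Lambda1) (a b s : ℤ) :
    extend h ρ hρ (point y a b s) = point (h y + s • ρ) a b s := by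
  have e : pointEquiv.symm (point y a b s) = (y, a, b, s) :=
    pointEquiv.symm_apply_apply (y, a, b, s)
  change (fun p : Lambda1 × ℤ × ℤ × ℤ => point (h p.1 + p.2.2.2 • ρ) p.2.1 p.2.2.1 p.2.2.2)
    (pointEquiv.symm (point y a b s)) = _
  rw [e]

theorem extend_eta (h : form1.IsometryEquiv form1) (ρ : Lambda1)
    (hρ : h glue = glue + (3 : ℤ) • ρ) : extend h ρ hρ eta = eta := by
  rw [eta_eq, extend_point, map_neg, hρ]
  congr 1
  module

end Extension

/-! ### Eichler transvections in the stabilizer of `η` -/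

section Transvections

/-- The Eichler transvection `x ↦ x + (x, e) w - (x, w) e - ½ (w, w) (x, e) e`. -/
noncomputable def transvection {M : Type*} [AddCommGroup M] (B : LinearMap.BilinForm ℤ M)
    (hB : ∀ x y, B x y = B y x) (e w : M) (k : ℤ) (he : B e e = 0) (hew : B e w = 0)
    (hk : B w w = 2 * k) : B.IsometryEquiv B where
  toLinearEquiv :=
    have hwe : B w e = 0 := by rw [hB, hew]
    LinearEquiv.ofLinearMap
      (LinearMap.id + (B.flip e).smulRight w - (B.flip w + k • B.flip e).smulRight e)
      (LinearMap.id - (B.flip e).smulRight w + (B.flip w - k • B.flip e).smulRight e)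
      (by
        ext x
        simp only [LinearMap.comp_apply, LinearMap.add_apply, LinearMap.sub_apply,
          LinearMap.smul_apply, LinearMap.smulRight_apply, LinearMap.id_apply,
          LinearMap.BilinForm.flip_apply, map_add, map_sub, map_smul, he, hew, hwe, hk, smul_eq_mul]
        module)
      (by
        ext x
        simp only [LinearMap.comp_apply, LinearMap.add_apply, LinearMap.sub_apply,
          LinearMap.smul_apply, LinearMap.smulRight_apply, LinearMap.id_apply,
          LinearMap.BilinForm.flip_apply, map_add, map_sub, map_smul, he, hew, hwe, hk, smul_eq_mul]
        module)
  map_app' x y := by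
    have hwe : B w e = 0 := by rw [hB, hew]
    change B (x + B x e • w - (B x w + k * B x e) • e) (y + B y e • w - (B y w + k * B y e) • e) =
      B x y
    simp only [map_add, map_sub, LinearMap.add_apply, LinearMap.sub_apply, map_smul,
      LinearMap.smul_apply, smul_eq_mul, he, hew, hwe, hk, hB e y, hB w y]
    ring

theorem transvection_apply {M : Type*} [AddCommGroup M] (B : LinearMap.BilinForm ℤ M)
    (hB : ∀ x y, B x y = B y x) (e w : M) (k : ℤ) (he : B e e = 0) (hew : B e w = 0)
    (hk : B w w = 2 * k) (x : M) :
    transvection B hB e w k he hew hk x = x + B x e • w - (B x w + k * B x e) • e := rfl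

/-- `x` and `y` lie in the same orbit under the stabilizer of `η` in the orthogonal group
of `Λ`. -/
def OrbitRel (x y : Lambda) : Prop := ∃ g : form.IsometryEquiv form, g eta = eta ∧ g x = y

theorem OrbitRel.trans {x y z : Lambda} (h : OrbitRel x y) (h' : OrbitRel y z) : OrbitRel x z := by
  obtain ⟨g, hg, rfl⟩ := h
  obtain ⟨g', hg', rfl⟩ := h'
  exact ⟨g.trans g', (congrArg g' hg).trans hg', rfl⟩

theorem eta_apply_point (y : Lambda1) (a b s : ℤ) : form eta (point y a b s) = s := by
  rw [form_comm, form_point_eta]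

theorem exists_two_mul_eq (w : Lambda1) : ∃ k, form1 w w = 2 * k := by
  obtain ⟨k, hk⟩ := form1_even w
  exact ⟨k, by rw [hk]; ring⟩

/-- The transvection along `e` and `w` lies in the stabilizer because both vectors are orthogonal to
`η`. -/
theorem orbitRel_add (w : Lambda1) {k : ℤ} (hk : form1 w w = 2 * k) (y : Lambda1) (a b : ℤ) :
    OrbitRel (point y a b 0) (point (y + b • w) (a - form1 y w - k * b) b 0) := by
  refine ⟨transvection form form_comm (point 0 1 0 0) (point w 0 0 0) k (by simp [form_point])
    (by simp [form_point]) (by simp [form_point, hk]), ?_, ?_⟩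
  · rw [transvection_apply, eta_apply_point, eta_apply_point]
    simp
  · rw [transvection_apply]
    simp only [form_point, smul_point, point_add, point_sub]
    congr 1 <;> simp
    ring

theorem orbitRel_add' (w : Lambda1) {k : ℤ} (hk : form1 w w = 2 * k) (y : Lambda1) (a b : ℤ) :
    OrbitRel (point y a b 0) (point (y + a • w) a (b - form1 y w - k * a) 0) := by
  refine ⟨transvection form form_comm (point 0 0 1 0) (point w 0 0 0) k (by simp [form_point])
    (by simp [form_point]) (by simp [form_point, hk]), ?_, ?_⟩
  · rw [transvection_apply, eta_apply_point, eta_apply_point]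
    simp
  · rw [transvection_apply]
    simp only [form_point, smul_point, point_add, point_sub]
    congr 1 <;> simp
    ring

/-- The reflection in `e - f`, of norm `-2`, exchanges `e` and `f`. -/
theorem orbitRel_swap (y : Lambda1) (a b : ℤ) : OrbitRel (point y a b 0) (point y b a 0) := by
  refine ⟨reflectionEquiv form form_comm (point 0 1 (-1) 0) (-form.flip (point 0 1 (-1) 0)) (-1)
    (by norm_num) (fun x => by simp) (by simp [form_point]), ?_, ?_⟩
  · rw [reflectionEquiv_apply, LinearMap.neg_apply, LinearMap.BilinForm.flip_apply,
      form_comm, form_point_eta]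
    simp
  · rw [reflectionEquiv_apply, LinearMap.neg_apply, LinearMap.BilinForm.flip_apply, form_point,
      smul_point, point_sub]
    congr 1 <;> simp

/-- A transvection along `f` carries `e` to `z + e`; one along `e` with a multiple of the partner
`w` then adjusts the coefficient of `e` arbitrarily. -/
theorem orbitRel_point {z w : Lambda1} (hz : form1 z z = 0) (hzw : form1 z w = 1) (m : ℤ) :
    OrbitRel (point 0 1 0 0) (point z (-m) 0 0) := by
  have h1 := orbitRel_add' z (k := 0) (by simpa using hz) 0 1 0
  obtain ⟨k, hk⟩ := exists_two_mul_eq ((m + 1) • w)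
  have h2 := orbitRel_add ((m + 1) • w) hk z 1 0
  simp only [zero_add, one_smul, map_zero, LinearMap.zero_apply, sub_zero, zero_smul,
    add_zero, mul_zero, map_smul, hzw, smul_eq_mul, mul_one] at h1 h2
  convert h1.trans h2 using 2
  ring

theorem orbitRel_point' (w : Lambda1) {k : ℤ} (hk : form1 w w = 2 * k) :
    OrbitRel (point 0 1 0 0) (point w (-k) 1 0) := by
  have h := orbitRel_add w hk 0 0 1
  simp only [zero_add, one_smul, map_zero, LinearMap.zero_apply, sub_zero, zero_sub,
    mul_one] at h
  exact (orbitRel_swap 0 1 0).trans h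

end Transvections

/-! ### Reduction of primitive isotropic vectors to `± e` -/

section Reduction

theorem dvd_of_forall_le {b r : ℤ} (hb : b ≠ 0)
    (h : ∀ m : ℤ, r - m * b = 0 ∨ |b| ≤ |r - m * b|) : b ∣ r := by
  have h1 := h (r / b)
  have h2 : r - r / b * b = r % b := by
    have := Int.emod_add_mul_ediv r b
    linarith
  rw [h2] at h1
  rcases h1 with h1 | h1
  · exact Int.dvd_of_emod_eq_zero h1
  · have := Int.emod_lt_abs r hb
    rw [abs_of_nonneg (Int.emod_nonneg r hb)] at h1
    omega

/-- The isotropic vectors of the hyperbolic plane in `Λ₁`. -/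
def vecU (c d : ℤ) : Lambda1 := Sum.elim 0 (Sum.elim 0 (Sum.elim 0 ![c, d]))

theorem form1_vecU (y : Lambda1) (c d : ℤ) : form1 y (vecU c d) = uZero y * d + uOne y * c := by
  rw [form1_eq, formN_apply]
  have e1 : (fun i => vecU c d (Sum.inl i)) = 0 := rfl
  have e2 : (fun i => vecU c d (Sum.inr (Sum.inl i))) = 0 := rfl
  have e3 : (fun i => vecU c d (Sum.inr (Sum.inr (Sum.inl i)))) = 0 := rfl
  rw [e1, e2, e3, map_zero, map_zero, map_zero]
  simp [vecU]

/-- The orbit of `e` contains families along which the product with the given vector changes by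
steps of `b`. Minimality of `|b|` among nonzero products forces each remainder modulo `b` to vanish,
so `b` divides all products of `y`, and also `a`. -/
theorem exists_eq_smul_of_minimal {y : Lambda1} {a b : ℤ} (hb : b ≠ 0)
    (hx : form1 y y + 2 * (a * b) = 0)
    (hmin : ∀ u, OrbitRel (point 0 1 0 0) u →
      form (point y a b 0) u = 0 ∨ |b| ≤ |form (point y a b 0) u|) : ∃ ν, y = b • ν := by
  have h1 : ∀ z w, form1 z z = 0 → form1 z w = 1 → b ∣ form1 y z := by
    intro z w hz hzw
    refine dvd_of_forall_le hb fun m => ?_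
    have h := hmin _ (orbitRel_point hz hzw m)
    rw [form_point] at h
    convert h using 3 <;> simp <;> ring
  have u0 : ∀ c d, uZero (vecU c d) = c := fun _ _ => rfl
  have u1 : ∀ c d, uOne (vecU c d) = d := fun _ _ => rfl
  have h2 : b ∣ uOne y := by
    have := h1 (vecU 1 0) (vecU 0 1) (by simp [form1_vecU, u0, u1]) (by simp [form1_vecU, u0, u1])
    simpa [form1_vecU] using this
  have h3 : b ∣ uZero y := by
    have := h1 (vecU 0 1) (vecU 1 0) (by simp [form1_vecU, u0, u1]) (by simp [form1_vecU, u0, u1])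
    simpa [form1_vecU] using this
  have h4 : ∀ n, b ∣ form1 y n := by
    intro n
    obtain ⟨k, hk⟩ := exists_two_mul_eq n
    -- The added vector makes the `U`-coordinate `uOne` equal to `1` and the norm `0`. Thus the
    -- first summand is isotropic and has product `1` with `vecU 1 0`.
    have e : n = (n + vecU (uZero n * uOne n - uZero n - k) (1 - uOne n)) -
        vecU (uZero n * uOne n - uZero n - k) (1 - uOne n) := by abel
    rw [e, map_sub]
    refine dvd_sub (h1 _ (vecU 1 0) ?_ ?_) ?_
    · simp only [map_add, LinearMap.add_apply, form1_vecU, u0, u1, hk, form1_comm (vecU _ _) n]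
      ring
    · rw [map_add, LinearMap.add_apply, form1_vecU, form1_vecU, u0, u1]
      ring
    · rw [form1_vecU]
      exact dvd_add (h3.mul_right _) (h2.mul_right _)
  have h5 : b ∣ a := by
    obtain ⟨d, hd⟩ := h2
    obtain ⟨c, hc⟩ := h3
    have h6 : b ∣ a + b * ((d + 1) * c) := by
      refine dvd_of_forall_le hb fun m => ?_
      -- With `uOne y = b * d`, the second coordinate `d + 1` makes the product depend on `m`
      -- through exactly `-m * b`.
      have hk : form1 (vecU m (d + 1)) (vecU m (d + 1)) = 2 * (m * (d + 1)) := by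
        rw [form1_vecU, u0, u1]
        ring
      have h := hmin _ (orbitRel_point' _ hk)
      rw [form_point, form1_vecU, hc, hd] at h
      convert h using 3 <;> ring
    exact (dvd_add_left (Dvd.intro _ rfl)).1 h6
  refine exists_eq_smul_of_dvd h4 ?_
  obtain ⟨c, rfl⟩ := h5
  exact ⟨-c, by linarith⟩

/-- Orthogonality to `e`, to `f` and to their transvections along the isotropic vectors of `U ⊆ Λ₁`
leaves an isotropic vector of the definite lattice `2E₈ ⊥ A₂`, which is zero. -/
theorem exists_apply_ne_zero {y : Lambda1} {a b : ℤ} (h0 : point y a b 0 ≠ 0)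
    (hx : form1 y y + 2 * (a * b) = 0) :
    ∃ u, OrbitRel (point 0 1 0 0) u ∧ form (point y a b 0) u ≠ 0 := by
  by_contra! hc
  have h1 := hc (point 0 1 0 0) ⟨.refl form, rfl, rfl⟩
  rw [form_point] at h1
  have hb : b = 0 := by simpa using h1
  subst hb
  have h2 := hc _ (orbitRel_swap 0 1 0)
  rw [form_point] at h2
  have ha : a = 0 := by simpa using h2
  subst ha
  have h3 : ∀ c d, c * d = 0 → uZero y * d + uOne y * c = 0 := by
    intro c d hcd
    have := hc _ (orbitRel_point' (vecU c d) (k := 0)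
      (by rw [form1_vecU]; simp [vecU, mul_comm d c, hcd]))
    rw [form_point, form1_vecU] at this
    simpa using this
  have h4 := h3 1 0 (by ring)
  have h5 := h3 0 1 (by ring)
  have hu1 : uOne y = 0 := by linarith
  have hu0 : uZero y = 0 := by linarith
  refine h0 ?_
  rw [form1_eq, hu0, hu1] at hx
  rw [eq_zero_of_formN (by linarith) hu0 hu1, point_zero]

/-- A primitive isotropic vector of `Λ_o` can be moved to `e` or `-e`. -/
theorem orbitRel_of_isPrimitiveVector {x : Lambda} (hx : IsPrimitiveVector x) (hxx : form x x = 0)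
    (hxo : x ∈ LambdaO) :
    OrbitRel x (point 0 1 0 0) ∨ OrbitRel x (point 0 (-1) 0 0) := by
  have hne : {u | OrbitRel (point 0 1 0 0) u ∧ form x u ≠ 0}.Nonempty := by
    obtain ⟨y, a, b, rfl⟩ := exists_eq_point_of_mem hxo
    exact exists_apply_ne_zero hx.ne_zero (by rw [form_point] at hxx; linarith)
  -- The vector `u` has the smallest nonzero product with `x` in the orbit of `e`. Applying `g.symm`
  -- turns `u` into `e` and this product into the coordinate `b`.
  obtain ⟨u, ⟨⟨g, hg, hgu⟩, hu⟩, hmin⟩ := exists_min_of_nonneg hne (fun u => |form x u|)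
    fun _ _ => abs_nonneg _
  have hgx : ∀ v, form (g.symm x) v = form x (g v) := by
    intro v
    have := g.map_app v (g.symm x)
    rw [← this]
    congr 2
    exact g.toLinearEquiv.apply_symm_apply x
  obtain ⟨y, a, b, hy⟩ := exists_eq_point_of_mem (x := g.symm x) (by
    rw [mem_LambdaO, hgx, hg]
    exact mem_LambdaO.1 hxo)
  have hp : IsPrimitiveVector (g.symm x) := hx.map g.symm.toLinearEquiv
  have hxx' : form (g.symm x) (g.symm x) = 0 := by
    rw [hgx]
    rw [show g (g.symm x) = x from g.toLinearEquiv.apply_symm_apply x, hxx]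
  rw [hy] at hp hxx' hgx
  have hb : form x u = b := by
    rw [← hgu, ← hgx, form_point]
    simp
  rw [hb] at hu
  have hyy : form1 y y + 2 * (a * b) = 0 := by
    rw [form_point] at hxx'
    linarith
  obtain ⟨ν, hν⟩ := exists_eq_smul_of_minimal hu hyy fun v hv => by
    rw [or_iff_not_imp_left, hgx]
    intro hv0
    rw [← hb]
    refine hmin (g v) ⟨?_, hv0⟩
    obtain ⟨g', hg', rfl⟩ := hv
    exact ⟨g'.trans g, (congrArg g hg').trans hg, rfl⟩
  -- As `y = b • ν`, the transvection along `-ν` removes the component in `Λ₁`; what remains is an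
  -- isotropic vector of `U` with `b ≠ 0`, so a multiple of `f`.
  obtain ⟨k, hk⟩ := exists_two_mul_eq (-ν)
  have h1 := orbitRel_add (-ν) hk y a b
  set c := a - form1 y (-ν) - k * b with hc
  have h2 : y + b • -ν = 0 := by rw [hν]; simp
  rw [h2] at h1
  have hxr : OrbitRel x (point y a b 0) := hy ▸ ⟨g.symm, symm_apply_eq g hg, rfl⟩
  have h3 := hxr.trans h1
  obtain ⟨g2, hg2, hgx2⟩ := id h3
  have hp2 : IsPrimitiveVector (point 0 c b 0) := hgx2 ▸ hx.map g2.toLinearEquiv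
  have hcb : c * b = 0 := by
    have := g2.map_app x x
    rw [hgx2, hxx, form_point] at this
    simp only [map_zero] at this
    linarith
  have hc0 : c = 0 := (mul_eq_zero.1 hcb).resolve_right hu
  have h4 := h3.trans (orbitRel_swap 0 c b)
  rw [hc0] at h4 hp2
  have hunit : IsUnit b := hp2 b (point 0 0 1 0) (by rw [smul_point]; simp)
  rcases Int.isUnit_iff.1 hunit with rfl | rfl
  · exact Or.inl h4
  · exact Or.inr h4

end Reduction

/-! ### The action of `Γ` on `Λ_o` and on the quotients -/

section Stabilizer

theorem map_LambdaO (g : form.IsometryEquiv form) (hg : g eta = eta) :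
    LambdaO.map (g.toLinearEquiv : Lambda →ₗ[ℤ] Lambda) = LambdaO := by
  ext x
  rw [Submodule.mem_map_equiv, mem_LambdaO, mem_LambdaO]
  have h : form (g.symm x) eta = form x eta := by
    have := g.symm.map_app eta x
    rwa [symm_apply_eq g hg] at this
  exact Eq.congr_left h

/-- The isometry of `Λ_o` induced by an isometry of `Λ` that fixes `η`. -/
noncomputable def restrictO (g : form.IsometryEquiv form) (hg : g eta = eta) :
    formO.IsometryEquiv formO where
  toLinearEquiv := g.toLinearEquiv.ofSubmodules LambdaO LambdaO (map_LambdaO g hg)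
  map_app' x y := g.map_app' x.1 y.1

theorem map_subtype_restrictO (g : form.IsometryEquiv form) (hg : g eta = eta)
    (K : Submodule ℤ LambdaO) :
    (K.map (restrictO g hg).toLinearEquiv.toLinearMap).map LambdaO.subtype =
      (K.map LambdaO.subtype).map (g.toLinearEquiv : Lambda →ₗ[ℤ] Lambda) := by
  rw [← Submodule.map_comp, ← Submodule.map_comp]
  rfl

/-- Passing to the induced isometries of `Λ_o` makes the quotients `K^⊥ / K` directly comparable. -/
theorem gammaEquivalent_iff {K K' : Submodule ℤ LambdaO} : GammaEquivalent K K' ↔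
    ∃ (g : form.IsometryEquiv form) (hg : g eta = eta),
      K.map (restrictO g hg).toLinearEquiv.toLinearMap = K' := by
  constructor
  · rintro ⟨g, hg, h⟩
    rw [← map_subtype_restrictO g hg] at h
    exact ⟨g, hg, Submodule.map_injective_of_injective LambdaO.subtype_injective h⟩
  · rintro ⟨g, hg, rfl⟩
    exact ⟨g, hg, (map_subtype_restrictO g hg K).symm⟩

theorem GammaEquivalent.trans {K K' K'' : Submodule ℤ LambdaO} (h : GammaEquivalent K K')
    (h' : GammaEquivalent K' K'') : GammaEquivalent K K'' := by
  obtain ⟨g, hg, h⟩ := h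
  obtain ⟨g', hg', h'⟩ := h'
  refine ⟨g.trans g', (congrArg g' hg).trans hg', ?_⟩
  rw [← h', ← h]
  exact Submodule.map_comp _ _ _

theorem GammaEquivalent.symm {K K' : Submodule ℤ LambdaO} (h : GammaEquivalent K K') :
    GammaEquivalent K' K := by
  obtain ⟨g, hg, h⟩ := h
  refine ⟨g.symm, symm_apply_eq g hg, ?_⟩
  rw [← h, ← Submodule.map_comp]
  convert Submodule.map_id _
  exact LinearMap.ext fun x => g.toLinearEquiv.symm_apply_apply x

theorem IsPrimitiveIsotropicPlane.map {M : Type*} [AddCommGroup M] {B : LinearMap.BilinForm ℤ M}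
    {K : Submodule ℤ M} (hK : IsPrimitiveIsotropicPlane B K) (g : B.IsometryEquiv B) :
    IsPrimitiveIsotropicPlane B (K.map g.toLinearEquiv.toLinearMap) where
  primitive n x hn hx := by
    obtain ⟨x, rfl⟩ := g.toLinearEquiv.surjective x
    rw [← map_smul] at hx
    obtain ⟨y, hy, h⟩ := hx
    refine ⟨x, hK.primitive n x hn ?_, rfl⟩
    rwa [← g.toLinearEquiv.injective h]
  isotropic := by
    rintro _ ⟨x, hx, rfl⟩ _ ⟨y, hy, rfl⟩
    exact (g.map_app y x).trans (hK.isotropic x hx y hy)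
  rank_two := (LinearEquiv.finrank_map_eq g.toLinearEquiv K).trans hK.rank_two

theorem nonempty_isometryEquiv_of_map {M : Type*} [AddCommGroup M] {B : LinearMap.BilinForm ℤ M}
    (hB : ∀ x y, B x y = B y x) {K K' : Submodule ℤ M} (g : B.IsometryEquiv B)
    (h : K.map g.toLinearEquiv.toLinearMap = K') :
    Nonempty ((perpQuotForm B hB K).IsometryEquiv (perpQuotForm B hB K')) := by
  have hmem : ∀ x, g x ∈ K' ↔ x ∈ K := by
    intro x
    rw [← h]
    constructor
    · rintro ⟨y, hy, hxy⟩
      rwa [← g.toLinearEquiv.injective hxy]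
    · exact fun hx => ⟨x, hx, rfl⟩
  have hperp : (B.orthogonal K).map g.toLinearEquiv.toLinearMap = B.orthogonal K' := by
    ext x
    obtain ⟨x, rfl⟩ := g.toLinearEquiv.surjective x
    rw [Submodule.mem_map_equiv, LinearEquiv.symm_apply_apply,
      LinearMap.BilinForm.mem_orthogonal_iff, LinearMap.BilinForm.mem_orthogonal_iff, ← h]
    constructor
    · rintro hx _ ⟨y, hy, rfl⟩
      exact (g.map_app x y).trans (hx y hy)
    · intro hx y hy
      exact (g.map_app x y).symm.trans (hx _ ⟨y, hy, rfl⟩)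
  refine ⟨⟨Submodule.Quotient.equiv _ _
    (g.toLinearEquiv.ofSubmodules (B.orthogonal K) (B.orthogonal K') hperp) ?_, ?_⟩⟩
  · ext x
    obtain ⟨x, rfl⟩ := (g.toLinearEquiv.ofSubmodules _ _ hperp).surjective x
    rw [Submodule.mem_map_equiv, LinearEquiv.symm_apply_apply]
    exact (hmem x.1).symm
  · intro x y
    obtain ⟨x, rfl⟩ := Submodule.Quotient.mk_surjective _ x
    obtain ⟨y, rfl⟩ := Submodule.Quotient.mk_surjective _ y
    exact g.map_app' x.1 y.1

theorem GammaEquivalent.nonempty_isometryEquiv {K K' : Submodule ℤ LambdaO}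
    (h : GammaEquivalent K K') : Nonempty ((quotForm K).IsometryEquiv (quotForm K')) := by
  obtain ⟨g, hg, h⟩ := gammaEquivalent_iff.1 h
  exact nonempty_isometryEquiv_of_map formO_comm _ h

end Stabilizer

/-! ### Reduction of planes to the six standard planes -/

section PlaneReduction

/-- Among the vectors of which `x` is a multiple, one with least sum of absolute values of
coordinates is primitive. -/
theorem exists_isPrimitiveVector {ι : Type*} [Fintype ι] {x : ι → ℤ} (hx : x ≠ 0) :
    ∃ (n : ℤ) (w : ι → ℤ), n ≠ 0 ∧ IsPrimitiveVector w ∧ x = n • w := by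
  obtain ⟨w, ⟨n, rfl⟩, hmin⟩ := exists_min_of_nonneg
    (s := {w : ι → ℤ | ∃ n : ℤ, x = n • w}) ⟨x, 1, (one_smul _ _).symm⟩
    (fun w => ∑ i, |w i|) fun w _ => Finset.sum_nonneg fun i _ => abs_nonneg _
  refine ⟨n, w, ?_, ?_, rfl⟩
  · rintro rfl
    exact hx (zero_smul _ _)
  · rintro m w' rfl
    have h1 := hmin w' ⟨n * m, (mul_smul _ _ _).symm⟩
    have h2 : ∑ i, |(m • w') i| = |m| * ∑ i, |w' i| := by
      rw [Finset.mul_sum]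
      exact Finset.sum_congr rfl fun i _ => abs_mul _ _
    have h3 : 0 < ∑ i, |w' i| := by
      refine lt_of_le_of_ne (Finset.sum_nonneg fun i _ => abs_nonneg _) fun h0 => hx ?_
      have : w' = 0 := funext fun i =>
        abs_eq_zero.1 ((Finset.sum_eq_zero_iff_of_nonneg fun i _ => abs_nonneg _).1 h0.symm i
          (Finset.mem_univ i))
      rw [this, smul_zero, smul_zero]
    rw [h2] at h1
    have h4 : |m| ≤ 1 := by nlinarith
    have h5 : m ≠ 0 := by
      rintro rfl
      exact hx (by rw [zero_smul, smul_zero])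
    rw [Int.isUnit_iff]
    rcases abs_le.1 h4 with ⟨h6, h7⟩
    omega

theorem point_eq_add (y : Lambda1) (a : ℤ) :
    point y a 0 0 = (a • vecE + embed y : LambdaO) := by
  have := smul_vecE_add_smul_embed a 1 y
  rw [one_smul, one_smul] at this
  exact this.symm

/-- Isotropy removes the coefficient of `f`, so every member of `K` is a multiple of `e` plus an
isotropic vector of `Λ₁` in `K`. These components are mutually orthogonal, hence proportional in the
hyperbolic lattice. -/
theorem exists_eq_plane {K : Submodule ℤ LambdaO} (hK : IsPrimitiveIsotropicPlane formO K)
    (he : vecE ∈ K) : ∃ w, IsPrimitiveVector w ∧ form1 w w = 0 ∧ K = plane w := by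
  have h1 : ∀ x ∈ K, ∃ (y : Lambda1) (a : ℤ), x = a • vecE + embed y ∧ embed y ∈ K ∧
      form1 y y = 0 := by
    intro x hx
    obtain ⟨y, a, b, hy⟩ := exists_eq_point_of_mem x.2
    have h2 : form (point 0 1 0 0) x = 0 := hK.isotropic _ he _ hx
    have h3 : form x x = 0 := hK.isotropic _ hx _ hx
    rw [hy, form_point] at h2 h3
    have hb : b = 0 := by simpa using h2
    subst hb
    rw [point_eq_add] at hy
    have hy' : x = a • vecE + embed y := Subtype.ext hy
    refine ⟨y, a, hy', ?_, by linarith⟩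
    rw [← add_sub_cancel_left (a • vecE) (embed y), ← hy']
    exact K.sub_mem hx (K.smul_mem a he)
  have h2 : ∀ y, embed y ∈ K → form1 y y = 0 → y ≠ 0 → ∃ (n : ℤ) (w : Lambda1),
      IsPrimitiveVector w ∧ form1 w w = 0 ∧ embed w ∈ K ∧ y = n • w := by
    intro y hy hyy hy0
    obtain ⟨n, w, hn, hw, rfl⟩ := exists_isPrimitiveVector hy0
    refine ⟨n, w, hw, ?_, hK.primitive n _ hn ?_, rfl⟩
    · simp only [map_smul, LinearMap.smul_apply, smul_eq_mul] at hyy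
      simpa [hn] using hyy
    · have : (n • embed w : LambdaO) = embed (n • w) := by
        refine Subtype.ext ?_
        change n • point w 0 0 0 = point (n • w) 0 0 0
        rw [smul_point, mul_zero]
      rwa [this]
  -- If all components in `Λ₁` vanished, `K` would be generated by `e`, against rank two.
  obtain ⟨y, hy, hyy, hy0⟩ : ∃ y, embed y ∈ K ∧ form1 y y = 0 ∧ y ≠ 0 := by
    by_contra! hc
    have := finrank_le_one (R := ℤ) (⟨vecE, he⟩ : K) fun x => by
      obtain ⟨y, a, hx, hy, hyy⟩ := h1 x.1 x.2
      refine ⟨a, Subtype.ext ?_⟩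
      rw [hx, hc y hy hyy, show embed 0 = 0 from Subtype.ext point_zero, add_zero]
      rfl
    rw [hK.rank_two] at this
    norm_num at this
  obtain ⟨n, w, hw, hww, hwK, rfl⟩ := h2 y hy hyy hy0
  refine ⟨w, hw, hww, le_antisymm (fun x hx => ?_) ?_⟩
  · obtain ⟨z, a, rfl, hz, hzz⟩ := h1 x hx
    rcases eq_or_ne z 0 with rfl | hz0
    · exact mem_plane.2 ⟨a, 0, by rw [← point_eq_add, zero_smul]⟩
    · obtain ⟨m, w', hw', hww', hwK', rfl⟩ := h2 z hz hzz hz0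
      have h3 : form1 w w' = 0 := by
        have := hK.isotropic _ hwK _ hwK'
        change form (point w 0 0 0) (point w' 0 0 0) = 0 at this
        rw [form_point] at this
        simpa using this
      rcases eq_or_eq_neg_of_form1_eq_zero hw hw' hww hww' h3 with rfl | rfl
      · exact mem_plane.2 ⟨a, m, by rw [← point_eq_add]⟩
      · exact mem_plane.2 ⟨a, -m, by rw [← point_eq_add, smul_neg, neg_smul, neg_neg]⟩
  · rw [plane, Submodule.span_le]
    rintro _ ⟨i, rfl⟩
    fin_cases i
    · exact he
    · exact hwK

theorem map_plane {g : form.IsometryEquiv form} (hg : g eta = eta) {w w' : Lambda1}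
    (he : g (point 0 1 0 0) = point 0 1 0 0) (h : g (point w 0 0 0) = point w' 0 0 0) :
    GammaEquivalent (plane w) (plane w') := by
  refine gammaEquivalent_iff.2 ⟨g, hg, ?_⟩
  rw [plane, plane, Submodule.map_span, ← Set.range_comp]
  congr 2
  funext i
  fin_cases i
  · exact Subtype.ext he
  · exact Subtype.ext h

theorem plane_neg (w : Lambda1) : plane (-w) = plane w := by
  ext x
  rw [mem_plane, mem_plane]
  constructor
  · rintro ⟨a, c, h⟩
    exact ⟨a, -c, by rw [h, smul_neg, neg_smul]⟩
  · rintro ⟨a, c, h⟩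
    exact ⟨a, -c, by rw [h, smul_neg, neg_smul, neg_neg]⟩

theorem gammaEquivalent_plane_of_glue (h : form1.IsometryEquiv form1) {ρ : Lambda1}
    (hρ : h glue = glue + (3 : ℤ) • ρ) (w : Lambda1) :
    GammaEquivalent (plane w) (plane (h w)) := by
  refine map_plane (extend_eta h ρ hρ) ?_ ?_
  · rw [extend_point, map_zero, zero_smul, add_zero]
  · rw [extend_point, zero_smul, add_zero]

/-- One of `h` and `-h` acts trivially on the discriminant group and so extends to `Γ`; the sign
does not change the plane. -/
theorem gammaEquivalent_plane (h : form1.IsometryEquiv form1) (w : Lambda1) :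
    GammaEquivalent (plane w) (plane (h w)) := by
  obtain ⟨ρ, hρ | hρ⟩ := exists_glue h
  · exact gammaEquivalent_plane_of_glue h hρ w
  · rw [← plane_neg (h w)]
    refine gammaEquivalent_plane_of_glue (h.trans (negEquiv form1)) (ρ := -ρ) ?_ w
    change -(h glue) = _
    rw [hρ]
    module

/-- Every primitive isotropic plane in `Λ_o` is equivalent to one of the six standard planes. -/
theorem exists_gammaEquivalent_cusp {K : Submodule ℤ LambdaO}
    (hK : IsPrimitiveIsotropicPlane formO K) : ∃ t, GammaEquivalent K (plane (cusp t)) := by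
  obtain ⟨x, hx, hx0⟩ : ∃ x ∈ K, x ≠ 0 := by
    by_contra! hc
    have := finrank_le_one (R := ℤ) (0 : K) fun x => ⟨0, by
      rw [smul_zero]
      exact Subtype.ext (hc x.1 x.2).symm⟩
    rw [hK.rank_two] at this
    norm_num at this
  obtain ⟨n, u, hn, hu, hxu⟩ := exists_isPrimitiveVector (x := (x : Lambda))
    fun h => hx0 (Subtype.ext h)
  have huo : u ∈ LambdaO := by
    have := mem_LambdaO.1 x.2
    rw [hxu, map_smul, LinearMap.smul_apply, smul_eq_mul] at this
    exact mem_LambdaO.2 ((mul_eq_zero.1 this).resolve_left hn)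
  have huK : (⟨u, huo⟩ : LambdaO) ∈ K := by
    refine hK.primitive n _ hn ?_
    have : (n • ⟨u, huo⟩ : LambdaO) = x := Subtype.ext hxu.symm
    rwa [this]
  -- The sign ambiguity in the reduction is harmless, because the plane contains `-u` along with
  -- `u`.
  have key : ∃ (g : form.IsometryEquiv form) (hg : g eta = eta),
      vecE ∈ K.map (restrictO g hg).toLinearEquiv.toLinearMap := by
    rcases orbitRel_of_isPrimitiveVector hu (hK.isotropic _ huK _ huK) huo with
      ⟨g, hg, h⟩ | ⟨g, hg, h⟩
    · exact ⟨g, hg, ⟨u, huo⟩, huK, Subtype.ext h⟩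
    · refine ⟨g, hg, -⟨u, huo⟩, K.neg_mem huK, Subtype.ext ?_⟩
      change g (-u) = point 0 1 0 0
      rw [map_neg, h, neg_eq_iff_add_eq_zero, point_add, ← point_zero]
      congr 1
  obtain ⟨g, hg, he⟩ := key
  obtain ⟨w, hw, hww, h⟩ := exists_eq_plane (hK.map _) he
  obtain ⟨t, g', hg'⟩ := exists_isometry_cusp hw hww
  refine ⟨t, (gammaEquivalent_iff.2 ⟨g, hg, h⟩).trans ?_⟩
  rw [← hg']
  exact gammaEquivalent_plane g' w

end PlaneReduction

/-! ### Orbits of primitive isotropic planes of `Λ_o` -/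

section SecondPart

theorem quotForm_comm (K : Submodule ℤ LambdaO) (x y : PerpQuot formO K) :
    quotForm K x y = quotForm K y x := by
  obtain ⟨x, rfl⟩ := Submodule.Quotient.mk_surjective _ x
  obtain ⟨y, rfl⟩ := Submodule.Quotient.mk_surjective _ y
  exact formO_comm x.1 y.1

theorem hasFiniteType_of_isometryEquiv {K K' : Submodule ℤ LambdaO}
    (g : (quotForm K).IsometryEquiv (quotForm K')) {t : BoundaryType}
    (h : HasFiniteType (rationalForm (quotForm K)) (longRootSystem K) t) :
    HasFiniteType (rationalForm (quotForm K')) (longRootSystem K') t :=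
  HasFiniteType.map (rationalForm_rationalEquiv g)
    (mem_componentsWithoutShort_map (rationalForm_rationalEquiv g) (mem_roots_rationalEquiv g)) h

theorem HasFiniteType.unique_longRootSystem {K : Submodule ℤ LambdaO} {s t : BoundaryType}
    (hs : HasFiniteType (rationalForm (quotForm K)) (longRootSystem K) s)
    (ht : HasFiniteType (rationalForm (quotForm K)) (longRootSystem K) t) : s = t :=
  hs.unique (rationalForm_comm (quotForm_comm K)) ht

theorem isPrimitiveIsotropicPlane_cusp (t : BoundaryType) :
    IsPrimitiveIsotropicPlane formO (plane (cusp t)) :=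
  isPrimitiveIsotropicPlane_plane (isPrimitiveVector_cusp t) (form1_cusp t)

theorem hasFiniteType_plane (t : BoundaryType) :
    HasFiniteType (rationalForm (quotForm (plane (cusp t)))) (longRootSystem (plane (cusp t))) t :=
  hasFiniteType_of_isRootBasis (quotForm_comm _) (isRootBasis_planeClass t)

theorem quotForm_plane_pos (t : BoundaryType) (x : PerpQuot formO (plane (cusp t))) (hx : x ≠ 0) :
    0 < quotForm (plane (cusp t)) x x :=
  apply_self_pos_of_isRootBasis (isValid_cuspDatum t) (isRootBasis_planeClass t)
    (eq_zero_of_smul_eq_zero (isPrimitiveVector_cusp t) (form1_cusp t)) hx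

/-- The equivalence with a standard plane gives an isometry of quotients, along which the explicitly
known type is transported. -/
theorem exists_hasFiniteType {K : Submodule ℤ LambdaO} (hK : IsPrimitiveIsotropicPlane formO K) :
    ∃ t, GammaEquivalent K (plane (cusp t)) ∧
      HasFiniteType (rationalForm (quotForm K)) (longRootSystem K) t := by
  obtain ⟨t, h⟩ := exists_gammaEquivalent_cusp hK
  obtain ⟨g⟩ := h.nonempty_isometryEquiv
  exact ⟨t, h, hasFiniteType_of_isometryEquiv g.symm (hasFiniteType_plane t)⟩

theorem quotForm_pos {K : Submodule ℤ LambdaO} (hK : IsPrimitiveIsotropicPlane formO K)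
    (x : PerpQuot formO K) (hx : x ≠ 0) : 0 < quotForm K x x := by
  obtain ⟨t, h⟩ := exists_gammaEquivalent_cusp hK
  obtain ⟨g⟩ := h.nonempty_isometryEquiv
  rw [← g.map_app]
  exact quotForm_plane_pos t _ ((map_ne_zero_iff g g.toLinearEquiv.injective).2 hx)

theorem even_quotForm {K : Submodule ℤ LambdaO} (hK : IsPrimitiveIsotropicPlane formO K)
    (x : PerpQuot formO K) : Even (quotForm K x x) := by
  obtain ⟨t, h⟩ := exists_gammaEquivalent_cusp hK
  obtain ⟨g⟩ := h.nonempty_isometryEquiv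
  rw [← g.map_app]
  exact even_quotForm_plane _

theorem hasFiniteType_iff_of_isometryEquiv {K K' : Submodule ℤ LambdaO}
    (h : Nonempty ((quotForm K).IsometryEquiv (quotForm K'))) (t : BoundaryType) :
    HasFiniteType (rationalForm (quotForm K)) (longRootSystem K) t ↔
      HasFiniteType (rationalForm (quotForm K')) (longRootSystem K') t := by
  obtain ⟨g⟩ := h
  exact ⟨hasFiniteType_of_isometryEquiv g, hasFiniteType_of_isometryEquiv g.symm⟩

/-- Both planes are equivalent to standard planes, and uniqueness of the type makes these two
standard planes the same one. -/
theorem gammaEquivalent_of_hasFiniteType {K K' : Submodule ℤ LambdaO}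
    (hK : IsPrimitiveIsotropicPlane formO K) (hK' : IsPrimitiveIsotropicPlane formO K')
    (h : ∀ t, HasFiniteType (rationalForm (quotForm K)) (longRootSystem K) t ↔
      HasFiniteType (rationalForm (quotForm K')) (longRootSystem K') t) :
    GammaEquivalent K K' := by
  obtain ⟨s, hs, hs'⟩ := exists_hasFiniteType hK
  obtain ⟨t, ht, ht'⟩ := exists_hasFiniteType hK'
  obtain rfl := ((h s).1 hs').unique_longRootSystem ht'
  exact hs.trans ht.symm

end SecondPart

end CubicFourfold

theorem corollary1p5 :
    -- Part 1: orbits of primitive isotropic vectors of `Λ₁` under its orthogonal group.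
    ((∀ v : Lambda1, IsPrimitiveVector v → form1 v v = 0 →
        ∃! t : BoundaryType,
          HasAffineType (rationalForm form1) (rootsPerp form1 v) (toRational v) t) ∧
      (∀ t : BoundaryType, ∃ v : Lambda1, IsPrimitiveVector v ∧ form1 v v = 0 ∧
          HasAffineType (rationalForm form1) (rootsPerp form1 v) (toRational v) t) ∧
      (∀ v w : Lambda1, IsPrimitiveVector v → form1 v v = 0 →
        IsPrimitiveVector w → form1 w w = 0 →
        ((∃ g : form1.IsometryEquiv form1, g v = w) ↔
          ∀ t : BoundaryType,
            HasAffineType (rationalForm form1) (rootsPerp form1 v) (toRational v) t ↔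
            HasAffineType (rationalForm form1) (rootsPerp form1 w) (toRational w) t))) ∧
    -- Part 2: `Γ`-orbits of primitive isotropic sublattices of rank two of `Λ_o`.
    ((∀ K : Submodule ℤ LambdaO, IsPrimitiveIsotropicPlane formO K →
        (∀ x, x ≠ 0 → 0 < quotForm K x x) ∧ (∀ x, Even (quotForm K x x)) ∧
        ∃! t : BoundaryType, HasFiniteType (rationalForm (quotForm K)) (longRootSystem K) t) ∧
      (∀ t : BoundaryType, ∃ K : Submodule ℤ LambdaO, IsPrimitiveIsotropicPlane formO K ∧
          HasFiniteType (rationalForm (quotForm K)) (longRootSystem K) t) ∧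
      (∀ K K' : Submodule ℤ LambdaO, IsPrimitiveIsotropicPlane formO K →
        IsPrimitiveIsotropicPlane formO K' →
        (GammaEquivalent K K' ↔ Nonempty ((quotForm K).IsometryEquiv (quotForm K'))) ∧
        (Nonempty ((quotForm K).IsometryEquiv (quotForm K')) ↔
          ∀ t : BoundaryType,
            HasFiniteType (rationalForm (quotForm K)) (longRootSystem K) t ↔
            HasFiniteType (rationalForm (quotForm K')) (longRootSystem K') t))) := by
  refine ⟨⟨fun v hv hv0 => existsUnique_hasAffineType hv hv0,
    fun t => ⟨cusp t, isPrimitiveVector_cusp t, form1_cusp t, hasAffineType_cusp t⟩,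
    fun v w hv hv0 hw hw0 => exists_isometry_iff_hasAffineType hv hv0 hw hw0⟩,
    fun K hK => ⟨quotForm_pos hK, even_quotForm hK, ?_⟩,
    fun t => ⟨plane (cusp t), isPrimitiveIsotropicPlane_cusp t, hasFiniteType_plane t⟩,
    fun K K' hK hK' => ⟨⟨GammaEquivalent.nonempty_isometryEquiv, fun h => ?_⟩,
      ⟨hasFiniteType_iff_of_isometryEquiv, fun h => ?_⟩⟩⟩
  · obtain ⟨t, -, ht⟩ := exists_hasFiniteType hK
    exact ⟨t, ht, fun s hs => hs.unique_longRootSystem ht⟩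
  · exact gammaEquivalent_of_hasFiniteType hK hK' (hasFiniteType_iff_of_isometryEquiv h)
  · exact (gammaEquivalent_of_hasFiniteType hK hK' h).nonempty_isometryEquiv
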